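/- Let $N\ge 1$, let $\Omega\subset\mathbb R^N$ be a bounded domain (a nonempty connected bounded open set; no regularity of the boundary is needed), let $-\infty<a<b<\infty$, $D=(a,b)\times\Omega$, $\tfrac12<\alpha\le 1$, $s\in(0,1)$, and let $C_{N,s}>0$ be any positive normalisation constant. All functions take values in $\mathbb K=\mathbb R$ or $\mathbb K=\mathbb C$. **The operator in $x$.** For $\beta>0$ put $$I_{a+}^{\beta}g(x)=\frac1{\Gamma(\beta)}\int_a^x (x-t)^{\beta-1}g(t)\,dt,\qquad I_{b-}^{\beta}g(x)=\frac1{\Gamma(\beta)}\int_x^b (t-x)^{\beta-1}g(t)\,dt,$$ and $I_{a+}^0=I_{b-}^0=\mathrm{id}$. Let $D_{a+}^{\alpha}g=\frac{d}{dx}I_{a+}^{1-\alpha}g$ be the left Riemann–Liouville derivative, defined for integrable $g$ for which $I_{a+}^{1-\alpha}g$ is (almost everywhere equal to) an absolutely continuous function on $[a,b]$. Let $\mathcal D_{b-}^{\alpha}u=-I_{b-}^{1-\alpha}u'$ be the right Caputo derivative, defined for absolutely continuous $u$ on $[a,b]$. **The operator in $y$.** For $\varphi\in C_c^\infty(\mathbb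 R^N)$ let $$(-\Delta)^s\varphi(y)=C_{N,s}\,\mathrm{p.v.}\!\int_{\mathbb R^N}\frac{\varphi(y)-\varphi(\xi)}{|y-\xi|^{N+2s}}\,d\xi .$$ For $w,g\in L^2(\Omega)$ we say that $(-\Delta)^sw=g$ in $\Omega$ with $w=0$ in $\mathbb R^N\setminus\Omega$ if the extension of $w$ by zero lies in the closure of $C_c^\infty(\Omega)$ in $H^s(\mathbb R^N)$ (with norm given by the $L^2$ norm plus the Gagliardo seminorm) and $\int_\Omega w\,(-\Delta)^s\varphi\,dy=\int_\Omega g\,\varphi\,dy$ for all $\varphi\in C_c^\infty(\Omega)$. **The Dirichlet operator.** Let $$\mathcal L^{\alpha,s}u=D_{a+,x}^{\alpha}\mathcal D_{b-,x}^{\alpha}u+(-\Delta)^s_y u$$ in $L^2(D)$. Its domain consists of all $u\in L^2(D)$ for which there are $f,g\in L^2(D)$ such that: for almost every $y\in\Omega$, $u(\cdot,y)$ has an absolutely continuous representative on $[a,b]$ vanishing at $a$ and $b$ that satisfies $D_{a+}^{\alpha}\mathcal D_{b-}^{\alpha}u(\cdot,y)=f(\cdot,y)$; and for almost every $x\in(a,b)$,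 $(-\Delta)^su(x,\cdot)=g(x,\cdot)$ in $\Omega$ with $u(x,\cdot)=0$ in $\mathbb R^N\setminus\Omega$, in the sense above. Then $\mathcal L^{\alpha,s}u=f+g$. **Theorem.** The operator $\mathcal L^{\alpha,s}$ is self-adjoint in $L^2(D)$ (in particular densely defined) and positive, that is, $\langle\mathcal L^{\alpha,s}u,u\rangle>0$ for every $u\neq0$ in its domain. Its eigenvalues are real, positive and discrete, and can be arranged in an increasing sequence: there are real numbers $0<\nu_1\le\nu_2\le\cdots$ with $\nu_n\to\infty$ such that the set of eigenvalues of $\mathcal L^{\alpha,s}$ is exactly $\{\nu_n : n\ge1\}$, and there is an orthonormal basis $(e_n)$ of $L^2(D)$ with $e_n$ in the domain and $\mathcal L^{\alpha,s}e_n=\nu_ne_n$ for all $n$. (So each eigenvalue occurs in the sequence as often as its multiplicity, which is finite.) -/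

import Mathlib

open MeasureTheory Set Filter Topology
open scoped ENNReal ContDiff

noncomputable section

namespace FracCyl

variable {𝕜 : Type*} [RCLike 𝕜]

/-! ### One-dimensional fractional calculus on an interval -/

/-- Left Riemann-Liouville fractional integral `I_{a+}^β`, with the convention `I_{a+}^0 = id`. -/
def leftFracInt (β a : ℝ) (g : ℝ → 𝕜) (x : ℝ) : 𝕜 :=
  if β = 0 then g x else (Real.Gamma β)⁻¹ • ∫ t in a..x, ((x - t) ^ (β - 1)) • g t

/-- Right Riemann-Liouville fractional integral `I_{b-}^β`, with the convention `I_{b-}^0 = id`. -/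
def rightFracInt (β b : ℝ) (g : ℝ → 𝕜) (x : ℝ) : 𝕜 :=
  if β = 0 then g x else (Real.Gamma β)⁻¹ • ∫ t in x..b, ((t - x) ^ (β - 1)) • g t

/-- `u` is absolutely continuous on `[a, b]` with almost everywhere derivative `v`, that is, `u` is
a primitive of the Lebesgue integrable function `v`. -/
def HasACDeriv (a b : ℝ) (u v : ℝ → 𝕜) : Prop :=
  IntegrableOn v (Ioo a b) ∧ ∀ x ∈ Icc a b, u x = u a + ∫ t in a..x, v t

/-- `g` is the right Caputo derivative `-I_{b-}^{1-α} u'` of the absolutely continuous function `u`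
on `[a, b]`. -/
def HasRightCaputo (α a b : ℝ) (u g : ℝ → 𝕜) : Prop :=
  ∃ v : ℝ → 𝕜, HasACDeriv a b u v ∧
    g =ᵐ[volume.restrict (Ioo a b)] fun x => -rightFracInt (1 - α) b v x

/-- `f` is the left Riemann-Liouville derivative `(I_{a+}^{1-α} g)'` on `(a, b)` of the integrable
function `g`: the function `I_{a+}^{1-α} g` coincides almost everywhere with an absolutely
continuous function, and `f` is the derivative of the latter. -/
def HasLeftRL (α a b : ℝ) (g f : ℝ → 𝕜) : Prop :=
  IntegrableOn g (Ioo a b) ∧ ∃ w : ℝ → 𝕜, HasACDeriv a b w f ∧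
    leftFracInt (1 - α) a g =ᵐ[volume.restrict (Ioo a b)] w

/-- `D_{a+}^α 𝒟_{b-}^α u = f` on `(a, b)` with `u(a) = u(b) = 0`, for functions `u`, `f` given up to
null sets: `u` has an absolutely continuous representative with these properties. -/
def IsDirichletFracODE (α a b : ℝ) (u f : ℝ → 𝕜) : Prop :=
  ∃ U g : ℝ → 𝕜, u =ᵐ[volume.restrict (Ioo a b)] U ∧ U a = 0 ∧ U b = 0 ∧
    HasRightCaputo α a b U g ∧ HasLeftRL α a b g f

/-! ### The fractional Dirichlet Laplacian on a domain -/

variable {N : ℕ}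

/-- Smooth functions with compact support contained in `Ω`. -/
def IsTestFunction (Ω : Set (EuclideanSpace ℝ (Fin N))) (φ : EuclideanSpace ℝ (Fin N) → 𝕜) :
    Prop :=
  ContDiff ℝ ∞ φ ∧ HasCompactSupport φ ∧ tsupport φ ⊆ Ω

/-- The fractional Laplacian `(-Δ)^s φ (y) = C ∫ (φ(y) - φ(ξ)) / |y - ξ|^{N+2s} dξ`, the singular
integral being taken in the sense of the principal value. It is applied below to smooth compactly
supported functions only, for which the principal value exists at every point. -/
def fracLap (C s : ℝ) (φ : EuclideanSpace ℝ (Fin N) → 𝕜) (y : EuclideanSpace ℝ (Fin N)) : 𝕜 :=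
  limUnder (𝓝[>] (0 : ℝ)) fun ε =>
    C • ∫ ξ in (Metric.ball y ε)ᶜ, (‖y - ξ‖ ^ ((N : ℝ) + 2 * s))⁻¹ • (φ y - φ ξ)

/-- The difference quotient `(w(y) - w(ξ)) / |y - ξ|^{N/2+s}`, whose norm in `L²(ℝᴺ × ℝᴺ)` is the
Gagliardo seminorm of order `s` of `w`. -/
def diffQuot (s : ℝ) (w : EuclideanSpace ℝ (Fin N) → 𝕜)
    (p : EuclideanSpace ℝ (Fin N) × EuclideanSpace ℝ (Fin N)) : 𝕜 :=
  (‖p.1 - p.2‖ ^ ((N : ℝ) / 2 + s))⁻¹ • (w p.1 - w p.2)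

/-- The fractional Sobolev space with homogeneous Dirichlet exterior condition: the closure of the
test functions on `Ω` for the norm of `H^s(ℝᴺ)` (the `L²` norm plus the Gagliardo seminorm). -/
def MemHs0 (s : ℝ) (Ω : Set (EuclideanSpace ℝ (Fin N))) (w : EuclideanSpace ℝ (Fin N) → 𝕜) :
    Prop :=
  AEStronglyMeasurable w volume ∧ ∃ φ : ℕ → EuclideanSpace ℝ (Fin N) → 𝕜,
    (∀ n, IsTestFunction Ω (φ n)) ∧
    Tendsto (fun n => eLpNorm (w - φ n) 2 volume) atTop (𝓝 0) ∧
    Tendsto (fun n => eLpNorm (diffQuot s (w - φ n)) 2 (volume.prod volume)) atTop (𝓝 0)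

/-- `(-Δ)^s w = g` in `Ω` and `w = 0` outside `Ω`, for functions `w`, `g ∈ L²(Ω)`: the extension of
`w` by zero belongs to the fractional Sobolev space with Dirichlet exterior condition, and the
equation holds in `Ω` in the sense of distributions. -/
def IsFracDirichletLap (C s : ℝ) (Ω : Set (EuclideanSpace ℝ (Fin N)))
    (w g : EuclideanSpace ℝ (Fin N) → 𝕜) : Prop :=
  MemHs0 s Ω (Ω.indicator w) ∧ MemLp g 2 (volume.restrict Ω) ∧
    ∀ φ : EuclideanSpace ℝ (Fin N) → 𝕜, IsTestFunction Ω φ →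
      Integrable (fun y => Ω.indicator w y * fracLap C s φ y) ∧
      ∫ y, Ω.indicator w y * fracLap C s φ y = ∫ y in Ω, g y * φ y

/-! ### Linearity and uniqueness for the one-dimensional operator -/

theorem HasACDeriv.add {a b : ℝ} {u₁ v₁ u₂ v₂ : ℝ → 𝕜} (h₁ : HasACDeriv a b u₁ v₁)
    (h₂ : HasACDeriv a b u₂ v₂) : HasACDeriv a b (u₁ + u₂) (v₁ + v₂) := by
  refine ⟨h₁.1.add h₂.1, fun x hx => ?_⟩
  have hi : ∀ v : ℝ → 𝕜, IntegrableOn v (Ioo a b) → IntervalIntegrable v volume a x := by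
    intro v hv
    rw [intervalIntegrable_iff_integrableOn_Ioo_of_le hx.1]
    exact hv.mono_set (Ioo_subset_Ioo_right hx.2)
  simp only [Pi.add_apply]
  rw [h₁.2 x hx, h₂.2 x hx, intervalIntegral.integral_add (hi _ h₁.1) (hi _ h₂.1)]
  ring

theorem HasACDeriv.smul {a b : ℝ} {u v : ℝ → 𝕜} (c : 𝕜) (h : HasACDeriv a b u v) :
    HasACDeriv a b (c • u) (c • v) := by
  refine ⟨h.1.smul c, fun x hx => ?_⟩
  simp only [Pi.smul_apply]
  rw [h.2 x hx, intervalIntegral.integral_smul, smul_add]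

theorem HasACDeriv.congr {a b : ℝ} {u v v' : ℝ → 𝕜} (h : HasACDeriv a b u v)
    (hv : v =ᵐ[volume.restrict (Ioo a b)] v') : HasACDeriv a b u v' := by
  refine ⟨h.1.congr hv, fun x hx => ?_⟩
  rw [h.2 x hx]
  congr 1
  rw [intervalIntegral.integral_of_le hx.1, intervalIntegral.integral_of_le hx.1,
    integral_Ioc_eq_integral_Ioo, integral_Ioc_eq_integral_Ioo]
  exact integral_congr_ae (ae_mono (Measure.restrict_mono (Ioo_subset_Ioo_right hx.2) le_rfl) hv)

theorem HasACDeriv.continuousOn {a b : ℝ} (hab : a < b) {u v : ℝ → 𝕜} (h : HasACDeriv a b u v) :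
    ContinuousOn u (Icc a b) := by
  have hi : IntegrableOn v (uIcc a b) := by
    rw [uIcc_of_le hab.le, integrableOn_Icc_iff_integrableOn_Ioo]; exact h.1
  have := intervalIntegral.continuousOn_primitive_interval (μ := volume) hi
  rw [uIcc_of_le hab.le] at this
  exact (continuousOn_const.add this).congr h.2

/-- The derivative is determined almost everywhere by the function almost everywhere. -/
theorem HasACDeriv.ae_eq_zero {a b : ℝ} (hab : a < b) {u v : ℝ → 𝕜} (h : HasACDeriv a b u v)
    (hu : u =ᵐ[volume.restrict (Ioo a b)] 0) : v =ᵐ[volume.restrict (Ioo a b)] 0 := by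
  have h0 : EqOn u 0 (Ioo a b) :=
    Measure.eqOn_open_of_ae_eq hu isOpen_Ioo
      ((h.continuousOn hab).mono Ioo_subset_Icc_self) continuousOn_const
  have hi : IntervalIntegrable v volume a b := by
    rw [intervalIntegrable_iff_integrableOn_Ioo_of_le hab.le]; exact h.1
  have hd := hi.ae_hasDerivAt_integral
  rw [EventuallyEq, ae_restrict_iff' measurableSet_Ioo]
  filter_upwards [hd] with x hx hxm
  have hx' := hx (by rw [uIcc_of_le hab.le]; exact Ioo_subset_Icc_self hxm) a (by simp)
  have hc : HasDerivAt (fun y => ∫ t in a..y, v t) 0 x := by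
    refine (hasDerivAt_const x (-u a)).congr_of_eventuallyEq ?_
    filter_upwards [isOpen_Ioo.mem_nhds hxm] with y hy
    have h1 := h.2 y (Ioo_subset_Icc_self hy)
    rw [h0 hy] at h1
    simp only [Pi.zero_apply] at h1
    linear_combination -h1
  exact hx'.unique hc

theorem ae_integrable_mul_kernel {k : ℝ → ℝ} {G : ℝ → 𝕜} (hk : Integrable k) (hG : Integrable G) :
    (∀ᵐ x : ℝ, Integrable fun t => k (x - t) • G t) ∧
      Integrable fun x : ℝ => ∫ t, k (x - t) • G t := by
  have h1 := hG.ae_convolution_exists (ContinuousLinearMap.lsmul ℝ ℝ (E := 𝕜)).flip hk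
  have h2 := hG.integrable_convolution (ContinuousLinearMap.lsmul ℝ ℝ (E := 𝕜)).flip hk
  exact ⟨h1, h2⟩

theorem integrable_kernel {β : ℝ} (hβ : 0 < β) {c : ℝ} (hc : 0 < c) :
    Integrable ((Ioo 0 c).indicator fun t : ℝ => t ^ (β - 1)) := by
  rw [integrable_indicator_iff measurableSet_Ioo,
    ← intervalIntegrable_iff_integrableOn_Ioo_of_le hc.le]
  exact intervalIntegral.intervalIntegrable_rpow' (by linarith)

/-- The right fractional integral of an integrable function is absolutely convergent almost
everywhere, and integrable. -/
theorem rightFracInt_aux {a b β : ℝ} (hab : a < b) (hβ : 0 < β) {g : ℝ → 𝕜}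
    (hg : IntegrableOn g (Ioo a b)) :
    (∀ᵐ x ∂volume.restrict (Ioo a b),
      IntervalIntegrable (fun t => ((t - x) ^ (β - 1)) • g t) volume x b) ∧
      IntegrableOn (fun x => ∫ t in x..b, ((t - x) ^ (β - 1)) • g t) (Ioo a b) := by
  obtain ⟨h1, h2⟩ := ae_integrable_mul_kernel (integrable_kernel hβ (sub_pos.2 hab)).comp_neg
    ((integrable_indicator_iff measurableSet_Ioo).2 hg)
  have key : ∀ x ∈ Ioo a b, (fun t => (Ioo 0 (b - a)).indicator (fun t : ℝ => t ^ (β - 1))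
      (-(x - t)) • (Ioo a b).indicator g t) =
        (Ioo x b).indicator fun t => ((t - x) ^ (β - 1)) • g t := by
    intro x hx
    funext t
    by_cases ht : t ∈ Ioo x b
    · have e1 : -(x - t) ∈ Ioo 0 (b - a) := ⟨by linarith [ht.1], by linarith [ht.2, hx.1]⟩
      have e2 : t ∈ Ioo a b := ⟨by linarith [ht.1, hx.1], ht.2⟩
      rw [indicator_of_mem ht, indicator_of_mem e1, indicator_of_mem e2, neg_sub]
    · rw [indicator_of_notMem ht]
      by_cases e2 : t ∈ Ioo a b
      · have e1 : -(x - t) ∉ Ioo 0 (b - a) := fun h => ht ⟨by linarith [h.1], e2.2⟩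
        rw [indicator_of_notMem e1, zero_smul]
      · rw [indicator_of_notMem e2, smul_zero]
  constructor
  · rw [ae_restrict_iff' measurableSet_Ioo]
    filter_upwards [h1] with x hx hxm
    rw [intervalIntegrable_iff_integrableOn_Ioo_of_le hxm.2.le,
      ← integrable_indicator_iff measurableSet_Ioo, ← key x hxm]
    exact hx
  · refine h2.integrableOn.congr_fun (fun x hx => ?_) measurableSet_Ioo
    simp only
    rw [key x hx, integral_indicator measurableSet_Ioo, intervalIntegral.integral_of_le hx.2.le,
      integral_Ioc_eq_integral_Ioo]

/-- The left fractional integral of an integrable function is absolutely convergent almost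
everywhere. -/
theorem leftFracInt_aux {a b β : ℝ} (hab : a < b) (hβ : 0 < β) {g : ℝ → 𝕜}
    (hg : IntegrableOn g (Ioo a b)) :
    ∀ᵐ x ∂volume.restrict (Ioo a b),
      IntervalIntegrable (fun t => ((x - t) ^ (β - 1)) • g t) volume a x := by
  obtain ⟨h1, -⟩ := ae_integrable_mul_kernel (integrable_kernel hβ (sub_pos.2 hab))
    ((integrable_indicator_iff measurableSet_Ioo).2 hg)
  rw [ae_restrict_iff' measurableSet_Ioo]
  filter_upwards [h1] with x hx hxm
  rw [intervalIntegrable_iff_integrableOn_Ioo_of_le hxm.1.le,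
    ← integrable_indicator_iff measurableSet_Ioo]
  refine hx.congr (Eventually.of_forall fun t => ?_)
  by_cases ht : t ∈ Ioo a x
  · have e1 : x - t ∈ Ioo 0 (b - a) := ⟨by linarith [ht.2], by linarith [ht.1, hxm.2]⟩
    have e2 : t ∈ Ioo a b := ⟨ht.1, by linarith [ht.2, hxm.2]⟩
    simp only [indicator_of_mem ht, indicator_of_mem e1, indicator_of_mem e2]
  · rw [indicator_of_notMem ht]
    by_cases e2 : t ∈ Ioo a b
    · have e1 : x - t ∉ Ioo 0 (b - a) := fun h => ht ⟨e2.1, by linarith [h.1]⟩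
      simp only [indicator_of_notMem e1, zero_smul]
    · simp only [indicator_of_notMem e2, smul_zero]

theorem rightFracInt_add {a b β : ℝ} (hab : a < b) (hβ : 0 ≤ β) {g₁ g₂ : ℝ → 𝕜}
    (h₁ : IntegrableOn g₁ (Ioo a b)) (h₂ : IntegrableOn g₂ (Ioo a b)) :
    rightFracInt β b (g₁ + g₂) =ᵐ[volume.restrict (Ioo a b)]
      rightFracInt β b g₁ + rightFracInt β b g₂ := by
  rcases hβ.eq_or_lt with rfl | hβ
  · exact Eventually.of_forall fun x => by simp [rightFracInt]
  filter_upwards [(rightFracInt_aux hab hβ h₁).1, (rightFracInt_aux hab hβ h₂).1] with x e₁ e₂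
  simp only [rightFracInt, hβ.ne', if_false, Pi.add_apply, smul_add]
  rw [intervalIntegral.integral_add e₁ e₂, smul_add]

theorem leftFracInt_add {a b β : ℝ} (hab : a < b) (hβ : 0 ≤ β) {g₁ g₂ : ℝ → 𝕜}
    (h₁ : IntegrableOn g₁ (Ioo a b)) (h₂ : IntegrableOn g₂ (Ioo a b)) :
    leftFracInt β a (g₁ + g₂) =ᵐ[volume.restrict (Ioo a b)]
      leftFracInt β a g₁ + leftFracInt β a g₂ := by
  rcases hβ.eq_or_lt with rfl | hβ
  · exact Eventually.of_forall fun x => by simp [leftFracInt]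
  filter_upwards [leftFracInt_aux hab hβ h₁, leftFracInt_aux hab hβ h₂] with x e₁ e₂
  simp only [leftFracInt, hβ.ne', if_false, Pi.add_apply, smul_add]
  rw [intervalIntegral.integral_add e₁ e₂, smul_add]

theorem rightFracInt_smul (β b : ℝ) (c : 𝕜) (g : ℝ → 𝕜) :
    rightFracInt β b (c • g) = c • rightFracInt β b g := by
  funext x
  simp only [rightFracInt, Pi.smul_apply]
  split_ifs
  · rfl
  · simp_rw [smul_comm _ c]
    rw [intervalIntegral.integral_smul, smul_comm]

theorem leftFracInt_smul (β a : ℝ) (c : 𝕜) (g : ℝ → 𝕜) :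
    leftFracInt β a (c • g) = c • leftFracInt β a g := by
  funext x
  simp only [leftFracInt, Pi.smul_apply]
  split_ifs
  · rfl
  · simp_rw [smul_comm _ c]
    rw [intervalIntegral.integral_smul, smul_comm]

theorem rightFracInt_ae_eq_zero {a b β : ℝ} {g : ℝ → 𝕜}
    (hg : g =ᵐ[volume.restrict (Ioo a b)] 0) :
    rightFracInt β b g =ᵐ[volume.restrict (Ioo a b)] 0 := by
  filter_upwards [hg, ae_restrict_mem measurableSet_Ioo] with x hx hxm
  simp only [rightFracInt]
  split_ifs
  · exact hx
  · rw [intervalIntegral.integral_of_le hxm.2.le, integral_Ioc_eq_integral_Ioo,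
      integral_eq_zero_of_ae, smul_zero, Pi.zero_apply]
    have := ae_mono (Measure.restrict_mono (Ioo_subset_Ioo_left hxm.1.le) le_rfl) hg
    filter_upwards [this] with t ht
    rw [ht]; simp

theorem leftFracInt_ae_eq_zero {a b β : ℝ} {g : ℝ → 𝕜}
    (hg : g =ᵐ[volume.restrict (Ioo a b)] 0) :
    leftFracInt β a g =ᵐ[volume.restrict (Ioo a b)] 0 := by
  filter_upwards [hg, ae_restrict_mem measurableSet_Ioo] with x hx hxm
  simp only [leftFracInt]
  split_ifs
  · exact hx
  · rw [intervalIntegral.integral_of_le hxm.1.le, integral_Ioc_eq_integral_Ioo,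
      integral_eq_zero_of_ae, smul_zero, Pi.zero_apply]
    have := ae_mono (Measure.restrict_mono (Ioo_subset_Ioo_right hxm.2.le) le_rfl) hg
    filter_upwards [this] with t ht
    rw [ht]; simp

theorem IsDirichletFracODE.congr {α a b : ℝ} {u u' f f' : ℝ → 𝕜}
    (h : IsDirichletFracODE α a b u f) (hu : u =ᵐ[volume.restrict (Ioo a b)] u')
    (hf : f =ᵐ[volume.restrict (Ioo a b)] f') : IsDirichletFracODE α a b u' f' := by
  obtain ⟨U, g, h1, h2, h3, h4, hg, w, hw, hw'⟩ := h
  exact ⟨U, g, hu.symm.trans h1, h2, h3, h4, hg, w, hw.congr hf, hw'⟩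

theorem IsDirichletFracODE.add {α a b : ℝ} (hα : α ≤ 1) (hab : a < b) {u₁ u₂ f₁ f₂ : ℝ → 𝕜}
    (h₁ : IsDirichletFracODE α a b u₁ f₁) (h₂ : IsDirichletFracODE α a b u₂ f₂) :
    IsDirichletFracODE α a b (u₁ + u₂) (f₁ + f₂) := by
  obtain ⟨U, g, e1, e2, e3, ⟨v, hv, hgv⟩, hg, w, hw, hw'⟩ := h₁
  obtain ⟨U', g', e1', e2', e3', ⟨v', hv', hgv'⟩, hg', w', hww, hww'⟩ := h₂
  refine ⟨U + U', g + g', e1.add e1', by simp [e2, e2'], by simp [e3, e3'],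
    ⟨v + v', hv.add hv', ?_⟩, hg.add hg', w + w', hw.add hww, ?_⟩
  · filter_upwards [hgv, hgv', rightFracInt_add hab (sub_nonneg.2 hα) hv.1 hv'.1] with x a1 a2 a3
    rw [Pi.add_apply, a1, a2, a3, Pi.add_apply, neg_add]
  · exact (leftFracInt_add hab (sub_nonneg.2 hα) hg hg').trans (hw'.add hww')

theorem IsDirichletFracODE.smul {α a b : ℝ} {u f : ℝ → 𝕜} (c : 𝕜)
    (h : IsDirichletFracODE α a b u f) : IsDirichletFracODE α a b (c • u) (c • f) := by
  obtain ⟨U, g, e1, e2, e3, ⟨v, hv, hgv⟩, hg, w, hw, hw'⟩ := h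
  refine ⟨c • U, c • g, e1.const_smul c, by simp [e2], by simp [e3],
    ⟨c • v, hv.smul c, ?_⟩, hg.smul c, c • w, hw.smul c, ?_⟩
  · filter_upwards [hgv] with x a1
    rw [Pi.smul_apply, a1, rightFracInt_smul, Pi.smul_apply, smul_neg]
  · rw [leftFracInt_smul]
    exact hw'.const_smul c

theorem isDirichletFracODE_zero (α a b : ℝ) : IsDirichletFracODE α a b (0 : ℝ → 𝕜) 0 := by
  have hz : HasACDeriv a b (0 : ℝ → 𝕜) 0 := ⟨integrableOn_zero, fun x _ => by simp⟩
  refine ⟨0, 0, ae_eq_rfl, rfl, rfl, ⟨0, hz, ?_⟩, integrableOn_zero, 0, hz,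
    leftFracInt_ae_eq_zero ae_eq_rfl⟩
  filter_upwards [rightFracInt_ae_eq_zero (𝕜 := 𝕜) (β := 1 - α) (a := a) (b := b) ae_eq_rfl]
    with x hx
  rw [hx]; simp

/-- The value of the one-dimensional operator is determined almost everywhere. -/
theorem IsDirichletFracODE.ae_eq_zero {α a b : ℝ} (hab : a < b) {u f : ℝ → 𝕜}
    (h : IsDirichletFracODE α a b u f) (hu : u =ᵐ[volume.restrict (Ioo a b)] 0) :
    f =ᵐ[volume.restrict (Ioo a b)] 0 := by
  obtain ⟨U, g, e1, e2, e3, ⟨v, hv, hgv⟩, hg, w, hw, hw'⟩ := h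
  have hv0 := hv.ae_eq_zero hab (e1.symm.trans hu)
  have hg0 : g =ᵐ[volume.restrict (Ioo a b)] 0 := by
    filter_upwards [hgv, rightFracInt_ae_eq_zero (β := 1 - α) hv0] with x a1 a2
    rw [a1, a2]; simp
  exact hw.ae_eq_zero hab (hw'.symm.trans (leftFracInt_ae_eq_zero hg0))

/-! ### Linearity and uniqueness for the fractional Dirichlet Laplacian -/

variable {C s : ℝ} {Ω : Set (EuclideanSpace ℝ (Fin N))}

theorem aestronglyMeasurable_diffQuot (s : ℝ) {w : EuclideanSpace ℝ (Fin N) → 𝕜}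
    (hw : AEStronglyMeasurable w volume) :
    AEStronglyMeasurable (diffQuot s w) (volume.prod volume) := by
  refine AEStronglyMeasurable.smul ?_ (hw.comp_fst.sub hw.comp_snd)
  exact (Measurable.inv (by fun_prop)).aestronglyMeasurable

theorem IsTestFunction.zero (Ω : Set (EuclideanSpace ℝ (Fin N))) :
    IsTestFunction Ω (0 : EuclideanSpace ℝ (Fin N) → 𝕜) :=
  ⟨contDiff_zero_fun, HasCompactSupport.zero, by simp [tsupport]⟩

theorem IsTestFunction.add {φ ψ : EuclideanSpace ℝ (Fin N) → 𝕜} (h₁ : IsTestFunction Ω φ)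
    (h₂ : IsTestFunction Ω ψ) : IsTestFunction Ω (φ + ψ) :=
  ⟨h₁.1.add h₂.1, h₁.2.1.add h₂.2.1,
    (tsupport_add φ ψ).trans (union_subset h₁.2.2 h₂.2.2)⟩

theorem IsTestFunction.smul {φ : EuclideanSpace ℝ (Fin N) → 𝕜} (c : 𝕜)
    (h : IsTestFunction Ω φ) : IsTestFunction Ω (c • φ) :=
  ⟨contDiff_const.smul h.1, h.2.1.smul_left (f := fun _ => c),
    (tsupport_smul_subset_right (fun _ => c) φ).trans h.2.2⟩

theorem MemHs0.add {w₁ w₂ : EuclideanSpace ℝ (Fin N) → 𝕜} (h₁ : MemHs0 s Ω w₁)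
    (h₂ : MemHs0 s Ω w₂) : MemHs0 s Ω (w₁ + w₂) := by
  obtain ⟨m₁, φ, t₁, a₁, b₁⟩ := h₁
  obtain ⟨m₂, ψ, t₂, a₂, b₂⟩ := h₂
  have mφ : ∀ n, AEStronglyMeasurable (w₁ - φ n) volume := fun n =>
    m₁.sub (t₁ n).1.continuous.aestronglyMeasurable
  have mψ : ∀ n, AEStronglyMeasurable (w₂ - ψ n) volume := fun n =>
    m₂.sub (t₂ n).1.continuous.aestronglyMeasurable
  refine ⟨m₁.add m₂, fun n => φ n + ψ n, fun n => (t₁ n).add (t₂ n), ?_, ?_⟩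
  · refine tendsto_of_tendsto_of_tendsto_of_le_of_le tendsto_const_nhds
      (by simpa using a₁.add a₂) (fun _ => zero_le) fun n => ?_
    rw [add_sub_add_comm]
    exact eLpNorm_add_le (mφ n) (mψ n) (by norm_num)
  · refine tendsto_of_tendsto_of_tendsto_of_le_of_le tendsto_const_nhds
      (by simpa using b₁.add b₂) (fun _ => zero_le) fun n => ?_
    have : diffQuot s (w₁ + w₂ - (φ n + ψ n)) =
        diffQuot s (w₁ - φ n) + diffQuot s (w₂ - ψ n) := by
      funext p
      simp only [diffQuot, Pi.add_apply, Pi.sub_apply, ← smul_add]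
      congr 1; ring
    simp only [this]
    exact eLpNorm_add_le (aestronglyMeasurable_diffQuot s (mφ n))
      (aestronglyMeasurable_diffQuot s (mψ n)) (by norm_num)

theorem MemHs0.smul {w : EuclideanSpace ℝ (Fin N) → 𝕜} (c : 𝕜) (h : MemHs0 s Ω w) :
    MemHs0 s Ω (c • w) := by
  obtain ⟨m, φ, t, ha, hb⟩ := h
  refine ⟨m.const_smul c, fun n => c • φ n, fun n => (t n).smul c, ?_, ?_⟩
  · simp_rw [← smul_sub, eLpNorm_const_smul]
    simpa using ENNReal.Tendsto.const_mul ha (Or.inr enorm_ne_top)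
  · have : ∀ n, diffQuot s (c • w - c • φ n) = c • diffQuot s (w - φ n) := by
      intro n
      funext p
      simp only [diffQuot, Pi.smul_apply, Pi.sub_apply, ← smul_sub]
      rw [smul_comm]
    simp_rw [this, eLpNorm_const_smul]
    simpa using ENNReal.Tendsto.const_mul hb (Or.inr enorm_ne_top)

theorem memHs0_zero : MemHs0 s Ω (0 : EuclideanSpace ℝ (Fin N) → 𝕜) := by
  refine ⟨aestronglyMeasurable_zero, fun _ => 0, fun _ => IsTestFunction.zero Ω, by simp, ?_⟩
  have : diffQuot s (0 : EuclideanSpace ℝ (Fin N) → 𝕜) = 0 := by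
    funext p; simp [diffQuot]
  simp [this]

theorem MemHs0.congr {w w' : EuclideanSpace ℝ (Fin N) → 𝕜} (h : MemHs0 s Ω w)
    (hw : w =ᵐ[volume] w') : MemHs0 s Ω w' := by
  obtain ⟨m, φ, t, ha, hb⟩ := h
  refine ⟨m.congr hw, φ, t, ?_, ?_⟩
  · refine ha.congr fun n => eLpNorm_congr_ae (hw.sub ae_eq_rfl)
  · refine hb.congr fun n => eLpNorm_congr_ae ?_
    have h1 := Measure.quasiMeasurePreserving_fst (μ := (volume : Measure (EuclideanSpace ℝ (Fin N))))
      (ν := (volume : Measure (EuclideanSpace ℝ (Fin N)))) |>.ae hw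
    have h2 := Measure.quasiMeasurePreserving_snd (μ := (volume : Measure (EuclideanSpace ℝ (Fin N))))
      (ν := (volume : Measure (EuclideanSpace ℝ (Fin N)))) |>.ae hw
    filter_upwards [h1, h2] with p e1 e2
    simp only [diffQuot, Pi.sub_apply, e1, e2]

theorem IsTestFunction.memLp {φ : EuclideanSpace ℝ (Fin N) → 𝕜} (h : IsTestFunction Ω φ) :
    MemLp φ 2 (volume.restrict Ω) :=
  (h.1.continuous.memLp_of_hasCompactSupport h.2.1).restrict Ω

theorem IsFracDirichletLap.congr (hΩ : IsOpen Ω) {w w' g g' : EuclideanSpace ℝ (Fin N) → 𝕜}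
    (h : IsFracDirichletLap C s Ω w g) (hw : w =ᵐ[volume.restrict Ω] w')
    (hg : g =ᵐ[volume.restrict Ω] g') : IsFracDirichletLap C s Ω w' g' := by
  have hw' := (ae_eq_restrict_iff_indicator_ae_eq hΩ.measurableSet).1 hw
  refine ⟨h.1.congr hw', h.2.1.ae_eq hg, fun φ hφ => ?_⟩
  obtain ⟨h1, h2⟩ := h.2.2 φ hφ
  have e1 : (fun y => Ω.indicator w y * fracLap C s φ y) =ᵐ[volume]
      fun y => Ω.indicator w' y * fracLap C s φ y := hw'.mul ae_eq_rfl
  refine ⟨h1.congr e1, ?_⟩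
  rw [← integral_congr_ae e1, h2]
  exact integral_congr_ae (hg.mul ae_eq_rfl)

theorem IsFracDirichletLap.add {w₁ w₂ g₁ g₂ : EuclideanSpace ℝ (Fin N) → 𝕜}
    (h₁ : IsFracDirichletLap C s Ω w₁ g₁) (h₂ : IsFracDirichletLap C s Ω w₂ g₂) :
    IsFracDirichletLap C s Ω (w₁ + w₂) (g₁ + g₂) := by
  have e : Ω.indicator (w₁ + w₂) = Ω.indicator w₁ + Ω.indicator w₂ := indicator_add' Ω w₁ w₂
  refine ⟨e ▸ h₁.1.add h₂.1, h₁.2.1.add h₂.2.1, fun φ hφ => ?_⟩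
  obtain ⟨a1, a2⟩ := h₁.2.2 φ hφ
  obtain ⟨b1, b2⟩ := h₂.2.2 φ hφ
  simp only [e, Pi.add_apply, add_mul]
  refine ⟨a1.add b1, ?_⟩
  rw [integral_add a1 b1, a2, b2]
  exact (integral_add (h₁.2.1.integrable_mul hφ.memLp) (h₂.2.1.integrable_mul hφ.memLp)).symm

theorem IsFracDirichletLap.smul {w g : EuclideanSpace ℝ (Fin N) → 𝕜} (c : 𝕜)
    (h : IsFracDirichletLap C s Ω w g) : IsFracDirichletLap C s Ω (c • w) (c • g) := by
  have e : Ω.indicator (c • w) = c • Ω.indicator w := indicator_const_smul Ω c w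
  refine ⟨e ▸ h.1.smul c, h.2.1.const_smul c, fun φ hφ => ?_⟩
  obtain ⟨a1, a2⟩ := h.2.2 φ hφ
  simp only [e, Pi.smul_apply, smul_eq_mul, mul_assoc]
  exact ⟨a1.const_mul c, by rw [integral_const_mul, a2, integral_const_mul]⟩

theorem isFracDirichletLap_zero :
    IsFracDirichletLap C s Ω (0 : EuclideanSpace ℝ (Fin N) → 𝕜) 0 := by
  have e : Ω.indicator (0 : EuclideanSpace ℝ (Fin N) → 𝕜) = 0 := by
    funext y; simp
  refine ⟨by rw [e]; exact memHs0_zero, MemLp.zero, fun φ _ => ?_⟩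
  simp [e]

/-- The value of the fractional Dirichlet Laplacian is determined almost everywhere. -/
theorem IsFracDirichletLap.ae_eq_zero (hΩ : IsOpen Ω) {w g : EuclideanSpace ℝ (Fin N) → 𝕜}
    (h : IsFracDirichletLap C s Ω w g) (hw : w =ᵐ[volume.restrict Ω] 0) :
    g =ᵐ[volume.restrict Ω] 0 := by
  rw [EventuallyEq, ae_restrict_iff' hΩ.measurableSet]
  have hloc : LocallyIntegrableOn g Ω volume :=
    locallyIntegrableOn_of_locallyIntegrable_restrict (h.2.1.locallyIntegrable (by norm_num))
  refine hΩ.ae_eq_zero_of_integral_contDiff_smul_eq_zero hloc fun φ h1 h2 h3 => ?_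
  have hφ : IsTestFunction Ω fun y => (φ y : 𝕜) := by
    refine ⟨(RCLike.ofRealCLM (K := 𝕜)).contDiff.comp h1, h2.comp_left (g := RCLike.ofReal) (by simp),
      ?_⟩
    exact (closure_mono (Function.support_comp_subset (g := (RCLike.ofReal : ℝ → 𝕜)) (by simp) φ)).trans h3
  have hw' := (ae_eq_restrict_iff_indicator_ae_eq hΩ.measurableSet).1 hw
  have h4 := (h.2.2 _ hφ).2
  have h5 : ∫ y, Ω.indicator w y * fracLap C s (fun y => (φ y : 𝕜)) y = 0 := by
    refine integral_eq_zero_of_ae ?_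
    filter_upwards [hw'] with y hy
    rw [hy]; simp
  rw [h5] at h4
  rw [← setIntegral_eq_integral_of_forall_compl_eq_zero (s := Ω)
    (fun y hy => by rw [image_eq_zero_of_notMem_tsupport (fun hm => hy (h3 hm)), zero_smul]), h4]
  refine integral_congr_ae (Eventually.of_forall fun y => ?_)
  simp only [RCLike.real_smul_eq_coe_mul, mul_comm]

/-! ### The operator on the cylinder -/

/-- The Hilbert space `L²(D)` on the cylinder `D = (a, b) × Ω`. -/
abbrev L2Cyl (𝕜 : Type*) [RCLike 𝕜] (a b : ℝ) (Ω : Set (EuclideanSpace ℝ (Fin N))) : Type _ :=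
  Lp 𝕜 2 ((volume : Measure (ℝ × EuclideanSpace ℝ (Fin N))).restrict (Ioo a b ×ˢ Ω))

/-- `D_{a+,x}^α 𝒟_{b-,x}^α u = f` in `L²(D)` with `u(a, y) = u(b, y) = 0`: for almost every
`y ∈ Ω` the function `u(·, y)` solves the one-dimensional problem. -/
def IsXPart (α : ℝ) {a b : ℝ} {Ω : Set (EuclideanSpace ℝ (Fin N))} (u f : L2Cyl 𝕜 a b Ω) : Prop :=
  ∀ᵐ y ∂volume.restrict Ω, IsDirichletFracODE α a b (fun x => u (x, y)) fun x => f (x, y)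

/-- `(-Δ)_y^s u = g` in `L²(D)` with `u(x, y) = 0` for `y ∉ Ω`: for almost every `x ∈ (a, b)` the
function `u(x, ·)` solves the Dirichlet problem on `Ω`. -/
def IsYPart (C s : ℝ) {a b : ℝ} {Ω : Set (EuclideanSpace ℝ (Fin N))} (u g : L2Cyl 𝕜 a b Ω) : Prop :=
  ∀ᵐ x ∂volume.restrict (Ioo a b), IsFracDirichletLap C s Ω (fun y => u (x, y)) fun y => g (x, y)

theorem slices_x {a b : ℝ} {u v : ℝ × EuclideanSpace ℝ (Fin N) → 𝕜}
    (h : u =ᵐ[volume.restrict (Ioo a b ×ˢ Ω)] v) :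
    ∀ᵐ y ∂volume.restrict Ω,
      (fun x => u (x, y)) =ᵐ[volume.restrict (Ioo a b)] fun x => v (x, y) := by
  rw [Measure.volume_eq_prod, ← Measure.prod_restrict] at h
  exact Measure.ae_ae_of_ae_prod
    ((Measure.measurePreserving_swap (μ := (volume : Measure (EuclideanSpace ℝ (Fin N))).restrict Ω)
      (ν := (volume : Measure ℝ).restrict (Ioo a b))).quasiMeasurePreserving.ae h)

theorem slices_y {a b : ℝ} {u v : ℝ × EuclideanSpace ℝ (Fin N) → 𝕜}
    (h : u =ᵐ[volume.restrict (Ioo a b ×ˢ Ω)] v) :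
    ∀ᵐ x ∂volume.restrict (Ioo a b),
      (fun y => u (x, y)) =ᵐ[volume.restrict Ω] fun y => v (x, y) := by
  rw [Measure.volume_eq_prod, ← Measure.prod_restrict] at h
  exact Measure.ae_ae_of_ae_prod h

/-- The graph of `L^{α,s} = D_{a+,x}^α 𝒟_{b-,x}^α + (-Δ)_y^s` with Dirichlet conditions, on its
natural domain in `L²(D)`: all `u` for which both terms are defined as elements of `L²(D)`. -/
def dirichletGraph {α a b : ℝ} (C s : ℝ) {Ω : Set (EuclideanSpace ℝ (Fin N))} (hα : α ≤ 1)
    (hab : a < b) (hΩ : IsOpen Ω) : Submodule 𝕜 (L2Cyl 𝕜 a b Ω × L2Cyl 𝕜 a b Ω) where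
  carrier := {p | ∃ f g : L2Cyl 𝕜 a b Ω, IsXPart α p.1 f ∧ IsYPart C s p.1 g ∧ p.2 = f + g}
  zero_mem' := by
    refine ⟨0, 0, ?_, ?_, by simp⟩
    · filter_upwards [slices_x (Lp.coeFn_zero 𝕜 2
        ((volume : Measure (ℝ × EuclideanSpace ℝ (Fin N))).restrict (Ioo a b ×ˢ Ω)))] with y hy
      exact (isDirichletFracODE_zero α a b).congr hy.symm hy.symm
    · filter_upwards [slices_y (Lp.coeFn_zero 𝕜 2
        ((volume : Measure (ℝ × EuclideanSpace ℝ (Fin N))).restrict (Ioo a b ×ˢ Ω)))] with x hx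
      exact isFracDirichletLap_zero.congr hΩ hx.symm hx.symm
  add_mem' := by
    rintro ⟨u, -⟩ ⟨u', -⟩ ⟨f, g, hf, hg, rfl⟩ ⟨f', g', hf', hg', rfl⟩
    refine ⟨f + f', g + g', ?_, ?_, add_add_add_comm f g f' g'⟩
    · filter_upwards [hf, hf', slices_x (Lp.coeFn_add u u'), slices_x (Lp.coeFn_add f f')]
        with y a1 a2 a3 a4
      exact (a1.add hα hab a2).congr a3.symm a4.symm
    · filter_upwards [hg, hg', slices_y (Lp.coeFn_add u u'), slices_y (Lp.coeFn_add g g')]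
        with y a1 a2 a3 a4
      exact (a1.add a2).congr hΩ a3.symm a4.symm
  smul_mem' := by
    rintro c ⟨u, -⟩ ⟨f, g, hf, hg, rfl⟩
    refine ⟨c • f, c • g, ?_, ?_, smul_add c f g⟩
    · filter_upwards [hf, slices_x (Lp.coeFn_smul c u), slices_x (Lp.coeFn_smul c f)]
        with y a1 a3 a4
      exact (a1.smul c).congr a3.symm a4.symm
    · filter_upwards [hg, slices_y (Lp.coeFn_smul c u), slices_y (Lp.coeFn_smul c g)]
        with y a1 a3 a4
      exact (a1.smul c).congr hΩ a3.symm a4.symm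

theorem ae_zero_of_slices_x {a b : ℝ} {f : ℝ × EuclideanSpace ℝ (Fin N) → 𝕜} (hf : Measurable f)
    (h : ∀ᵐ y ∂volume.restrict Ω, (fun x => f (x, y)) =ᵐ[volume.restrict (Ioo a b)] 0) :
    f =ᵐ[volume.restrict (Ioo a b ×ˢ Ω)] 0 := by
  rw [Measure.volume_eq_prod, ← Measure.prod_restrict]
  have h2 : MeasurableSet {z : EuclideanSpace ℝ (Fin N) × ℝ | f (z.2, z.1) = 0} :=
    (hf.comp measurable_swap) (measurableSet_singleton 0)
  exact (Measure.measurePreserving_swap (ν := (volume : Measure (EuclideanSpace ℝ (Fin N))).restrict Ω)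
    (μ := (volume : Measure ℝ).restrict (Ioo a b))).quasiMeasurePreserving.ae
      ((Measure.ae_prod_iff_ae_ae h2).2 h)

theorem ae_zero_of_slices_y {a b : ℝ} {f : ℝ × EuclideanSpace ℝ (Fin N) → 𝕜} (hf : Measurable f)
    (h : ∀ᵐ x ∂volume.restrict (Ioo a b), (fun y => f (x, y)) =ᵐ[volume.restrict Ω] 0) :
    f =ᵐ[volume.restrict (Ioo a b ×ˢ Ω)] 0 := by
  rw [Measure.volume_eq_prod, ← Measure.prod_restrict]
  have h2 : MeasurableSet {z : ℝ × EuclideanSpace ℝ (Fin N) | f z = 0} :=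
    hf (measurableSet_singleton 0)
  exact (Measure.ae_prod_iff_ae_ae h2).2 h

/-- The graph is the graph of a single-valued operator. -/
theorem dirichletGraph_singleValued {α a b : ℝ} (C s : ℝ) (hα : α ≤ 1) (hab : a < b)
    (hΩ : IsOpen Ω) (p : L2Cyl 𝕜 a b Ω × L2Cyl 𝕜 a b Ω)
    (hp : p ∈ dirichletGraph C s hα hab hΩ) (hp0 : p.1 = 0) : p.2 = 0 := by
  have h0 := Lp.coeFn_zero 𝕜 2
    ((volume : Measure (ℝ × EuclideanSpace ℝ (Fin N))).restrict (Ioo a b ×ˢ Ω))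
  obtain ⟨u, v⟩ := p
  obtain ⟨f, g, hf, hg, hv⟩ := hp
  simp only at hp0 hf hg hv ⊢
  subst hp0 hv
  have hf0 : f = 0 := by
    have h1 : ∀ᵐ y ∂volume.restrict Ω, (fun x => f (x, y)) =ᵐ[volume.restrict (Ioo a b)] 0 := by
      filter_upwards [hf, slices_x h0] with y a1 a2
      exact a1.ae_eq_zero hab a2
    exact (Lp.eq_zero_iff_ae_eq_zero).2 (ae_zero_of_slices_x (Lp.stronglyMeasurable f).measurable h1)
  have hg0 : g = 0 := by
    have h1 : ∀ᵐ x ∂volume.restrict (Ioo a b), (fun y => g (x, y)) =ᵐ[volume.restrict Ω] 0 := by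
      filter_upwards [hg, slices_y h0] with y a1 a2
      exact a1.ae_eq_zero hΩ a2
    exact (Lp.eq_zero_iff_ae_eq_zero).2 (ae_zero_of_slices_y (Lp.stronglyMeasurable g).measurable h1)
  rw [hf0, hg0, add_zero]

/-- The Dirichlet operator `L^{α,s}` as an unbounded operator in `L²(D)`. -/
def dirichletOp {α a b : ℝ} (C s : ℝ) {Ω : Set (EuclideanSpace ℝ (Fin N))} (hα : α ≤ 1)
    (hab : a < b) (hΩ : IsOpen Ω) : L2Cyl 𝕜 a b Ω →ₗ.[𝕜] L2Cyl 𝕜 a b Ω :=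
  (dirichletGraph C s hα hab hΩ).toLinearPMap

theorem dirichletOp_graph {α a b : ℝ} (C s : ℝ) (hα : α ≤ 1) (hab : a < b) (hΩ : IsOpen Ω) :
    (dirichletOp (𝕜 := 𝕜) C s hα hab hΩ).graph = dirichletGraph C s hα hab hΩ :=
  Submodule.toLinearPMap_graph_eq _ (dirichletGraph_singleValued C s hα hab hΩ)

/-- `μ` is an eigenvalue of the unbounded operator `T`. -/
def IsEigenvalue {H : Type*} [AddCommGroup H] [Module 𝕜 H] (T : H →ₗ.[𝕜] H) (μ : 𝕜) : Prop :=
  ∃ u : T.domain, (u : H) ≠ 0 ∧ T u = μ • (u : H)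

end FracCyl

end

noncomputable section

namespace FracCyl

section

/-! ### Diagonal operators in a Hilbert space -/

section Diagonal

variable {𝕜 : Type*} [RCLike 𝕜] {H : Type*} [NormedAddCommGroup H] [InnerProductSpace 𝕜 H]

/-! Each of the two one-variable problems is solved by a compact positive injective symmetric
operator, so each has an orthonormal eigenbasis; the operator on the cylinder is then diagonal in
the products of eigenfunctions, with eigenvalues `c i + d j`.

In `x`, let `J = I_{a+}^α` on `L²(a, b)`, let `J* = I_{b-}^α`, and let `k(t) = (t - a)^(α-1) /
Γ(α)`. Since `α > 1/2`, the kernel of `J` is square integrable, so `J` is Hilbert-Schmidt and `k` is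
in `L²`. If `g` is the Caputo derivative of `u`, the equation for `g` says `g = J f + c k` with a
free constant `c`; the condition at `b` gives `u = J* g`; and then `u(a) = ⟨k, g⟩`, so the condition
at `a` fixes `c` and makes `g` the projection of `J f` orthogonal to `k`. Hence `u = J* (1 - P_k) J
f` (`isDirichletFracODE_iff`). The converse needs `J* g` to be absolutely continuous. This holds
because the iterated kernel `∫ (t - x)_+^(α-1) (t - τ)_+^(α-1) dt` is monotone in `x` on either side
of `τ`, with variation controlled by its diagonal value, finite for `α > 1/2`
(`exists_primitive_fracInt_fracInt`).

In `y`, symmetrising the principal value turns the weak equation into the Gagliardo form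
(`integral_mul_fracLap`), so the equation reads `u = (1 + A)⁻¹ (g + u)`, where `(1 + A)⁻¹ = ι ι*`
and `ι` embeds the closed form domain into `L²(Ω)` (`isFracDirichletLap_iff`). The embedding is
compact without any regularity of the boundary: averaging over balls of radius `ε` is
Hilbert-Schmidt on a bounded set and moves a function by at most a constant times `ε^s` times its
seminorm (`lintegral_sub_average_sq_le`).

With `c i > 0` and `d j ≥ 0`, the multiplier `c i / (c i + d j)` is bounded by one. So if the sum of
the two parts lies in `L²`, so does each part: the slicewise domain is the maximal domain of the
diagonal operator (`exists_hilbertBasis_slicewise_sum`). No Poincaré inequality in `y` is needed, as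
positivity comes from `x`. Self-adjointness, positivity and the list of eigenvalues follow from
diagonality alone (`diagonal_operator_spectral`). -/

theorem HilbertBasis.ext_inner {ι : Type*} (e : HilbertBasis ι 𝕜 H) {x y : H}
    (h : ∀ i, inner 𝕜 (e i) x = inner 𝕜 (e i) y) : x = y := by
  apply e.repr.injective
  ext i
  simpa only [e.repr_apply_apply] using h i

theorem HilbertBasis.inner_self {ι : Type*} (e : HilbertBasis ι 𝕜 H) (i : ι) :
    inner 𝕜 (e i) (e i) = (1 : 𝕜) := by
  rw [inner_self_eq_norm_sq_to_K, e.orthonormal.1 i]; simp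

theorem HilbertBasis.inner_ne {ι : Type*} (e : HilbertBasis ι 𝕜 H) {i j : ι} (h : i ≠ j) :
    inner 𝕜 (e i) (e j) = (0 : 𝕜) := e.orthonormal.2 h

/-- A compact operator has only finitely many orthonormal eigenvectors with eigenvalues bounded
away from zero. -/
theorem finite_large_eigenvalues {ι : Type*} {S : H →L[𝕜] H} (hS : IsCompactOperator S)
    {e : ι → H} (he : Orthonormal 𝕜 e) {κ : ι → ℝ} (hκ : ∀ i, S (e i) = (κ i : 𝕜) • e i)
    {δ : ℝ} (hδ : 0 < δ) : {i | δ ≤ κ i}.Finite := by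
  by_contra hinf
  have hinf : {i | δ ≤ κ i}.Infinite := hinf
  let f := hinf.natEmbedding
  obtain ⟨K, hK, hSK⟩ := IsCompactOperator.image_closedBall_subset_compact (f := S.toLinearMap) hS 1
  have hmem : ∀ n, S (e (f n)) ∈ K := fun n =>
    hSK ⟨e (f n), by simp [he.1], rfl⟩
  obtain ⟨z, -, φ, hφ, hlim⟩ := hK.tendsto_subseq hmem
  obtain ⟨M, hM⟩ := Metric.cauchySeq_iff.1 hlim.cauchySeq δ hδ
  have h1 := hM M le_rfl (M + 1) (Nat.le_succ M)
  set i : ι := (f (φ M)).1 with hi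
  set j : ι := (f (φ (M + 1))).1 with hj
  have hij : i ≠ j := by
    intro h
    exact (hφ (Nat.lt_succ_self M)).ne (f.injective (Subtype.ext h))
  -- Pairing with `e i` shows that the images of two distinct eigenvectors are at distance at least
  -- `κ i ≥ δ`, so no subsequence of them is Cauchy.
  have h2 : inner 𝕜 (e i) (S (e i) - S (e j)) = (κ i : 𝕜) := by
    rw [hκ, hκ, inner_sub_right, inner_smul_right, inner_smul_right, he.2 hij,
      inner_self_eq_norm_sq_to_K, he.1 i]
    simp
  have h3 : κ i ≤ ‖S (e i) - S (e j)‖ := by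
    have := norm_inner_le_norm (𝕜 := 𝕜) (e i) (S (e i) - S (e j))
    rw [h2, he.1 i, one_mul, RCLike.norm_ofReal] at this
    exact (le_abs_self _).trans this
  have h4 : δ ≤ κ i := (f (φ M)).2
  simp only [Function.comp, dist_eq_norm] at h1
  linarith

/-- Spectral theorem for an injective, compact, positive symmetric operator. -/
theorem exists_hilbertBasis_eigenvectors.{u} {𝕜 : Type u} [RCLike 𝕜] {H : Type*}
    [NormedAddCommGroup H] [InnerProductSpace 𝕜 H] [CompleteSpace H] {S : H →L[𝕜] H}
    (hS : IsCompactOperator S)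
    (hsymm : (S : H →ₗ[𝕜] H).IsSymmetric) (hinj : ∀ x, S x = 0 → x = 0)
    (hpos : ∀ x, 0 ≤ RCLike.re (inner 𝕜 (S x) x)) :
    ∃ (ι : Type u) (e : HilbertBasis ι 𝕜 H) (κ : ι → ℝ), (∀ i, 0 < κ i) ∧
      (∀ i, S (e i) = (κ i : 𝕜) • e i) ∧ ∀ δ : ℝ, 0 < δ → {i | δ ≤ κ i}.Finite := by
  let T : Module.End 𝕜 H := (S : H →ₗ[𝕜] H)
  have hfin : ∀ μ : 𝕜, FiniteDimensional 𝕜 (Module.End.eigenspace T μ) := by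
    intro μ
    by_cases hμ : μ = 0
    · have : Module.End.eigenspace T μ = ⊥ := by
        rw [eq_bot_iff]
        intro x hx
        rw [Module.End.mem_eigenspace_iff, hμ, zero_smul] at hx
        exact hinj x hx
      rw [this]; infer_instance
    · exact ContinuousLinearMap.finite_dimensional_eigenspace hS μ hμ
  -- The basis is indexed by all scalars `μ` at once; non-eigenvalues contribute the empty type `Fin
  -- 0`. The kernel is trivial by injectivity, so every eigenspace is finite dimensional.
  let v : ∀ μ : 𝕜, Fin (Module.finrank 𝕜 (Module.End.eigenspace T μ)) →
    Module.End.eigenspace T μ := fun μ => stdOrthonormalBasis 𝕜 (Module.End.eigenspace T μ)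
  have hv : ∀ μ, Orthonormal 𝕜 (v μ) := fun μ => (stdOrthonormalBasis 𝕜 _).orthonormal
  have hon := hsymm.orthogonalFamily_eigenspaces.orthonormal_sigma_orthonormal hv
  have hspan : (Submodule.span 𝕜 (Set.range fun a : Σ μ : 𝕜,
      Fin (Module.finrank 𝕜 (Module.End.eigenspace T μ)) => (v a.1 a.2 : H)))ᗮ = ⊥ := by
    rw [eq_bot_iff, ← ContinuousLinearMap.orthogonalComplement_iSup_eigenspaces_eq_bot hS hsymm]
    apply Submodule.orthogonal_le
    refine iSup_le fun μ => ?_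
    intro x hx
    have h1 := (stdOrthonormalBasis 𝕜 (Module.End.eigenspace T μ)).sum_repr ⟨x, hx⟩
    have h2 := congrArg Subtype.val h1
    rw [← show ((⟨x, hx⟩ : Module.End.eigenspace T μ) : H) = x from rfl, ← h2]
    rw [Submodule.coe_sum]
    refine Submodule.sum_mem _ fun i _ => ?_
    rw [Submodule.coe_smul]
    exact Submodule.smul_mem _ _ (Submodule.subset_span ⟨⟨μ, i⟩, rfl⟩)
  let e := HilbertBasis.mkOfOrthogonalEqBot hon hspan
  have he : ∀ a, e a = (v a.1 a.2 : H) := fun a => by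
    exact congrFun (HilbertBasis.coe_mkOfOrthogonalEqBot hon hspan) a
  have hT : ∀ a, S (e a) = a.1 • e a := fun a => by
    rw [he]; exact Module.End.mem_eigenspace_iff.1 (v a.1 a.2).2
  have hreal : ∀ a : Σ μ : 𝕜, Fin (Module.finrank 𝕜 (Module.End.eigenspace T μ)),
      ((RCLike.re a.1 : ℝ) : 𝕜) = a.1 := by
    intro a
    rw [← RCLike.conj_eq_iff_re]
    have h1 := hsymm (e a) (e a)
    simp only [ContinuousLinearMap.coe_coe] at h1
    rw [hT, inner_smul_left, inner_smul_right, HilbertBasis.inner_self, mul_one, mul_one] at h1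
    exact h1
  have hT' : ∀ a, S (e a) = ((RCLike.re a.1 : ℝ) : 𝕜) • e a := fun a => by rw [hreal, hT]
  refine ⟨_, e, fun a => RCLike.re a.1, fun a => ?_, hT', fun δ hδ =>
    finite_large_eigenvalues hS e.orthonormal hT' hδ⟩
  have h1 := hpos (e a)
  rw [hT', inner_smul_left, HilbertBasis.inner_self, mul_one, RCLike.conj_ofReal,
    RCLike.ofReal_re] at h1
  refine lt_of_le_of_ne h1 fun h => ?_
  have h2 := hT' a
  rw [← (show 0 = RCLike.re a.1 from h), RCLike.ofReal_zero, zero_smul] at h2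
  have h3 := e.orthonormal.1 a
  rw [hinj _ h2] at h3
  simp at h3

/-- An infinite family of real numbers with finite sublevel sets can be arranged in increasing
order. -/
theorem exists_monotone_enumeration {ι : Type*} [Infinite ι] (ν : ι → ℝ)
    (hν : ∀ c : ℝ, {i | ν i ≤ c}.Finite) :
    ∃ σ : ℕ ≃ ι, Monotone (ν ∘ σ) := by
  have hc : Countable ι := by
    rw [← Set.countable_univ_iff]
    have : (Set.univ : Set ι) = ⋃ n : ℕ, {i | ν i ≤ n} := by
      ext i
      simp only [mem_univ, mem_iUnion, mem_ofPred_eq, true_iff]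
      exact exists_nat_ge (ν i)
    rw [this]
    exact Set.countable_iUnion fun n => (hν n).countable
  obtain ⟨enc, henc⟩ := hc.exists_injective_nat ι
  -- Predecessors of `i` when sorting by value, with ties broken by the injection `enc` into the
  -- natural numbers. Finite sublevel sets make `B i` finite, and its cardinality strictly increases
  -- along the order.
  let B : ι → Set ι := fun i => {j | ν j < ν i ∨ (ν j = ν i ∧ enc j < enc i)}
  have hB : ∀ i, (B i).Finite := fun i => (hν (ν i)).subset fun j hj => by
    rcases hj with h | h
    · exact h.le
    · exact h.1.le
  let rank : ι → ℕ := fun i => (B i).ncard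
  have hlt : ∀ i j, j ∈ B i → rank j < rank i := by
    intro i j hj
    apply Set.ncard_lt_ncard _ (hB i)
    refine ⟨fun k hk => ?_, fun h => ?_⟩
    · rcases hj with h | h <;> rcases hk with h' | h'
      · exact Or.inl (h'.trans h)
      · exact Or.inl (h'.1 ▸ h)
      · exact Or.inl (h.1 ▸ h')
      · exact Or.inr ⟨h'.1.trans h.1, h'.2.trans h.2⟩
    · rcases h hj with h' | h'
      · exact lt_irrefl _ h'
      · exact lt_irrefl _ h'.2
  have htri : ∀ i j, i ≠ j → j ∈ B i ∨ i ∈ B j := by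
    intro i j hij
    rcases lt_trichotomy (ν i) (ν j) with h | h | h
    · exact Or.inr (Or.inl h)
    · rcases lt_trichotomy (enc i) (enc j) with h' | h' | h'
      · exact Or.inr (Or.inr ⟨h, h'⟩)
      · exact absurd (henc h') hij
      · exact Or.inl (Or.inr ⟨h.symm, h'⟩)
    · exact Or.inl (Or.inl h)
  have hinj : Function.Injective rank := by
    intro i j h
    by_contra hij
    rcases htri i j hij with h' | h'
    · exact (hlt _ _ h').ne' h
    · exact (hlt _ _ h').ne h
  have : Infinite (Set.range rank) := (Set.infinite_range_of_injective hinj).to_subtype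
  classical
  -- An infinite set of natural numbers is order isomorphic to `ℕ`, so there is no need to know that
  -- `rank` is onto.
  let o := Nat.Subtype.orderIsoOfNat (Set.range rank)
  let r := Equiv.ofInjective rank hinj
  refine ⟨o.toEquiv.trans r.symm, fun m n hmn => ?_⟩
  have hr : ∀ k, rank (r.symm (o k)) = (o k : ℕ) := fun k =>
    congrArg Subtype.val (Equiv.apply_symm_apply r (o k))
  by_contra hgt
  have hgt : ν (r.symm (o n)) < ν (r.symm (o m)) := not_le.1 hgt
  have h1 := hlt _ _ (Or.inl hgt : r.symm (o n) ∈ B (r.symm (o m)))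
  rw [hr, hr] at h1
  exact absurd (o.monotone hmn) (not_le.2 h1)

/-- An unbounded operator which is diagonal, with maximal domain, with respect to a Hilbert basis,
with positive diagonal entries having finite sublevel sets. -/
theorem diagonal_operator_spectral [CompleteSpace H] {ι : Type*} [Infinite ι]
    (e : HilbertBasis ι 𝕜 H) (ν : ι → ℝ)
    (hpos : ∀ i, 0 < ν i) (hν : ∀ c : ℝ, {i | ν i ≤ c}.Finite) (T : H →ₗ.[𝕜] H)
    (hT : ∀ u v : H, (u, v) ∈ T.graph ↔
      ∀ i, inner 𝕜 (e i) v = (ν i : 𝕜) * inner 𝕜 (e i) u) :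
    IsSelfAdjoint T ∧
    (∀ u : T.domain, (u : H) ≠ 0 → 0 < RCLike.re (inner 𝕜 (T u) (u : H))) ∧
    ∃ ν : ℕ → ℝ, Monotone ν ∧ (∀ n, 0 < ν n) ∧ Tendsto ν atTop atTop ∧
      (∀ μ : 𝕜, IsEigenvalue T μ ↔ ∃ n, μ = (ν n : 𝕜)) ∧
      ∃ e : HilbertBasis ℕ 𝕜 H, ∀ n, ∃ u : T.domain,
        (u : H) = e n ∧ T u = (ν n : 𝕜) • e n := by
  have hTu : ∀ (u : T.domain) i, inner 𝕜 (e i) (T u) = (ν i : 𝕜) * inner 𝕜 (e i) (u : H) :=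
    fun u => (hT u (T u)).1 (T.mem_graph u)
  have heig : ∀ i, ∃ u : T.domain, (u : H) = e i ∧ T u = (ν i : 𝕜) • e i := by
    intro i
    have : (e i, (ν i : 𝕜) • e i) ∈ T.graph := by
      rw [hT]
      intro j
      rw [inner_smul_right]
      by_cases h : j = i
      · rw [h]
      · rw [HilbertBasis.inner_ne e h]; simp
    obtain ⟨u, hu1, hu2⟩ := (LinearPMap.mem_graph_iff _).1 this
    exact ⟨u, hu1, hu2⟩
  have hdense : Dense (T.domain : Set H) := by
    rw [Submodule.dense_iff_topologicalClosure_eq_top, eq_top_iff, ← e.dense_span]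
    apply Submodule.topologicalClosure_mono
    rw [Submodule.span_le]
    rintro _ ⟨i, rfl⟩
    obtain ⟨u, hu, -⟩ := heig i
    rw [← hu]; exact u.2
  have hformal : T.IsFormalAdjoint T := by
    intro x y
    rw [← e.tsum_inner_mul_inner, ← e.tsum_inner_mul_inner]
    refine tsum_congr fun i => ?_
    rw [hTu y, ← inner_conj_symm (T x), hTu x, map_mul, RCLike.conj_ofReal, inner_conj_symm]
    ring
  refine ⟨?_, ?_, ?_⟩
  · rw [LinearPMap.isSelfAdjoint_def]
    refine le_antisymm ?_ (hformal.le_adjoint hdense)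
    apply LinearPMap.le_of_le_graph
    rintro ⟨y, z⟩ hyz
    -- Testing an element of the adjoint's graph against the eigenvectors gives exactly the
    -- coefficient relation that characterises the graph of `T`; maximality of the domain is what
    -- makes this enough.
    obtain ⟨y', rfl, rfl⟩ := (LinearPMap.mem_graph_iff _).1 hyz
    rw [hT]
    intro i
    obtain ⟨u, hu1, hu2⟩ := heig i
    have := LinearPMap.adjoint_isFormalAdjoint hdense y' u
    rw [hu1, hu2, inner_smul_right] at this
    rw [← inner_conj_symm, this, map_mul, RCLike.conj_ofReal, inner_conj_symm]
  · intro u hu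
    have h1 := e.hasSum_inner_mul_inner (T u) (u : H)
    have h2 : ∀ i, inner 𝕜 (T u) (e i) * inner 𝕜 (e i) (u : H) =
        ((ν i * ‖inner 𝕜 (e i) (u : H)‖ ^ 2 : ℝ) : 𝕜) := by
      intro i
      rw [← inner_conj_symm (T u), hTu u, map_mul, RCLike.conj_ofReal, mul_assoc,
        RCLike.conj_mul]
      push_cast; rfl
    simp only [h2] at h1
    have h3 := (RCLike.reCLM (K := 𝕜)).hasSum h1
    simp only [RCLike.reCLM_apply, RCLike.ofReal_re] at h3
    -- The quadratic form is the sum of `ν i |⟨e i, u⟩|²`, and one nonzero coefficient makes it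
    -- strictly positive.
    obtain ⟨i, hi⟩ : ∃ i, inner 𝕜 (e i) (u : H) ≠ 0 := by
      by_contra! h
      exact hu (HilbertBasis.ext_inner e fun i => by rw [h i, inner_zero_right])
    have h4 : 0 < ν i * ‖inner 𝕜 (e i) (u : H)‖ ^ 2 :=
      mul_pos (hpos i) (pow_pos (norm_pos_iff.2 hi) 2)
    rw [← h3.tsum_eq]
    exact h3.summable.tsum_pos (fun j => mul_nonneg (hpos j).le (sq_nonneg _)) i h4
  · obtain ⟨σ, hσ⟩ := exists_monotone_enumeration ν hν
    refine ⟨ν ∘ σ, hσ, fun n => hpos _, ?_, ?_, ?_⟩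
    · refine tendsto_atTop_atTop_of_monotone hσ fun c => ?_
      by_contra! h
      have : (Set.range σ).Finite := (hν c).subset (by rintro _ ⟨n, rfl⟩; exact (h n).le)
      exact Set.infinite_range_of_injective σ.injective this
    · intro μ
      constructor
      · rintro ⟨u, hu, hTμ⟩
        -- At any nonzero coefficient of an eigenvector, the coefficient relation forces `μ = ν i`.
        obtain ⟨i, hi⟩ : ∃ i, inner 𝕜 (e i) (u : H) ≠ 0 := by
          by_contra! h
          exact hu (HilbertBasis.ext_inner e fun i => by rw [h i, inner_zero_right])
        have h1 := hTu u i
        rw [hTμ, inner_smul_right] at h1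
        exact ⟨σ.symm i, by simpa using mul_right_cancel₀ hi h1⟩
      · rintro ⟨n, rfl⟩
        obtain ⟨u, hu1, hu2⟩ := heig (σ n)
        refine ⟨u, ?_, by rw [hu2, hu1]; rfl⟩
        rw [hu1]
        exact e.orthonormal.ne_zero _
    · let e' : HilbertBasis ℕ 𝕜 H := HilbertBasis.mk (v := e ∘ σ)
        (e.orthonormal.comp σ σ.injective)
        (by rw [σ.surjective.range_comp, e.dense_span])
      refine ⟨e', fun n => ?_⟩
      have : e' n = e (σ n) := by simp [e']
      rw [this]
      exact heig (σ n)

end Diagonal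

end

section

/-! ### Square integrable functions on products -/

section SquareIntegrable

variable {𝕜 : Type*} [RCLike 𝕜] {X Y : Type*} [MeasurableSpace X] [MeasurableSpace Y]
  {μ : Measure X} {ν : Measure Y}

theorem eLpNorm_two_sq {E : Type*} [NormedAddCommGroup E] (f : X → E) :
    eLpNorm f 2 μ ^ 2 = ∫⁻ x, ‖f x‖ₑ ^ 2 ∂μ := by
  have := eLpNorm_nnreal_pow_eq_lintegral (f := f) (μ := μ) (p := 2) (by norm_num)
  simpa using this

theorem memLp_two_iff_lintegral_lt_top {E : Type*} [NormedAddCommGroup E] {f : X → E}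
    (hf : AEStronglyMeasurable f μ) : MemLp f 2 μ ↔ ∫⁻ x, ‖f x‖ₑ ^ 2 ∂μ < ⊤ := by
  rw [← eLpNorm_two_sq, ENNReal.pow_lt_top_iff]
  simp [MemLp, hf]

theorem enorm_integral_smul_le {E : Type*} [NormedAddCommGroup E] [NormedSpace ℝ E]
    {k : X → ℝ} {f : X → E} (hk : AEStronglyMeasurable k μ)
    (hf : AEStronglyMeasurable f μ) : ‖∫ x, k x • f x ∂μ‖ₑ ≤ eLpNorm k 2 μ * eLpNorm f 2 μ := by
  refine (enorm_integral_le_lintegral_enorm _).trans ?_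
  rw [← eLpNorm_one_eq_lintegral_enorm]
  exact eLpNorm_smul_le_mul_eLpNorm hf hk

theorem MemLp.integrable_inner {f g : X → 𝕜} (hf : MemLp f 2 μ) (hg : MemLp g 2 μ) :
    Integrable (fun x => inner 𝕜 (f x) (g x)) μ := by
  simp only [RCLike.inner_apply]
  exact hg.integrable_mul hf.star

theorem inner_toLp {f g : X → 𝕜} (hf : MemLp f 2 μ) (hg : MemLp g 2 μ) :
    inner 𝕜 (hf.toLp f) (hg.toLp g) = ∫ x, inner 𝕜 (f x) (g x) ∂μ := by
  rw [L2.inner_def]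
  refine integral_congr_ae ?_
  filter_upwards [hf.coeFn_toLp, hg.coeFn_toLp] with x h1 h2
  rw [h1, h2]

theorem inner_Lp_toLp (f : Lp 𝕜 2 μ) {g : X → 𝕜} (hg : MemLp g 2 μ) :
    inner 𝕜 f (hg.toLp g) = ∫ x, inner 𝕜 (f x) (g x) ∂μ := by
  rw [L2.inner_def]
  refine integral_congr_ae ?_
  filter_upwards [hg.coeFn_toLp] with x h2
  rw [h2]

variable [SFinite μ] [SFinite ν]

theorem lintegral_enorm_sq_lt_top {E : Type*} [NormedAddCommGroup E] {F : X × Y → E}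
    (hF : MemLp F 2 (μ.prod ν)) :
    ∫⁻ x, ∫⁻ y, ‖F (x, y)‖ₑ ^ 2 ∂ν ∂μ < ⊤ := by
  rw [← lintegral_prod _ (hF.1.enorm.pow_const 2)]
  exact (memLp_two_iff_lintegral_lt_top hF.1).1 hF

theorem MemLp.ae_slice_right {E : Type*} [NormedAddCommGroup E] {F : X × Y → E}
    (hF : MemLp F 2 (μ.prod ν)) : ∀ᵐ x ∂μ, MemLp (fun y => F (x, y)) 2 ν := by
  have h1 := ae_lt_top' ((hF.1.enorm.pow_const 2).lintegral_prod_right')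
    (lintegral_enorm_sq_lt_top hF).ne
  filter_upwards [h1, hF.1.prodMk_left] with x h2 h3
  exact (memLp_two_iff_lintegral_lt_top h3).2 h2

theorem MemLp.swap_prod {E : Type*} [NormedAddCommGroup E] {F : X × Y → E}
    (hF : MemLp F 2 (μ.prod ν)) : MemLp (fun p : Y × X => F p.swap) 2 (ν.prod μ) :=
  hF.comp_measurePreserving Measure.measurePreserving_swap

theorem MemLp.ae_slice_left {E : Type*} [NormedAddCommGroup E] {F : X × Y → E}
    (hF : MemLp F 2 (μ.prod ν)) : ∀ᵐ y ∂ν, MemLp (fun x => F (x, y)) 2 μ :=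
  MemLp.ae_slice_right (MemLp.swap_prod hF)

theorem MemLp.tensor {f : X → 𝕜} {g : Y → 𝕜} (hf : MemLp f 2 μ) (hg : MemLp g 2 ν) :
    MemLp (fun p : X × Y => f p.1 * g p.2) 2 (μ.prod ν) := by
  have hm : AEStronglyMeasurable (fun p : X × Y => f p.1 * g p.2) (μ.prod ν) :=
    hf.1.comp_fst.mul hg.1.comp_snd
  rw [memLp_two_iff_lintegral_lt_top hm]
  simp only [enorm_mul, mul_pow]
  rw [lintegral_prod_mul (f := fun x => ‖f x‖ₑ ^ 2) (g := fun y => ‖g y‖ₑ ^ 2)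
    (hf.1.enorm.pow_const 2) (hg.1.enorm.pow_const 2)]
  exact ENNReal.mul_lt_top ((memLp_two_iff_lintegral_lt_top hf.1).1 hf)
    ((memLp_two_iff_lintegral_lt_top hg.1).1 hg)

/-- Partial integration against a square integrable function of the second variable. -/
theorem MemLp.partial_inner {e : Y → 𝕜} {F : X × Y → 𝕜} (he : MemLp e 2 ν)
    (hF : MemLp F 2 (μ.prod ν)) :
    MemLp (fun x => ∫ y, inner 𝕜 (e y) (F (x, y)) ∂ν) 2 μ := by
  have hm : AEStronglyMeasurable (fun p : X × Y => inner 𝕜 (e p.2) (F p)) (μ.prod ν) :=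
    he.1.comp_snd.inner hF.1
  have hm' := hm.integral_prod_right'
  rw [memLp_two_iff_lintegral_lt_top hm']
  have hb : ∀ᵐ x ∂μ, ‖∫ y, inner 𝕜 (e y) (F (x, y)) ∂ν‖ₑ ^ 2 ≤
      eLpNorm e 2 ν ^ 2 * ∫⁻ y, ‖F (x, y)‖ₑ ^ 2 ∂ν := by
    filter_upwards [hF.1.prodMk_left] with x hx
    rw [← eLpNorm_two_sq (fun y => F (x, y)), ← mul_pow]
    gcongr
    refine (enorm_integral_le_lintegral_enorm _).trans ?_
    rw [← eLpNorm_one_eq_lintegral_enorm]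
    have h1 : eLpNorm (fun y => inner 𝕜 (e y) (F (x, y))) 1 ν =
        eLpNorm ((star e) • fun y => F (x, y)) 1 ν := by
      congr 1; funext y; simp [RCLike.inner_apply, mul_comm]
    rw [h1]
    refine (eLpNorm_smul_le_mul_eLpNorm (p := 2) (q := 2) hx he.1.star).trans ?_
    rw [eLpNorm_star]
  refine (lintegral_mono_ae hb).trans_lt ?_
  rw [lintegral_const_mul'' _ ((hF.1.enorm.pow_const 2).lintegral_prod_right')]
  exact ENNReal.mul_lt_top (ENNReal.pow_lt_top he.2) (lintegral_enorm_sq_lt_top hF)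

theorem inner_mul_eq (a b c : 𝕜) : inner 𝕜 (a * b) c = inner 𝕜 a (inner 𝕜 b c) := by
  simp only [RCLike.inner_apply, map_mul]; ring

theorem integral_inner_tensor {f : X → 𝕜} {g : Y → 𝕜} {F : X × Y → 𝕜} (hf : MemLp f 2 μ)
    (hg : MemLp g 2 ν) (hF : MemLp F 2 (μ.prod ν)) :
    ∫ p, inner 𝕜 (f p.1 * g p.2) (F p) ∂(μ.prod ν) =
      ∫ x, inner 𝕜 (f x) (∫ y, inner 𝕜 (g y) (F (x, y)) ∂ν) ∂μ := by
  rw [integral_prod _ (MemLp.integrable_inner (MemLp.tensor hf hg) hF)]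
  refine integral_congr_ae ?_
  filter_upwards [MemLp.ae_slice_right hF] with x hx
  simp only [inner_mul_eq]
  exact integral_inner (MemLp.integrable_inner hg hx) (f x)

theorem integral_inner_tensor_symm {f : X → 𝕜} {g : Y → 𝕜} {F : X × Y → 𝕜} (hf : MemLp f 2 μ)
    (hg : MemLp g 2 ν) (hF : MemLp F 2 (μ.prod ν)) :
    ∫ p, inner 𝕜 (f p.1 * g p.2) (F p) ∂(μ.prod ν) =
      ∫ y, inner 𝕜 (g y) (∫ x, inner 𝕜 (f x) (F (x, y)) ∂μ) ∂ν := by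
  have h := integral_inner_tensor hg hf (MemLp.swap_prod hF)
  rw [← integral_prod_swap]
  simp only [Prod.fst_swap, Prod.snd_swap, Prod.swap_prod_mk] at h ⊢
  rw [← h]
  simp only [mul_comm]

variable {ι κ : Type*}

/-- Two functions with square integrable slices agree almost everywhere as soon as the integrals of
the slices against a Hilbert basis agree. -/
theorem HilbertBasis.ae_eq_of_integral_inner (e : HilbertBasis ι 𝕜 (Lp 𝕜 2 μ)) {f g : X → 𝕜}
    (hf : MemLp f 2 μ) (hg : MemLp g 2 μ)
    (h : ∀ i, ∫ x, inner 𝕜 (e i x) (f x) ∂μ = ∫ x, inner 𝕜 (e i x) (g x) ∂μ) : f =ᵐ[μ] g := by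
  rw [← MemLp.toLp_eq_toLp_iff hf hg]
  refine HilbertBasis.ext_inner e fun i => ?_
  rw [inner_Lp_toLp, inner_Lp_toLp, h]

/-- The Hilbert basis of products of basis functions in `L²` of a product measure. -/
theorem exists_hilbertBasis_tensor [Countable ι] (e : HilbertBasis ι 𝕜 (Lp 𝕜 2 μ))
    (f : HilbertBasis κ 𝕜 (Lp 𝕜 2 ν)) :
    ∃ E : HilbertBasis (ι × κ) 𝕜 (Lp 𝕜 2 (μ.prod ν)),
      ∀ p, E p =ᵐ[μ.prod ν] fun z => e p.1 z.1 * f p.2 z.2 := by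
  have hm : ∀ p : ι × κ, MemLp (fun z : X × Y => e p.1 z.1 * f p.2 z.2) 2 (μ.prod ν) :=
    fun p => MemLp.tensor (Lp.memLp (e p.1)) (Lp.memLp (f p.2))
  let v : ι × κ → Lp 𝕜 2 (μ.prod ν) := fun p => (hm p).toLp _
  have hinner : ∀ p q, inner 𝕜 (v p) (v q) =
      inner 𝕜 (e p.1) (e q.1) * inner 𝕜 (f p.2) (f q.2) := by
    intro p q
    rw [inner_toLp, L2.inner_def, L2.inner_def, ← integral_prod_mul]
    congr 1; funext z
    simp only [RCLike.inner_apply, map_mul]; ring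
  classical
  have hon : Orthonormal 𝕜 v := by
    rw [orthonormal_iff_ite]
    rintro ⟨i, j⟩ ⟨i', j'⟩
    rw [hinner, orthonormal_iff_ite.1 e.orthonormal, orthonormal_iff_ite.1 f.orthonormal]
    by_cases h : i = i' <;> by_cases h' : j = j' <;> simp [h, h']
  have hsp : (Submodule.span 𝕜 (Set.range v))ᗮ = ⊥ := by
    rw [eq_bot_iff]
    intro F hF
    have hF0 : ∀ p, inner 𝕜 (v p) F = 0 := fun p =>
      (Submodule.mem_orthogonal _ _).1 hF _ (Submodule.subset_span ⟨p, rfl⟩)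
    have hFm := Lp.memLp F
    -- The partial coefficient of `F` along `e i` is in `L²` of the second variable, and its
    -- coefficients along the `f j` all vanish. Countability of `ι` then gives one null set of `y`
    -- serving every `i`.
    have h1 : ∀ i, (fun y => ∫ x, inner 𝕜 (e i x) (F (x, y)) ∂μ) =ᵐ[ν] 0 := by
      intro i
      refine HilbertBasis.ae_eq_of_integral_inner f
        (MemLp.partial_inner (Lp.memLp (e i)) (MemLp.swap_prod hFm)) MemLp.zero fun j => ?_
      rw [← integral_inner_tensor_symm (Lp.memLp (e i)) (Lp.memLp (f j)) hFm]
      have h2 := hF0 (i, j)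
      rw [← Lp.toLp_coeFn F hFm, inner_toLp] at h2
      simpa using h2
    have h2 : ∀ᵐ y ∂ν, (fun x => F (x, y)) =ᵐ[μ] 0 := by
      filter_upwards [ae_all_iff.2 h1, MemLp.ae_slice_left hFm] with y hy hym
      refine HilbertBasis.ae_eq_of_integral_inner e hym MemLp.zero fun i => ?_
      simpa using hy i
    rw [Submodule.mem_bot, Lp.eq_zero_iff_ae_eq_zero]
    have hFs := (Lp.stronglyMeasurable F).measurable
    have h3 : MeasurableSet {z : Y × X | F (z.2, z.1) = 0} :=
      (hFs.comp measurable_swap) (measurableSet_singleton 0)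
    exact Measure.measurePreserving_swap.quasiMeasurePreserving.ae
      ((Measure.ae_prod_iff_ae_ae h3).2 h2)
  refine ⟨HilbertBasis.mkOfOrthogonalEqBot hon hsp, fun p => ?_⟩
  rw [HilbertBasis.coe_mkOfOrthogonalEqBot hon hsp]
  exact (hm p).coeFn_toLp

/-- An operator acting in the second variable, diagonal with respect to a Hilbert basis, is
diagonal with respect to the basis of products. -/
theorem ae_slice_diagonal_iff [Countable κ] (e : HilbertBasis ι 𝕜 (Lp 𝕜 2 μ))
    (f : HilbertBasis κ 𝕜 (Lp 𝕜 2 ν)) (c : κ → 𝕜) {u v : X × Y → 𝕜}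
    (hu : MemLp u 2 (μ.prod ν)) (hv : MemLp v 2 (μ.prod ν)) :
    (∀ᵐ x ∂μ, ∀ j, ∫ y, inner 𝕜 (f j y) (v (x, y)) ∂ν =
        c j * ∫ y, inner 𝕜 (f j y) (u (x, y)) ∂ν) ↔
      ∀ i j, ∫ p, inner 𝕜 (e i p.1 * f j p.2) (v p) ∂(μ.prod ν) =
        c j * ∫ p, inner 𝕜 (e i p.1 * f j p.2) (u p) ∂(μ.prod ν) := by
  have hcu : ∀ i j, c j * ∫ p, inner 𝕜 (e i p.1 * f j p.2) (u p) ∂(μ.prod ν) =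
      ∫ x, inner 𝕜 (e i x) (c j * ∫ y, inner 𝕜 (f j y) (u (x, y)) ∂ν) ∂μ := by
    intro i j
    rw [integral_inner_tensor (Lp.memLp (e i)) (Lp.memLp (f j)) hu, ← integral_const_mul]
    congr 1; funext x
    simp only [RCLike.inner_apply]; ring
  -- Countability of `κ` exchanges "almost every `x`" with "every `j`". For fixed `j` both sides are
  -- square integrable in `x`, so they are compared through their coefficients along `e`.
  rw [ae_all_iff, forall_comm (α := ι)]
  refine forall_congr' fun j => ?_
  simp only [hcu]
  constructor
  · intro h i
    rw [integral_inner_tensor (Lp.memLp (e i)) (Lp.memLp (f j)) hv]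
    refine integral_congr_ae ?_
    filter_upwards [h] with x hx
    rw [hx]
  · intro h
    refine HilbertBasis.ae_eq_of_integral_inner e (MemLp.partial_inner (Lp.memLp (f j)) hv)
      ((MemLp.partial_inner (Lp.memLp (f j)) hu).const_mul (c j)) fun i => ?_
    rw [← h i, integral_inner_tensor (Lp.memLp (e i)) (Lp.memLp (f j)) hv]

theorem ae_slice_diagonal_iff_left [Countable ι] (e : HilbertBasis ι 𝕜 (Lp 𝕜 2 μ))
    (f : HilbertBasis κ 𝕜 (Lp 𝕜 2 ν)) (c : ι → 𝕜) {u v : X × Y → 𝕜}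
    (hu : MemLp u 2 (μ.prod ν)) (hv : MemLp v 2 (μ.prod ν)) :
    (∀ᵐ y ∂ν, ∀ i, ∫ x, inner 𝕜 (e i x) (v (x, y)) ∂μ =
        c i * ∫ x, inner 𝕜 (e i x) (u (x, y)) ∂μ) ↔
      ∀ i j, ∫ p, inner 𝕜 (e i p.1 * f j p.2) (v p) ∂(μ.prod ν) =
        c i * ∫ p, inner 𝕜 (e i p.1 * f j p.2) (u p) ∂(μ.prod ν) := by
  have hsw : ∀ (w : X × Y → 𝕜) i j, ∫ p, inner 𝕜 (e i p.1 * f j p.2) (w p) ∂(μ.prod ν) =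
      ∫ p : Y × X, inner 𝕜 (f j p.1 * e i p.2) (w p.swap) ∂(ν.prod μ) := by
    intro w i j
    rw [← integral_prod_swap]
    simp only [Prod.fst_swap, Prod.snd_swap, mul_comm]
  simp only [hsw]
  rw [forall_comm]
  exact ae_slice_diagonal_iff f e c (MemLp.swap_prod hu) (MemLp.swap_prod hv)

/-- In coordinates with respect to a Hilbert basis, contractive real multipliers are defined
everywhere. -/
theorem HilbertBasis.exists_multiplier {H : Type*} [NormedAddCommGroup H] [InnerProductSpace 𝕜 H]
    (E : HilbertBasis ι 𝕜 H) (m : ι → ℝ) (hm : ∀ i, |m i| ≤ 1) (v : H) :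
    ∃ w : H, ∀ i, inner 𝕜 (E i) w = (m i : 𝕜) * inner 𝕜 (E i) v := by
  have hmem : Memℓp (fun i => (m i : 𝕜) * E.repr v i) 2 := by
    have h1 := lp.memℓp (E.repr v)
    refine memℓp_gen ?_
    refine Summable.of_nonneg_of_le (fun i => by positivity) (fun i => ?_)
      (h1.summable (by norm_num))
    gcongr
    rw [norm_mul, RCLike.norm_ofReal]
    exact mul_le_of_le_one_left (norm_nonneg _) (hm i)
  refine ⟨E.repr.symm ⟨_, hmem⟩, fun i => ?_⟩
  rw [← E.repr_apply_apply, ← E.repr_apply_apply, LinearIsometryEquiv.apply_symm_apply]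

/-- The sum of two operators acting in separate variables, both diagonal with respect to Hilbert
bases, is diagonal with respect to the basis of products, on its natural domain. -/
theorem exists_hilbertBasis_slicewise_sum [Countable ι] [Countable κ] {ρ : Measure (X × Y)}
    (hρ : ρ = μ.prod ν) (e : HilbertBasis ι 𝕜 (Lp 𝕜 2 μ)) (f : HilbertBasis κ 𝕜 (Lp 𝕜 2 ν))
    {c : ι → ℝ} {d : κ → ℝ} (hc : ∀ i, 0 < c i) (hd : ∀ j, 0 ≤ d j)
    {R : (X → 𝕜) → (X → 𝕜) → Prop} {S : (Y → 𝕜) → (Y → 𝕜) → Prop}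
    (hR : ∀ u v, MemLp u 2 μ → MemLp v 2 μ → (R u v ↔ ∀ i, ∫ x, inner 𝕜 (e i x) (v x) ∂μ =
      (c i : 𝕜) * ∫ x, inner 𝕜 (e i x) (u x) ∂μ))
    (hS : ∀ u v, MemLp u 2 ν → MemLp v 2 ν → (S u v ↔ ∀ j, ∫ y, inner 𝕜 (f j y) (v y) ∂ν =
      (d j : 𝕜) * ∫ y, inner 𝕜 (f j y) (u y) ∂ν)) :
    ∃ E : HilbertBasis (ι × κ) 𝕜 (Lp 𝕜 2 ρ), ∀ u v : Lp 𝕜 2 ρ,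
      (∃ F G : Lp 𝕜 2 ρ, (∀ᵐ y ∂ν, R (fun x => u (x, y)) fun x => F (x, y)) ∧
        (∀ᵐ x ∂μ, S (fun y => u (x, y)) fun y => G (x, y)) ∧ v = F + G) ↔
      ∀ p, inner 𝕜 (E p) v = ((c p.1 + d p.2 : ℝ) : 𝕜) * inner 𝕜 (E p) u := by
  subst hρ
  obtain ⟨E, hE⟩ := exists_hilbertBasis_tensor e f
  refine ⟨E, fun u v => ?_⟩
  have hinner : ∀ (w : Lp 𝕜 2 (μ.prod ν)) i j, inner 𝕜 (E (i, j)) w =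
      ∫ p, inner 𝕜 (e i p.1 * f j p.2) (w p) ∂(μ.prod ν) := by
    intro w i j
    rw [L2.inner_def]
    refine integral_congr_ae ?_
    filter_upwards [hE (i, j)] with z hz
    rw [hz]
  have hRF : ∀ F : Lp 𝕜 2 (μ.prod ν), (∀ᵐ y ∂ν, R (fun x => u (x, y)) fun x => F (x, y)) ↔
      ∀ p, inner 𝕜 (E p) F = (c p.1 : 𝕜) * inner 𝕜 (E p) u := by
    intro F
    have h1 := ae_slice_diagonal_iff_left e f (fun i => (c i : 𝕜)) (Lp.memLp u) (Lp.memLp F)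
    simp only [← hinner] at h1
    rw [Prod.forall, ← h1]
    refine eventually_congr ?_
    filter_upwards [MemLp.ae_slice_left (Lp.memLp u), MemLp.ae_slice_left (Lp.memLp F)]
      with y h2 h3 using hR _ _ h2 h3
  have hSF : ∀ F : Lp 𝕜 2 (μ.prod ν), (∀ᵐ x ∂μ, S (fun y => u (x, y)) fun y => F (x, y)) ↔
      ∀ p, inner 𝕜 (E p) F = (d p.2 : 𝕜) * inner 𝕜 (E p) u := by
    intro F
    have h1 := ae_slice_diagonal_iff e f (fun j => (d j : 𝕜)) (Lp.memLp u) (Lp.memLp F)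
    simp only [← hinner] at h1
    rw [Prod.forall, ← h1]
    refine eventually_congr ?_
    filter_upwards [MemLp.ae_slice_right (Lp.memLp u), MemLp.ae_slice_right (Lp.memLp F)]
      with y h2 h3 using hS _ _ h2 h3
  simp only [hRF, hSF]
  constructor
  · rintro ⟨F, G, h1, h2, rfl⟩ p
    rw [inner_add_right, h1, h2, RCLike.ofReal_add, add_mul]
  · intro h
    have hpos : ∀ p : ι × κ, 0 < c p.1 + d p.2 := fun p => add_pos_of_pos_of_nonneg (hc _) (hd _)
    -- `F` is the candidate for the part of `v` in the first variable. It lies in `L²` because `c /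
    -- (c + d) ≤ 1`, and `v - F` is then the other part.
    obtain ⟨F, hF⟩ := HilbertBasis.exists_multiplier E (fun p => c p.1 / (c p.1 + d p.2))
      (fun p => by
        rw [abs_of_nonneg (div_nonneg (hc _).le (hpos p).le), div_le_one (hpos p)]
        linarith [hd p.2]) v
    have hF' : ∀ p, inner 𝕜 (E p) F = (c p.1 : 𝕜) * inner 𝕜 (E p) u := by
      intro p
      have hne : ((c p.1 + d p.2 : ℝ) : 𝕜) ≠ 0 := RCLike.ofReal_ne_zero.2 (hpos p).ne'
      rw [hF, h, ← mul_assoc, RCLike.ofReal_div, div_mul_cancel₀ _ hne]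
    refine ⟨F, v - F, hF', fun p => ?_, by abel⟩
    rw [inner_sub_right, hF', h, RCLike.ofReal_add]; ring

end SquareIntegrable

/-! ### Hilbert-Schmidt operators -/

section HilbertSchmidt

variable {𝕜 : Type*} [RCLike 𝕜] {H G : Type*} [NormedAddCommGroup H] [InnerProductSpace 𝕜 H]
  [NormedAddCommGroup G] [InnerProductSpace 𝕜 G] [CompleteSpace G]

omit [CompleteSpace G] in
-- Cauchy-Schwarz followed by Bessel's inequality. Applied to finite blocks outside a large set, it
-- bounds the distance of `A` from its finite-rank truncations in operator norm.
theorem norm_sum_inner_smul_le {ι : Type*} {e : ι → H} (he : Orthonormal 𝕜 e) (A : H →L[𝕜] G)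
    (s : Finset ι) (x : H) :
    ‖∑ i ∈ s, inner 𝕜 (e i) x • A (e i)‖ ≤ √(∑ i ∈ s, ‖A (e i)‖ ^ 2) * ‖x‖ := by
  calc ‖∑ i ∈ s, inner 𝕜 (e i) x • A (e i)‖
      ≤ ∑ i ∈ s, ‖A (e i)‖ * ‖inner 𝕜 (e i) x‖ := by
        refine (norm_sum_le _ _).trans (Finset.sum_le_sum fun i _ => ?_)
        rw [norm_smul, mul_comm]
    _ ≤ √(∑ i ∈ s, ‖A (e i)‖ ^ 2) * √(∑ i ∈ s, ‖inner 𝕜 (e i) x‖ ^ 2) :=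
        Real.sum_mul_le_sqrt_mul_sqrt _ _ _
    _ ≤ _ := by
        gcongr
        rw [← Real.sqrt_sq (norm_nonneg x)]
        exact Real.sqrt_le_sqrt (he.sum_inner_products_le x)

/-- Hilbert-Schmidt operators are compact. -/
theorem isCompactOperator_of_summable {ι : Type*} (e : HilbertBasis ι 𝕜 H) (A : H →L[𝕜] G)
    (hA : Summable fun i => ‖A (e i)‖ ^ 2) : IsCompactOperator A := by
  classical
  let F : Finset ι → H →L[𝕜] G := fun s =>
    ∑ i ∈ s, (ContinuousLinearMap.toSpanSingleton 𝕜 (A (e i))).comp (innerSL 𝕜 (e i))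
  have hF : ∀ s x, F s x = ∑ i ∈ s, inner 𝕜 (e i) x • A (e i) := by
    intro s x
    simp [F]
  have hsum : ∀ x, Tendsto (fun s => F s x) atTop (𝓝 (A x)) := by
    intro x
    have h1 := A.hasSum (e.hasSum_repr x)
    simp only [map_smul, e.repr_apply_apply] at h1
    simpa only [hF] using! h1
  have hcomp : ∀ s, IsCompactOperator (F s) := by
    intro s
    induction s using Finset.induction_on with
    | empty => simpa [F] using! isCompactOperator_zero
    | insert i s his ih =>
      have h1 : F (insert i s) =
        (ContinuousLinearMap.toSpanSingleton 𝕜 (A (e i))).comp (innerSL 𝕜 (e i)) + F s := by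
        simp only [F, Finset.sum_insert his]
      rw [h1]
      refine IsCompactOperator.add ?_ ih
      have h2 : IsCompactOperator (innerSL 𝕜 (e i)) :=
        isCompactOperator_of_locallyCompactSpace_dom _
      exact h2.clm_comp (ContinuousLinearMap.toSpanSingleton 𝕜 (A (e i)))
  refine isCompactOperator_of_tendsto (l := atTop) (F := F) ?_ (Eventually.of_forall hcomp)
  rw [Metric.tendsto_atTop]
  intro ε hε
  obtain ⟨s, hs⟩ := summable_iff_vanishing_norm.1 hA ((ε / 2) ^ 2) (by positivity)
  refine ⟨s, fun t ht => ?_⟩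
  rw [dist_eq_norm]
  refine lt_of_le_of_lt (ContinuousLinearMap.opNorm_le_bound _ (by positivity : 0 ≤ ε / 2)
    fun x => ?_) (by linarith)
  rw [sub_apply]
  -- The series converges to `A` only pointwise a priori; the norm bound comes from the finite
  -- blocks `r \ t`, uniformly in `r`.
  refine le_of_tendsto ((tendsto_const_nhds (x := F t x)).sub (hsum x)).norm ?_
  filter_upwards [eventually_ge_atTop t] with r hr
  rw [norm_sub_rev, hF, hF, ← Finset.sum_sdiff hr, add_sub_cancel_right]
  refine (norm_sum_inner_smul_le e.orthonormal A _ x).trans ?_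
  gcongr
  refine Real.sqrt_le_iff.2 ⟨by positivity, ?_⟩
  have h1 := hs (r \ t) (Finset.disjoint_of_subset_right ht Finset.sdiff_disjoint)
  exact (le_abs_self _).trans h1.le

variable {X Y : Type*} [MeasurableSpace X] [MeasurableSpace Y]
  {μ : Measure X} {ν : Measure Y} [SFinite μ] [SFinite ν]

/-- Cauchy-Schwarz in `x` for each fixed `y`, then integration in `y`. -/
theorem memLp_kernel_integral {k : Y × X → ℝ} (hk : MemLp k 2 (ν.prod μ)) {f : X → 𝕜}
    (hf : MemLp f 2 μ) : MemLp (fun y => ∫ x, k (y, x) • f x ∂μ) 2 ν ∧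
      eLpNorm (fun y => ∫ x, k (y, x) • f x ∂μ) 2 ν ≤
        eLpNorm k 2 (ν.prod μ) * eLpNorm f 2 μ := by
  have hm : AEStronglyMeasurable (fun p : Y × X => k p • f p.2) (ν.prod μ) :=
    hk.1.smul hf.1.comp_snd
  have hb : ∫⁻ y, ‖∫ x, k (y, x) • f x ∂μ‖ₑ ^ 2 ∂ν ≤
      (eLpNorm k 2 (ν.prod μ) * eLpNorm f 2 μ) ^ 2 := by
    rw [mul_pow, eLpNorm_two_sq k, lintegral_prod _ (hk.1.enorm.pow_const 2),
      ← lintegral_mul_const'' _ ((hk.1.enorm.pow_const 2).lintegral_prod_right')]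
    refine lintegral_mono_ae ?_
    filter_upwards [hk.1.prodMk_left] with y hy
    rw [← eLpNorm_two_sq (fun x => k (y, x)), ← mul_pow]
    gcongr
    exact enorm_integral_smul_le hy hf.1
  have hm' := hm.integral_prod_right'
  constructor
  · rw [memLp_two_iff_lintegral_lt_top hm']
    exact hb.trans_lt (ENNReal.pow_lt_top (ENNReal.mul_lt_top hk.2 hf.2))
  · rw [← eLpNorm_two_sq] at hb
    exact (ENNReal.pow_le_pow_left_iff two_ne_zero).1 hb

/-- The integral operator with a square integrable real kernel. -/
def kernelOp (𝕜 : Type*) [RCLike 𝕜] {k : Y × X → ℝ} (hk : MemLp k 2 (ν.prod μ)) :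
    Lp 𝕜 2 μ →L[𝕜] Lp 𝕜 2 ν :=
  LinearMap.mkContinuous
    { toFun := fun f => (memLp_kernel_integral hk (Lp.memLp f)).1.toLp _
      map_add' := by
        intro f g
        rw [← MemLp.toLp_add, MemLp.toLp_eq_toLp_iff]
        filter_upwards [MemLp.ae_slice_right hk] with y hy
        have h1 : (fun x => k (y, x) • (f + g) x) =ᵐ[μ]
            fun x => k (y, x) • f x + k (y, x) • g x := by
          filter_upwards [Lp.coeFn_add f g] with x hx
          rw [hx, Pi.add_apply, smul_add]
        rw [Pi.add_apply, integral_congr_ae h1]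
        exact integral_add (memLp_one_iff_integrable.1 ((Lp.memLp f).smul hy))
          (memLp_one_iff_integrable.1 ((Lp.memLp g).smul hy))
      map_smul' := by
        intro c f
        rw [RingHom.id_apply, ← MemLp.toLp_const_smul, MemLp.toLp_eq_toLp_iff]
        refine Eventually.of_forall fun y => ?_
        have h1 : (fun x => k (y, x) • (c • f) x) =ᵐ[μ]
            fun x => c • k (y, x) • f x := by
          filter_upwards [Lp.coeFn_smul c f] with x hx
          rw [hx, Pi.smul_apply, smul_comm]
        simp only [Pi.smul_apply]
        rw [integral_congr_ae h1, integral_smul] }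
    (eLpNorm k 2 (ν.prod μ)).toReal
    (by
      intro f
      simp only [LinearMap.coe_mk, AddHom.coe_mk]
      rw [Lp.norm_toLp, Lp.norm_def, ← ENNReal.toReal_mul]
      exact ENNReal.toReal_mono (ENNReal.mul_lt_top hk.2 (Lp.memLp f).2).ne
        (memLp_kernel_integral hk (Lp.memLp f)).2)

theorem kernelOp_coeFn {k : Y × X → ℝ} (hk : MemLp k 2 (ν.prod μ)) (f : Lp 𝕜 2 μ) :
    kernelOp 𝕜 hk f =ᵐ[ν] fun y => ∫ x, k (y, x) • f x ∂μ :=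
  (memLp_kernel_integral hk (Lp.memLp f)).1.coeFn_toLp

theorem enorm_Lp_sq (f : Lp 𝕜 2 μ) : ‖f‖ₑ ^ 2 = ∫⁻ x, ‖f x‖ₑ ^ 2 ∂μ := by
  rw [← eLpNorm_two_sq, Lp.enorm_def]

/-- For fixed `y`, the values at `y` of the images of the basis vectors are, up to conjugation, the
Fourier coefficients of `k (y, ·)`. Bessel's inequality and integration in `y` bound the
Hilbert-Schmidt norm by the `L²` norm of the kernel. -/
theorem isCompactOperator_kernelOp {k : Y × X → ℝ} (hk : MemLp k 2 (ν.prod μ)) :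
    IsCompactOperator (kernelOp 𝕜 hk) := by
  obtain ⟨w, e, -⟩ := exists_hilbertBasis 𝕜 (Lp 𝕜 2 μ)
  refine isCompactOperator_of_summable e _ ?_
  refine summable_of_sum_le (c := (eLpNorm k 2 (ν.prod μ) ^ 2).toReal) (fun _ => sq_nonneg _)
    fun s => ?_
  rw [← ENNReal.ofReal_le_iff_le_toReal (ENNReal.pow_lt_top hk.2).ne,
    ENNReal.ofReal_sum_of_nonneg (fun _ _ => sq_nonneg _)]
  simp only [ENNReal.ofReal_pow (norm_nonneg _), ofReal_norm]
  simp only [enorm_Lp_sq]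
  rw [← lintegral_finsetSum' _ fun i _ => (Lp.aestronglyMeasurable _).enorm.pow_const 2,
    eLpNorm_two_sq k, lintegral_prod _ (hk.1.enorm.pow_const 2)]
  refine lintegral_mono_ae ?_
  have h1 : ∀ᵐ y ∂ν, ∀ i ∈ s, kernelOp 𝕜 hk (e i) y = ∫ x, k (y, x) • e i x ∂μ :=
    (Finset.eventually_all s).2 fun i _ => kernelOp_coeFn hk (e i)
  filter_upwards [h1, MemLp.ae_slice_right hk] with y hy hyk
  have hyk' : MemLp (fun x => (k (y, x) : 𝕜)) 2 μ := hyk.ofReal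
  have h2 := e.orthonormal.sum_inner_products_le (s := s) (hyk'.toLp _)
  have h3 : ∀ i ∈ s, ‖kernelOp 𝕜 hk (e i) y‖ₑ ^ 2 =
      ENNReal.ofReal (‖inner 𝕜 (e i) (hyk'.toLp _)‖ ^ 2) := by
    intro i hi
    rw [ENNReal.ofReal_pow (norm_nonneg _), norm_inner_symm, ofReal_norm, hy i hi,
      ← inner_conj_symm, inner_Lp_toLp, ← integral_conj]
    congr 2
    refine integral_congr_ae (Eventually.of_forall fun x => ?_)
    simp [RCLike.inner_apply, RCLike.real_smul_eq_coe_mul]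
  rw [Finset.sum_congr rfl h3, ← ENNReal.ofReal_sum_of_nonneg fun _ _ => sq_nonneg _]
  refine (ENNReal.ofReal_le_ofReal h2).trans (le_of_eq ?_)
  rw [ENNReal.ofReal_pow (norm_nonneg _), ofReal_norm, Lp.enorm_toLp, eLpNorm_two_sq]
  refine lintegral_congr fun x => ?_
  rw [← ofReal_norm, ← ofReal_norm, RCLike.norm_ofReal, Real.norm_eq_abs]

/-- Fubini: as the kernel is real, the adjoint has the transposed kernel, with no conjugation. -/
theorem inner_kernelOp {k : Y × X → ℝ} (hk : MemLp k 2 (ν.prod μ)) (f : Lp 𝕜 2 μ)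
    (g : Lp 𝕜 2 ν) : inner 𝕜 (kernelOp 𝕜 hk f) g =
      inner 𝕜 f (kernelOp 𝕜 (MemLp.swap_prod hk) g) := by
  have hi : Integrable (fun p : Y × X => k p • inner 𝕜 (f p.2) (g p.1)) (ν.prod μ) := by
    have h1 : MemLp (fun p : Y × X => inner 𝕜 (f p.2) (g p.1)) 2 (ν.prod μ) := by
      simp only [RCLike.inner_apply]
      exact MemLp.tensor (Lp.memLp g) (Lp.memLp f).star
    exact memLp_one_iff_integrable.1 (h1.smul hk)
  have e1 : inner 𝕜 (kernelOp 𝕜 hk f) g =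
      ∫ y, ∫ x, k (y, x) • inner 𝕜 (f x) (g y) ∂μ ∂ν := by
    rw [L2.inner_def]
    refine integral_congr_ae ?_
    filter_upwards [kernelOp_coeFn hk f] with y hy
    rw [hy, RCLike.inner_apply, ← integral_conj, ← integral_const_mul]
    congr 1; funext x
    simp only [RCLike.inner_apply, RCLike.real_smul_eq_coe_mul, map_mul, RCLike.conj_ofReal]
    ring
  have e2 : inner 𝕜 f (kernelOp 𝕜 (MemLp.swap_prod hk) g) =
      ∫ x, ∫ y, k (y, x) • inner 𝕜 (f x) (g y) ∂ν ∂μ := by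
    rw [L2.inner_def]
    refine integral_congr_ae ?_
    filter_upwards [kernelOp_coeFn (MemLp.swap_prod hk) g] with x hx
    rw [hx, RCLike.inner_apply, ← integral_mul_const]
    congr 1; funext y
    simp only [RCLike.inner_apply, RCLike.real_smul_eq_coe_mul, Prod.swap_prod_mk]
    ring
  rw [e1, e2, ← integral_prod _ hi, ← integral_prod_symm _ hi]

end HilbertSchmidt

end

section

/-! ### Power kernels on the line -/

section PowerKernels

theorem setLIntegral_Ioo_eq_of_hasDerivAt {p q : ℝ} (hpq : p ≤ q) {F F' : ℝ → ℝ}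
    (hF : ∀ x ∈ Icc p q, HasDerivAt F (F' x) x) (hc : ContinuousOn F' (Icc p q))
    (h0 : ∀ x ∈ Icc p q, 0 ≤ F' x) :
    ∫⁻ x in Ioo p q, ENNReal.ofReal (F' x) = ENNReal.ofReal (F q - F p) := by
  have hi : IntervalIntegrable F' volume p q :=
    (hc.mono (by rw [uIcc_of_le hpq])).intervalIntegrable
  rw [← intervalIntegral.integral_eq_sub_of_hasDerivAt (by rwa [uIcc_of_le hpq]) hi,
    intervalIntegral.integral_of_le hpq, integral_Ioc_eq_integral_Ioo,
    ofReal_integral_eq_lintegral_ofReal]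
  · exact (intervalIntegrable_iff_integrableOn_Ioo_of_le hpq).1 hi
  · rw [EventuallyLE, ae_restrict_iff' measurableSet_Ioo]
    exact Eventually.of_forall fun x hx => h0 x (Ioo_subset_Icc_self hx)

theorem setLIntegral_Ioo_sub_rpow {γ x c : ℝ} (hγ : -1 < γ) (hxc : x ≤ c) :
    ∫⁻ t in Ioo x c, ENNReal.ofReal ((t - x) ^ γ) =
      ENNReal.ofReal ((c - x) ^ (γ + 1) / (γ + 1)) := by
  have hi : IntervalIntegrable (fun t => (t - x) ^ γ) volume x c := by
    have := (intervalIntegral.intervalIntegrable_rpow' (a := 0) (b := c - x) hγ).comp_sub_right x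
    simpa using this
  have h1 : ∫ t in x..c, (t - x) ^ γ = (c - x) ^ (γ + 1) / (γ + 1) := by
    rw [intervalIntegral.integral_comp_sub_right (fun t => t ^ γ), integral_rpow (Or.inl hγ),
      sub_self, Real.zero_rpow (by linarith), sub_zero]
  rw [← h1, intervalIntegral.integral_of_le hxc, integral_Ioc_eq_integral_Ioo,
    ofReal_integral_eq_lintegral_ofReal]
  · exact (intervalIntegrable_iff_integrableOn_Ioo_of_le hxc).1 hi
  · rw [EventuallyLE, ae_restrict_iff' measurableSet_Ioo]
    exact Eventually.of_forall fun t ht => Real.rpow_nonneg (by linarith [ht.1]) _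

theorem setLIntegral_Ioo_rpow_sub {γ x c : ℝ} (hγ : -1 < γ) (hxc : c ≤ x) :
    ∫⁻ t in Ioo c x, ENNReal.ofReal ((x - t) ^ γ) =
      ENNReal.ofReal ((x - c) ^ (γ + 1) / (γ + 1)) := by
  have hi : IntervalIntegrable (fun t => (x - t) ^ γ) volume c x := by
    have := (intervalIntegral.intervalIntegrable_rpow' (a := x - c) (b := 0) hγ).comp_sub_left x
    simpa using this
  have h1 : ∫ t in c..x, (x - t) ^ γ = (x - c) ^ (γ + 1) / (γ + 1) := by
    rw [intervalIntegral.integral_comp_sub_left (fun t => t ^ γ), integral_rpow (Or.inl hγ),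
      sub_self, Real.zero_rpow (by linarith), sub_zero]
  rw [← h1, intervalIntegral.integral_of_le hxc, integral_Ioc_eq_integral_Ioo,
    ofReal_integral_eq_lintegral_ofReal]
  · exact (intervalIntegrable_iff_integrableOn_Ioo_of_le hxc).1 hi
  · rw [EventuallyLE, ae_restrict_iff' measurableSet_Ioo]
    exact Eventually.of_forall fun t ht => Real.rpow_nonneg (by linarith [ht.2]) _

/-- The fundamental theorem of calculus for a decreasing power, arranged so that all terms are
nonnegative. It can then be inserted under lower Lebesgue integrals without any integrability check.
-/
theorem rpow_eq_add_setLIntegral_right {α p t q : ℝ} (hα : α ≤ 1) (hp : p < t) (htq : t ≤ q) :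
    ENNReal.ofReal ((q - p) ^ (α - 1)) +
      ∫⁻ σ in Ioo t q, ENNReal.ofReal ((1 - α) * (σ - p) ^ (α - 2)) =
      ENNReal.ofReal ((t - p) ^ (α - 1)) := by
  rw [setLIntegral_Ioo_eq_of_hasDerivAt (F := fun σ => -(σ - p) ^ (α - 1)) htq,
    ← ENNReal.ofReal_add (Real.rpow_nonneg (by linarith) _)]
  · congr 1; ring
  · rw [sub_nonneg, neg_le_neg_iff]
    exact Real.rpow_le_rpow_of_nonpos (by linarith) (by linarith) (by linarith)
  · intro x hx
    have h1 : HasDerivAt (fun σ : ℝ => σ - p) 1 x := (hasDerivAt_id x).sub_const p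
    have := (h1.rpow_const (p := α - 1) (Or.inl (by linarith [hx.1]))).fun_neg
    refine this.congr_deriv ?_
    rw [show α - 1 - 1 = α - 2 by ring]; ring
  · intro x hx
    refine ContinuousAt.continuousWithinAt (ContinuousAt.mul continuousAt_const ?_)
    exact ContinuousAt.rpow_const (by fun_prop) (Or.inl (by linarith [hx.1]))
  · intro x hx
    exact mul_nonneg (by linarith) (Real.rpow_nonneg (by linarith [hx.1]) _)

theorem rpow_eq_add_setLIntegral_left {α x τ t : ℝ} (hα : α ≤ 1) (hx : x ≤ τ) (hτ : τ < t) :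
    ENNReal.ofReal ((t - x) ^ (α - 1)) +
      ∫⁻ ξ in Ioo x τ, ENNReal.ofReal ((1 - α) * (t - ξ) ^ (α - 2)) =
      ENNReal.ofReal ((t - τ) ^ (α - 1)) := by
  rw [setLIntegral_Ioo_eq_of_hasDerivAt (F := fun ξ => (t - ξ) ^ (α - 1)) hx,
    ← ENNReal.ofReal_add (Real.rpow_nonneg (by linarith) _)]
  · congr 1; ring
  · rw [sub_nonneg]
    exact Real.rpow_le_rpow_of_nonpos (by linarith) (by linarith) (by linarith)
  · intro ξ hξ
    have h1 : HasDerivAt (fun σ : ℝ => t - σ) (-1) ξ := (hasDerivAt_id ξ).const_sub t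
    have := (h1.rpow_const (p := α - 1) (Or.inl (by linarith [hξ.2])))
    refine this.congr_deriv ?_
    rw [show α - 1 - 1 = α - 2 by ring]; ring
  · intro ξ hξ
    refine ContinuousAt.continuousWithinAt (ContinuousAt.mul continuousAt_const ?_)
    exact ContinuousAt.rpow_const (by fun_prop) (Or.inl (by linarith [hξ.2]))
  · intro ξ hξ
    exact mul_nonneg (by linarith) (Real.rpow_nonneg (by linarith [hξ.2]) _)

/-- The kernel `(x - t)_+^{β-1} / Γ(β)` of the fractional integrals. -/
def fracKernel (β : ℝ) (p : ℝ × ℝ) : ℝ :=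
  if p.2 < p.1 then (Real.Gamma β)⁻¹ * (p.1 - p.2) ^ (β - 1) else 0

theorem measurable_fracKernel (β : ℝ) : Measurable (fracKernel β) := by
  refine Measurable.ite (measurableSet_lt measurable_snd measurable_fst) ?_ measurable_const
  fun_prop

theorem fracKernel_nonneg {β : ℝ} (hβ : 0 < β) (p : ℝ × ℝ) : 0 ≤ fracKernel β p := by
  unfold fracKernel
  split_ifs with h
  · exact mul_nonneg (inv_nonneg.2 (Real.Gamma_pos_of_pos hβ).le)
      (Real.rpow_nonneg (by linarith) _)
  · exact le_rfl

theorem fracKernel_of_lt {β x t : ℝ} (h : t < x) :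
    fracKernel β (x, t) = (Real.Gamma β)⁻¹ * (x - t) ^ (β - 1) := if_pos h

theorem fracKernel_of_le {β x t : ℝ} (h : x ≤ t) : fracKernel β (x, t) = 0 := if_neg h.not_gt

variable {a b : ℝ}

/-- The composition of two complementary fractional kernels is the Heaviside kernel. -/
theorem setLIntegral_fracKernel_mul {β γ : ℝ} (hβ : 0 < β) (hγ : 0 < γ) (hβγ : β + γ = 1)
    {x τ : ℝ} (hx : x ≤ b) (hτ : a ≤ τ) :
    ∫⁻ t in Ioo a b, ENNReal.ofReal (fracKernel β (x, t) * fracKernel γ (t, τ)) =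
      if τ < x then 1 else 0 := by
  have hG1 := Real.Gamma_pos_of_pos hβ
  have hG2 := Real.Gamma_pos_of_pos hγ
  have e1 : ∀ t, t ∉ Ioo τ x → fracKernel β (x, t) * fracKernel γ (t, τ) = 0 := by
    intro t ht
    by_cases h : τ < t
    · rw [fracKernel_of_le (x := x) (not_lt.1 fun h' => ht ⟨h, h'⟩), zero_mul]
    · rw [fracKernel_of_le (t := τ) (not_lt.1 h), mul_zero]
  split_ifs with hτx
  · have e2 : ∫⁻ t in Ioo a b, ENNReal.ofReal (fracKernel β (x, t) * fracKernel γ (t, τ)) =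
        ∫⁻ t in Ioo τ x, ENNReal.ofReal (fracKernel β (x, t) * fracKernel γ (t, τ)) := by
      rw [← lintegral_indicator measurableSet_Ioo, ← lintegral_indicator measurableSet_Ioo]
      congr 1; funext t
      by_cases h : t ∈ Ioo τ x
      · rw [indicator_of_mem h,
          indicator_of_mem (show t ∈ Ioo a b from ⟨hτ.trans_lt h.1, h.2.trans_le hx⟩)]
      · rw [indicator_of_notMem h, indicator_apply_eq_zero]
        intro _
        rw [e1 t h, ENNReal.ofReal_zero]
    rw [e2]
    -- Rescaling to the unit interval turns the integral into Euler's beta integral. As `β + γ = 1`,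
    -- all powers of `x - τ` cancel and `Γ(β + γ) = 1`, so what remains is the beta density, of
    -- total mass one.
    have himg : (fun r : ℝ => τ + (x - τ) * r) '' Ioo 0 1 = Ioo τ x := by
      have hpos : 0 < x - τ := sub_pos.2 hτx
      ext t
      constructor
      · rintro ⟨r, ⟨h0, h1⟩, rfl⟩
        constructor
        · simp only; nlinarith
        · simp only; nlinarith
      · rintro ⟨h0, h1⟩
        refine ⟨(t - τ) / (x - τ), ⟨div_pos (by linarith) hpos, (div_lt_one hpos).2 (by linarith)⟩,
          ?_⟩
        simp only
        field_simp
        ring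
    rw [← himg, lintegral_image_eq_lintegral_abs_deriv_mul measurableSet_Ioo
      (f' := fun _ => x - τ) ?_ ?_]
    · rw [← ProbabilityTheory.lintegral_betaPDF_eq_one hγ hβ, ProbabilityTheory.lintegral_betaPDF]
      refine setLIntegral_congr_fun measurableSet_Ioo fun r hr => ?_
      have hpos : 0 < x - τ := sub_pos.2 hτx
      rw [← ENNReal.ofReal_mul (abs_nonneg _)]
      congr 1
      have h1 : τ + (x - τ) * r < x := by nlinarith [hr.2]
      have h2 : τ < τ + (x - τ) * r := by nlinarith [hr.1]
      rw [fracKernel_of_lt h1, fracKernel_of_lt h2, ProbabilityTheory.beta, add_comm γ β, hβγ,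
        Real.Gamma_one, abs_of_pos hpos,
        show x - (τ + (x - τ) * r) = (x - τ) * (1 - r) by ring,
        show τ + (x - τ) * r - τ = (x - τ) * r by ring,
        Real.mul_rpow hpos.le (by linarith [hr.2]), Real.mul_rpow hpos.le hr.1.le]
      have h3 : (x - τ) * ((x - τ) ^ (β - 1) * (x - τ) ^ (γ - 1)) = 1 := by
        rw [← Real.rpow_add hpos, show β - 1 + (γ - 1) = -1 by linarith, Real.rpow_neg_one,
          mul_inv_cancel₀ hpos.ne']
      calc (x - τ) * ((Real.Gamma β)⁻¹ * ((x - τ) ^ (β - 1) * (1 - r) ^ (β - 1)) *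
            ((Real.Gamma γ)⁻¹ * ((x - τ) ^ (γ - 1) * r ^ (γ - 1))))
          = ((x - τ) * ((x - τ) ^ (β - 1) * (x - τ) ^ (γ - 1))) *
            ((Real.Gamma β)⁻¹ * (Real.Gamma γ)⁻¹ * r ^ (γ - 1) * (1 - r) ^ (β - 1)) := by ring
        _ = _ := by rw [h3]; field_simp
    · intro r _
      have h1 : HasDerivAt (fun r : ℝ => τ + (x - τ) * r) ((x - τ) * 1) r :=
        ((hasDerivAt_id r).const_mul (x - τ)).const_add τ
      rw [mul_one] at h1
      exact h1.hasDerivWithinAt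
    · intro r _ r' _ h
      have hpos : x - τ ≠ 0 := (sub_pos.2 hτx).ne'
      exact mul_left_cancel₀ hpos (add_left_cancel h)
  · refine (lintegral_congr fun t => ?_).trans lintegral_zero
    rw [e1 t fun h => hτx (h.1.trans h.2), ENNReal.ofReal_zero]

end PowerKernels

/-! ### Compositions of integral operators with nonnegative kernels -/

section KernelComposition

variable {𝕜 : Type*} [RCLike 𝕜] {X Y : Type*} [MeasurableSpace X] [MeasurableSpace Y]
  {μ : Measure X} {ν : Measure Y} [SFinite μ] [SFinite ν]

/-- Fubini's theorem for an integral operator with a nonnegative kernel. -/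
theorem integral_kernel_smul {W : X × Y → ℝ≥0∞} (hW : Measurable W) {g : Y → 𝕜}
    (hg : AEStronglyMeasurable g ν)
    (hfin : ∫⁻ y, (∫⁻ x, W (x, y) ∂μ) * ‖g y‖ₑ ∂ν ≠ ⊤) :
    Integrable (fun x => ∫ y, (W (x, y)).toReal • g y ∂ν) μ ∧
      (∀ᵐ x ∂μ, Integrable (fun y => (W (x, y)).toReal • g y) ν) ∧
      Integrable (fun y => (∫⁻ x, W (x, y) ∂μ).toReal • g y) ν ∧
      ∫ x, ∫ y, (W (x, y)).toReal • g y ∂ν ∂μ =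
        ∫ y, (∫⁻ x, W (x, y) ∂μ).toReal • g y ∂ν := by
  have hK : Measurable fun y => ∫⁻ x, W (x, y) ∂μ := hW.lintegral_prod_left'
  have hi : Integrable (fun p : X × Y => (W p).toReal • g p.2) (μ.prod ν) := by
    refine ⟨hW.ennreal_toReal.aestronglyMeasurable.smul hg.comp_snd, ?_⟩
    have h1 : ∫⁻ p, W p * ‖g p.2‖ₑ ∂(μ.prod ν) = ∫⁻ y, (∫⁻ x, W (x, y) ∂μ) * ‖g y‖ₑ ∂ν := by
      rw [lintegral_prod_symm (fun p : X × Y => W p * ‖g p.2‖ₑ)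
        (hW.aemeasurable.mul hg.comp_snd.enorm)]
      refine lintegral_congr fun y => ?_
      have hm : Measurable fun x => W (x, y) := hW.comp measurable_prodMk_right
      exact lintegral_mul_const (‖g y‖ₑ) hm
    refine lt_of_le_of_lt (lintegral_mono fun p => ?_) (h1 ▸ hfin.lt_top)
    rw [enorm_smul]
    gcongr
    rw [Real.enorm_of_nonneg ENNReal.toReal_nonneg]
    exact ENNReal.ofReal_toReal_le
  have he : ∀ᵐ y ∂ν, ∫ x, (W (x, y)).toReal • g y ∂μ = (∫⁻ x, W (x, y) ∂μ).toReal • g y := by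
    filter_upwards [ae_lt_top' (hK.aemeasurable.mul hg.enorm) hfin] with y hy
    -- The kernel integral may be infinite where `g` vanishes; there both sides are zero. Elsewhere
    -- finiteness of the product forces it to be finite.
    by_cases h0 : g y = 0
    · simp [h0]
    · have h1 : ∫⁻ x, W (x, y) ∂μ ≠ ⊤ := by
        intro h
        rw [Pi.mul_apply, h, ENNReal.top_mul (by simpa using h0)] at hy
        exact lt_irrefl _ hy
      have hm : Measurable fun x => W (x, y) := hW.comp measurable_prodMk_right
      rw [integral_smul_const, integral_toReal hm.aemeasurable (ae_lt_top hm h1)]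
  refine ⟨hi.integral_prod_left, hi.prod_right_ae, ?_, ?_⟩
  · exact hi.integral_prod_right.congr he
  · rw [← integral_prod _ hi, integral_prod_symm _ hi]
    exact integral_congr_ae he

end KernelComposition

end

section

/-! ### Absolute continuity of iterated fractional integrals -/

section IteratedKernel

theorem measurable_setLIntegral_Ioo {X : Type*} [MeasurableSpace X] {F : X × ℝ → ℝ≥0∞}
    (hF : Measurable F) {l : X → ℝ} (hl : Measurable l) (b : ℝ) :
    Measurable fun x => ∫⁻ t in Ioo (l x) b, F (x, t) := by
  have hs : MeasurableSet {p : X × ℝ | l p.1 < p.2 ∧ p.2 < b} :=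
    (measurableSet_lt (hl.comp measurable_fst) measurable_snd).inter
      (measurableSet_lt measurable_snd measurable_const)
  have h1 := (hF.indicator hs).lintegral_prod_right' (ν := volume)
  convert h1 using 2 with x
  rw [← lintegral_indicator measurableSet_Ioo]
  rfl

theorem setLIntegral_triangle_swap {x b : ℝ} {F : ℝ → ℝ → ℝ≥0∞}
    (hF : Measurable (Function.uncurry F)) :
    ∫⁻ t in Ioo x b, ∫⁻ σ in Ioo t b, F t σ = ∫⁻ σ in Ioo x b, ∫⁻ t in Ioo x σ, F t σ := by
  let S : Set (ℝ × ℝ) := {p | x < p.1 ∧ p.1 < p.2 ∧ p.2 < b}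
  have hS : MeasurableSet S :=
    (measurableSet_lt measurable_const measurable_fst).inter
      ((measurableSet_lt measurable_fst measurable_snd).inter
        (measurableSet_lt measurable_snd measurable_const))
  have h1 : ∫⁻ t in Ioo x b, ∫⁻ σ in Ioo t b, F t σ =
      ∫⁻ t, ∫⁻ σ, S.indicator (Function.uncurry F) (t, σ) := by
    rw [← lintegral_indicator measurableSet_Ioo]
    refine lintegral_congr fun t => ?_
    by_cases ht : t ∈ Ioo x b
    · rw [indicator_of_mem ht, ← lintegral_indicator measurableSet_Ioo]
      refine lintegral_congr fun σ => ?_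
      by_cases hσ : σ ∈ Ioo t b
      · rw [indicator_of_mem hσ, indicator_of_mem (show (t, σ) ∈ S from ⟨ht.1, hσ.1, hσ.2⟩)]; rfl
      · rw [indicator_of_notMem hσ, indicator_of_notMem fun h => hσ ⟨h.2.1, h.2.2⟩]
    · rw [indicator_of_notMem ht]
      refine (lintegral_eq_zero_of_ae_eq_zero (Eventually.of_forall fun σ => ?_)).symm
      exact indicator_of_notMem (fun h => ht ⟨h.1, h.2.1.trans h.2.2⟩) _
  have h2 : ∫⁻ σ in Ioo x b, ∫⁻ t in Ioo x σ, F t σ =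
      ∫⁻ σ, ∫⁻ t, S.indicator (Function.uncurry F) (t, σ) := by
    rw [← lintegral_indicator measurableSet_Ioo]
    refine lintegral_congr fun σ => ?_
    by_cases hσ : σ ∈ Ioo x b
    · rw [indicator_of_mem hσ, ← lintegral_indicator measurableSet_Ioo]
      refine lintegral_congr fun t => ?_
      by_cases ht : t ∈ Ioo x σ
      · rw [indicator_of_mem ht, indicator_of_mem (show (t, σ) ∈ S from ⟨ht.1, ht.2, hσ.2⟩)]; rfl
      · rw [indicator_of_notMem ht, indicator_of_notMem fun h => ht ⟨h.1, h.2.1⟩]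
    · rw [indicator_of_notMem hσ]
      refine (lintegral_eq_zero_of_ae_eq_zero (Eventually.of_forall fun t => ?_)).symm
      exact indicator_of_notMem (fun h => hσ ⟨h.1.trans h.2.1, h.2.2⟩) _
  rw [h1, h2]
  exact lintegral_lintegral_swap (f := fun t σ => S.indicator (Function.uncurry F) (t, σ))
    (hF.indicator hS).aemeasurable

variable (α b : ℝ)

/-- The power `(t - x)^{α-1}`, as an extended nonnegative number. -/
def powA (x t : ℝ) : ℝ≥0∞ := ENNReal.ofReal ((t - x) ^ (α - 1))

/-- Minus the derivative of `(t - x)^{α-1}` in `t`. -/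
def powB (x t : ℝ) : ℝ≥0∞ := ENNReal.ofReal ((1 - α) * (t - x) ^ (α - 2))

theorem measurable_powA : Measurable (Function.uncurry (powA α)) := by
  unfold powA Function.uncurry; fun_prop

theorem measurable_powB : Measurable (Function.uncurry (powB α)) := by
  unfold powB Function.uncurry; fun_prop

/-- The iterated kernel `∫ (t - x)_+^{α-1} (t - τ)_+^{α-1} dt`. -/
def iterKernel (x τ : ℝ) : ℝ≥0∞ := ∫⁻ t in Ioo (max x τ) b, powA α x t * powA α τ t

/-- The positive part of the derivative of the iterated kernel in the first variable. -/
def iterKernelInc (p : ℝ × ℝ) : ℝ≥0∞ :=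
  if p.1 < p.2 then ∫⁻ t in Ioo p.2 b, powA α p.2 t * powB α p.1 t else 0

/-- The negative part of the derivative of the iterated kernel in the first variable. -/
def iterKernelDec (p : ℝ × ℝ) : ℝ≥0∞ :=
  if p.2 < p.1 then
    powA α p.1 b * powA α p.2 b + ∫⁻ t in Ioo p.1 b, powA α p.1 t * powB α p.2 t else 0

theorem measurable_iterKernelInc : Measurable (iterKernelInc α b) := by
  refine Measurable.ite (measurableSet_lt measurable_fst measurable_snd) ?_ measurable_const
  refine measurable_setLIntegral_Ioo (F := fun q : (ℝ × ℝ) × ℝ =>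
    powA α q.1.2 q.2 * powB α q.1.1 q.2) ?_ measurable_snd b
  exact ((measurable_powA α).comp (by fun_prop : Measurable fun q : (ℝ × ℝ) × ℝ =>
    (q.1.2, q.2))).mul ((measurable_powB α).comp (by fun_prop : Measurable fun q : (ℝ × ℝ) × ℝ =>
    (q.1.1, q.2)))

theorem measurable_iterKernelDec : Measurable (iterKernelDec α b) := by
  refine Measurable.ite (measurableSet_lt measurable_snd measurable_fst) ?_ measurable_const
  have h1 : Measurable fun q : ℝ × ℝ => powA α q.1 b * powA α q.2 b :=
    ((measurable_powA α).comp (by fun_prop : Measurable fun q : ℝ × ℝ => (q.1, b))).mul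
      ((measurable_powA α).comp (by fun_prop : Measurable fun q : ℝ × ℝ => (q.2, b)))
  refine h1.add ?_
  refine measurable_setLIntegral_Ioo (F := fun q : (ℝ × ℝ) × ℝ =>
    powA α q.1.1 q.2 * powB α q.1.2 q.2) ?_ measurable_fst b
  exact ((measurable_powA α).comp (by fun_prop : Measurable fun q : (ℝ × ℝ) × ℝ =>
    (q.1.1, q.2))).mul ((measurable_powB α).comp (by fun_prop : Measurable fun q : (ℝ × ℝ) × ℝ =>
    (q.1.2, q.2)))

variable {α b}

theorem measurable_powA_right (x : ℝ) : Measurable (powA α x) :=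
  (measurable_powA α).comp measurable_prodMk_left

theorem measurable_powB_right (x : ℝ) : Measurable (powB α x) :=
  (measurable_powB α).comp measurable_prodMk_left

theorem measurable_powA_left (t : ℝ) : Measurable fun x => powA α x t :=
  (measurable_powA α).comp measurable_prodMk_right

theorem measurable_powB_left (t : ℝ) : Measurable fun x => powB α x t :=
  (measurable_powB α).comp measurable_prodMk_right

/-- Both sides equal `(c - x)^α / α`. The exchange moves the variable `x` from the integrand into
the limit of integration only, which is what produces a primitive in `x`. -/
theorem setLIntegral_powA_symm (hα : 0 < α) {x c : ℝ} (hxc : x ≤ c) :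
    ∫⁻ t in Ioo x c, powA α x t = ∫⁻ ξ in Ioo x c, powA α ξ c := by
  simp only [powA]
  rw [setLIntegral_Ioo_sub_rpow (by linarith) hxc, setLIntegral_Ioo_rpow_sub (by linarith) hxc]

/-- Differentiating the kernel directly would produce a divergent integral. Instead `(t - τ)^(α-1)`
is written as its value at `b` plus its total decrease on `(t, b)`. After Tonelli, `x` enters only
through integrals of `(t - x)^(α-1)`, which `setLIntegral_powA_symm` rewrites with `x` as a mere
endpoint. -/
theorem iterKernel_eq_of_le (hα : 0 < α) (hα1 : α ≤ 1) {x τ : ℝ} (hτx : τ ≤ x) (hx : x < b) :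
    iterKernel α b x τ = ∫⁻ ξ in Ioo x b, iterKernelDec α b (ξ, τ) := by
  have hA : Measurable (Function.uncurry (powA α)) := measurable_powA α
  have h1 : iterKernel α b x τ = ∫⁻ t in Ioo x b,
      (powA α x t * powA α τ b + ∫⁻ σ in Ioo t b, powA α x t * powB α τ σ) := by
    rw [iterKernel, max_eq_left hτx]
    refine setLIntegral_congr_fun measurableSet_Ioo fun t ht => ?_
    rw [lintegral_const_mul _ (measurable_powB_right τ), ← mul_add]
    congr 1
    exact (rpow_eq_add_setLIntegral_right hα1 (by linarith [ht.1]) ht.2.le).symm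
  have h2 : ∫⁻ ξ in Ioo x b, iterKernelDec α b (ξ, τ) = ∫⁻ ξ in Ioo x b,
      (powA α ξ b * powA α τ b + ∫⁻ t in Ioo ξ b, powA α ξ t * powB α τ t) := by
    refine setLIntegral_congr_fun measurableSet_Ioo fun ξ hξ => ?_
    exact if_pos (hτx.trans_lt hξ.1)
  rw [h1, h2, lintegral_add_left ((measurable_powA_right x).mul_const _), lintegral_add_left
    ((measurable_powA_left b).mul_const _)]
  congr 1
  · rw [lintegral_mul_const _ (measurable_powA_right x),
      lintegral_mul_const _ (measurable_powA_left _)]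
    congr 1
    exact setLIntegral_powA_symm hα hx.le
  · rw [setLIntegral_triangle_swap (F := fun t σ => powA α x t * powB α τ σ)
      (((measurable_powA_right x).comp measurable_fst).mul
        ((measurable_powB_right τ).comp measurable_snd)),
      setLIntegral_triangle_swap (F := fun t σ => powA α t σ * powB α τ σ)
      (hA.mul ((measurable_powB_right τ).comp measurable_snd))]
    refine setLIntegral_congr_fun measurableSet_Ioo fun σ hσ => ?_
    rw [lintegral_mul_const _ (measurable_powA_right x),
      lintegral_mul_const _ (measurable_powA_left _)]
    congr 1
    exact setLIntegral_powA_symm hα hσ.1.le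

/-- The integrand is `(t - τ)^(2α-2)`, integrable at `τ` because `α > 1/2`. -/
theorem iterKernel_self (hα : 1 / 2 < α) {τ : ℝ} (hτ : τ < b) :
    iterKernel α b τ τ = ENNReal.ofReal ((b - τ) ^ (2 * α - 1) / (2 * α - 1)) := by
  rw [iterKernel, max_self, show 2 * α - 1 = (2 * α - 2) + 1 by ring,
    ← setLIntegral_Ioo_sub_rpow (by linarith) hτ.le]
  refine setLIntegral_congr_fun measurableSet_Ioo fun t ht => ?_
  simp only [powA]
  rw [← ENNReal.ofReal_mul (Real.rpow_nonneg (by linarith [ht.1]) _),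
    ← Real.rpow_add (by linarith [ht.1])]
  congr 2; ring

theorem setLIntegral_iterKernelDec_of_le {x τ : ℝ} (hxτ : x ≤ τ) :
    ∫⁻ ξ in Ioo x b, iterKernelDec α b (ξ, τ) = ∫⁻ ξ in Ioo τ b, iterKernelDec α b (ξ, τ) := by
  rw [← lintegral_indicator measurableSet_Ioo, ← lintegral_indicator measurableSet_Ioo]
  refine lintegral_congr fun ξ => ?_
  by_cases h : ξ ∈ Ioo τ b
  · rw [indicator_of_mem h, indicator_of_mem (show ξ ∈ Ioo x b from ⟨hxτ.trans_lt h.1, h.2⟩)]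
  · rw [indicator_of_notMem h, indicator_apply_eq_zero]
    intro h'
    exact if_neg fun h'' => h ⟨h'', h'.2⟩

/-- The iterated kernel is a primitive in its first variable. -/
theorem iterKernel_add_setLIntegral (hα : 0 < α) (hα1 : α ≤ 1) {x τ : ℝ} (hx : x < b)
    (hτ : τ < b) :
    iterKernel α b x τ + ∫⁻ ξ in Ioo x b, iterKernelInc α b (ξ, τ) =
      ∫⁻ ξ in Ioo x b, iterKernelDec α b (ξ, τ) := by
  rcases le_or_gt τ x with h | h
  · rw [iterKernel_eq_of_le hα hα1 h hx, setLIntegral_congr_fun (g := fun _ => 0) (s := Ioo x b)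
      (f := fun ξ => iterKernelInc α b (ξ, τ)) measurableSet_Ioo
      (fun ξ hξ => if_neg (h.trans hξ.1.le).not_gt), lintegral_zero, add_zero]
  -- For `x < τ` the kernel increases in `x` up to the diagonal: `(t - x)^(α-1)` grows to `(t -
  -- τ)^(α-1)`. Adding the increase on `(x, τ)` gives the diagonal value, which is the total
  -- decrease after `τ`.
  · rw [setLIntegral_iterKernelDec_of_le h.le, ← iterKernel_eq_of_le hα hα1 le_rfl hτ]
    have h1 : ∫⁻ ξ in Ioo x b, iterKernelInc α b (ξ, τ) =
        ∫⁻ ξ in Ioo x τ, ∫⁻ t in Ioo τ b, powA α τ t * powB α ξ t := by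
      rw [← lintegral_indicator measurableSet_Ioo, ← lintegral_indicator measurableSet_Ioo]
      refine lintegral_congr fun ξ => ?_
      by_cases h' : ξ ∈ Ioo x τ
      · rw [indicator_of_mem h', indicator_of_mem (show ξ ∈ Ioo x b from ⟨h'.1, h'.2.trans hτ⟩)]
        exact if_pos h'.2
      · rw [indicator_of_notMem h', indicator_apply_eq_zero]
        intro h''
        exact if_neg fun h3 => h' ⟨h''.1, h3⟩
    have hB : Measurable (Function.uncurry (powB α)) := measurable_powB α
    rw [h1, lintegral_lintegral_swap, iterKernel, iterKernel, max_eq_right h.le, max_self,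
      ← lintegral_add_left (f := fun t => powA α x t * powA α τ t)
        ((measurable_powA_right x).mul (measurable_powA_right τ))]
    · refine setLIntegral_congr_fun measurableSet_Ioo fun t ht => ?_
      rw [lintegral_const_mul _ (measurable_powB_left _), mul_comm (powA α x t),
        ← mul_add]
      congr 1
      exact rpow_eq_add_setLIntegral_left hα1 h.le ht.1
    · exact (((measurable_powA_right τ).comp measurable_snd).mul hB).aemeasurable

/-- The total decrease is at most the diagonal value of the iterated kernel, hence bounded uniformly
in `τ`. This is the domination that lets Fubini be applied for any integrable density. -/
theorem setLIntegral_iterKernelDec_le (hα : 1 / 2 < α) (hα1 : α ≤ 1) {a x τ : ℝ}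
    (hτ : τ ∈ Ico a b) :
    ∫⁻ ξ in Ioo x b, iterKernelDec α b (ξ, τ) ≤
      ENNReal.ofReal ((b - a) ^ (2 * α - 1) / (2 * α - 1)) := by
  have h1 : ∫⁻ ξ in Ioo x b, iterKernelDec α b (ξ, τ) ≤
      ∫⁻ ξ in Ioo (min x τ) b, iterKernelDec α b (ξ, τ) :=
    lintegral_mono_set (Ioo_subset_Ioo_left (min_le_left _ _))
  refine h1.trans ?_
  rw [setLIntegral_iterKernelDec_of_le (min_le_right _ _),
    ← iterKernel_eq_of_le (by linarith) hα1 le_rfl hτ.2, iterKernel_self hα hτ.2]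
  refine ENNReal.ofReal_le_ofReal ?_
  have : 0 < 2 * α - 1 := by linarith
  gcongr
  · linarith [hτ.2]
  · exact hτ.1

theorem lintegral_fracKernel_mul {a x τ : ℝ} (hx : a ≤ x) :
    ∫⁻ t in Ioo a b, ENNReal.ofReal (fracKernel α (t, x) * fracKernel α (t, τ)) =
      ENNReal.ofReal ((Real.Gamma α)⁻¹ ^ 2) * iterKernel α b x τ := by
  have hA : Measurable fun t => powA α x t * powA α τ t :=
    (measurable_powA_right x).mul (measurable_powA_right τ)
  rw [iterKernel, ← lintegral_const_mul _ hA, ← lintegral_indicator measurableSet_Ioo,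
    ← lintegral_indicator measurableSet_Ioo]
  refine lintegral_congr fun t => ?_
  by_cases h : t ∈ Ioo (max x τ) b
  · have h1 : x < t := (le_max_left _ _).trans_lt h.1
    have h2 : τ < t := (le_max_right _ _).trans_lt h.1
    rw [indicator_of_mem h, indicator_of_mem (show t ∈ Ioo a b from ⟨hx.trans_lt h1, h.2⟩),
      fracKernel_of_lt h1, fracKernel_of_lt h2, powA, powA,
      ← ENNReal.ofReal_mul (Real.rpow_nonneg (by linarith) _), ← ENNReal.ofReal_mul (sq_nonneg _)]
    congr 1; ring
  · rw [indicator_of_notMem h, indicator_apply_eq_zero]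
    intro h'
    by_cases h1 : x < t
    · rw [fracKernel_of_le (t := τ) (not_lt.1 fun h2 => h ⟨max_lt h1 h2, h'.2⟩)]; simp
    · rw [fracKernel_of_le (t := x) (not_lt.1 h1)]; simp

/-- The composition of a right and a left fractional integral of order greater than `1/2` is
absolutely continuous. -/
theorem exists_primitive_fracInt_fracInt {𝕜 : Type*} [RCLike 𝕜] (hα : 1 / 2 < α) (hα1 : α ≤ 1)
    {a : ℝ} {ν : Measure ℝ} [SFinite ν] (hν : ∀ᵐ τ ∂ν, τ ∈ Ico a b) {g : ℝ → 𝕜}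
    (hg : Integrable g ν) :
    ∃ v : ℝ → 𝕜, IntegrableOn v (Ioo a b) ∧ ∀ x ∈ Ico a b,
      ∫ t in Ioo a b, fracKernel α (t, x) • ∫ τ, fracKernel α (t, τ) • g τ ∂ν =
        -∫ ξ in x..b, v ξ := by
  have hα0 : 0 < α := by linarith
  set c : ℝ := (Real.Gamma α)⁻¹ ^ 2 with hc
  set M := ENNReal.ofReal ((b - a) ^ (2 * α - 1) / (2 * α - 1)) with hM
  have hfin : ∀ K : ℝ → ℝ≥0∞, (∀ τ ∈ Ico a b, K τ ≤ M) → ∫⁻ τ, K τ * ‖g τ‖ₑ ∂ν ≠ ⊤ := by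
    intro K hK
    refine ne_top_of_le_ne_top (b := ∫⁻ τ, M * ‖g τ‖ₑ ∂ν) ?_ (lintegral_mono_ae ?_)
    · rw [lintegral_const_mul'' _ hg.1.enorm]
      exact ENNReal.mul_ne_top ENNReal.ofReal_ne_top hg.2.ne
    · filter_upwards [hν] with τ hτ
      gcongr
      exact hK τ hτ
  have hDec : ∀ x, ∀ τ ∈ Ico a b, ∫⁻ ξ in Ioo x b, iterKernelDec α b (ξ, τ) ≤ M :=
    fun x τ hτ => setLIntegral_iterKernelDec_le hα hα1 hτ
  have hsum : ∀ x ∈ Ico a b, ∀ τ ∈ Ico a b, iterKernel α b x τ +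
      ∫⁻ ξ in Ioo x b, iterKernelInc α b (ξ, τ) = ∫⁻ ξ in Ioo x b, iterKernelDec α b (ξ, τ) :=
    fun x hx τ hτ => iterKernel_add_setLIntegral hα0 hα1 hx.2 hτ.2
  have hInc : ∀ x ∈ Ico a b, ∀ τ ∈ Ico a b, ∫⁻ ξ in Ioo x b, iterKernelInc α b (ξ, τ) ≤ M :=
    fun x hx τ hτ => le_add_self.trans ((hsum x hx τ hτ).le.trans (hDec x τ hτ))
  have hT : ∀ x ∈ Ico a b, ∀ τ ∈ Ico a b, iterKernel α b x τ ≤ M :=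
    fun x hx τ hτ => le_self_add.trans ((hsum x hx τ hτ).le.trans (hDec x τ hτ))
  by_cases hab : a < b
  swap
  · exact ⟨0, by simp [Ioo_eq_empty hab], fun x hx => absurd (hx.1.trans_lt hx.2) hab⟩
  have ha : a ∈ Ico a b := ⟨le_rfl, hab⟩
  -- The derivative is obtained by integrating `g` against the increasing and the decreasing part of
  -- the derivative of the kernel separately, since Fubini is available for nonnegative kernels
  -- only.
  let u₁ : ℝ → 𝕜 := fun ξ => ∫ τ, (iterKernelInc α b (ξ, τ)).toReal • g τ ∂ν
  let u₂ : ℝ → 𝕜 := fun ξ => ∫ τ, (iterKernelDec α b (ξ, τ)).toReal • g τ ∂ν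
  have f1 := fun x hx => integral_kernel_smul (μ := volume.restrict (Ioo x b))
    (measurable_iterKernelInc α b) hg.1 (hfin _ (hInc x hx))
  have f2 := fun x => integral_kernel_smul (μ := volume.restrict (Ioo x b))
    (measurable_iterKernelDec α b) hg.1 (hfin _ (hDec x))
  refine ⟨fun ξ => c • (u₁ ξ - u₂ ξ), ((f1 a ha).1.sub (f2 a).1).smul c, fun x hx => ?_⟩
  have hW : Measurable fun p : ℝ × ℝ =>
      ENNReal.ofReal (fracKernel α (p.1, x) * fracKernel α p) :=
    (((measurable_fracKernel α).comp (by fun_prop : Measurable fun p : ℝ × ℝ => (p.1, x))).mul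
      (measurable_fracKernel α)).ennreal_ofReal
  have hK : ∀ τ, ∫⁻ t in Ioo a b, ENNReal.ofReal (fracKernel α (t, x) * fracKernel α (t, τ)) =
      ENNReal.ofReal c * iterKernel α b x τ := fun τ => lintegral_fracKernel_mul hx.1
  have f3 := integral_kernel_smul (μ := volume.restrict (Ioo a b)) hW hg.1 (by
    simp only [hK]
    rw [show (fun τ => ENNReal.ofReal c * iterKernel α b x τ * ‖g τ‖ₑ) =
      fun τ => ENNReal.ofReal c * (iterKernel α b x τ * ‖g τ‖ₑ) from funext fun τ => mul_assoc _ _ _,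
      lintegral_const_mul' _ _ ENNReal.ofReal_ne_top]
    exact ENNReal.mul_ne_top ENNReal.ofReal_ne_top (hfin _ (hT x hx)))
  have e0 : ∀ t τ, (ENNReal.ofReal (fracKernel α (t, x) * fracKernel α (t, τ))).toReal • g τ =
      fracKernel α (t, x) • fracKernel α (t, τ) • g τ := by
    intro t τ
    rw [ENNReal.toReal_ofReal (mul_nonneg (fracKernel_nonneg hα0 _) (fracKernel_nonneg hα0 _)),
      mul_smul]
  have f3' := f3.2.2.2
  simp only [e0, hK, integral_smul] at f3'
  rw [f3', intervalIntegral.integral_of_le hx.2.le, integral_Ioc_eq_integral_Ioo, integral_smul,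
    integral_sub (f1 x hx).1 (f2 x).1, (f1 x hx).2.2.2, (f2 x).2.2.2,
    ← integral_sub (f1 x hx).2.2.1 (f2 x).2.2.1, ← integral_smul, ← integral_neg]
  refine integral_congr_ae ?_
  filter_upwards [hν] with τ hτ
  have h1 := hsum x hx τ hτ
  have t1 : iterKernel α b x τ ≠ ⊤ := ne_top_of_le_ne_top ENNReal.ofReal_ne_top (hT x hx τ hτ)
  have t2 := ne_top_of_le_ne_top ENNReal.ofReal_ne_top (hInc x hx τ hτ)
  rw [← h1, ENNReal.toReal_add t1 t2, ENNReal.toReal_mul, ENNReal.toReal_ofReal (sq_nonneg _),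
    mul_smul, ← smul_neg, ← sub_smul, ← neg_smul]
  congr 2; ring

end IteratedKernel

end

section

/-! ### Compositions of fractional integrals -/

section FractionalIntegrals

variable {𝕜 : Type*} [RCLike 𝕜] {a b : ℝ}

theorem setIntegral_Ioo_ite_lt {x : ℝ} (hx : x ∈ Icc a b) (g : ℝ → 𝕜) :
    ∫ t in Ioo a b, (if t < x then (1 : ℝ) else 0) • g t = ∫ t in a..x, g t := by
  rw [intervalIntegral.integral_of_le hx.1, integral_Ioc_eq_integral_Ioo,
    ← integral_indicator measurableSet_Ioo, ← integral_indicator measurableSet_Ioo]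
  congr 1; funext t
  by_cases h : t ∈ Ioo a x
  · rw [indicator_of_mem h, indicator_of_mem (show t ∈ Ioo a b from ⟨h.1, h.2.trans_le hx.2⟩),
      if_pos h.2, one_smul]
  · rw [indicator_of_notMem h, indicator_apply_eq_zero]
    intro h'
    rw [if_neg fun h'' => h ⟨h'.1, h''⟩, zero_smul]

theorem setIntegral_Ioo_ite_gt {x : ℝ} (hx : x ∈ Icc a b) (g : ℝ → 𝕜) :
    ∫ t in Ioo a b, (if x < t then (1 : ℝ) else 0) • g t = ∫ t in x..b, g t := by
  rw [intervalIntegral.integral_of_le hx.2, integral_Ioc_eq_integral_Ioo,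
    ← integral_indicator measurableSet_Ioo, ← integral_indicator measurableSet_Ioo]
  congr 1; funext t
  by_cases h : t ∈ Ioo x b
  · rw [indicator_of_mem h, indicator_of_mem (show t ∈ Ioo a b from ⟨hx.1.trans_lt h.1, h.2⟩),
      if_pos h.1, one_smul]
  · rw [indicator_of_notMem h, indicator_apply_eq_zero]
    intro h'
    rw [if_neg fun h'' => h ⟨h'', h'.2⟩, zero_smul]

theorem leftFracInt_eq_setIntegral {β : ℝ} (hβ : β ≠ 0) {x : ℝ} (hx : x ∈ Icc a b) (g : ℝ → 𝕜) :
    leftFracInt β a g x = ∫ t in Ioo a b, fracKernel β (x, t) • g t := by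
  rw [leftFracInt, if_neg hβ, ← setIntegral_Ioo_ite_lt hx, ← integral_smul]
  congr 1; funext t
  by_cases h : t < x
  · rw [if_pos h, one_smul, fracKernel_of_lt h, mul_smul]
  · rw [if_neg h, fracKernel_of_le (not_lt.1 h)]; simp

theorem rightFracInt_eq_setIntegral {β : ℝ} (hβ : β ≠ 0) {x : ℝ} (hx : x ∈ Icc a b)
    (g : ℝ → 𝕜) : rightFracInt β b g x = ∫ t in Ioo a b, fracKernel β (t, x) • g t := by
  rw [rightFracInt, if_neg hβ, ← setIntegral_Ioo_ite_gt hx, ← integral_smul]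
  congr 1; funext t
  by_cases h : x < t
  · rw [if_pos h, one_smul, fracKernel_of_lt h, mul_smul]
  · rw [if_neg h, fracKernel_of_le (not_lt.1 h)]; simp

theorem fracKernel_one (x t : ℝ) : fracKernel 1 (x, t) = if t < x then 1 else 0 := by
  simp [fracKernel]

theorem lintegral_ite_mul_enorm_ne_top {ν : Measure ℝ} {g : ℝ → 𝕜} (hg : Integrable g ν)
    (p : ℝ → Prop) [DecidablePred p] {K : ℝ → ℝ≥0∞} (hK : ∀ᵐ τ ∂ν, K τ = if p τ then 1 else 0) :
    ∫⁻ τ, K τ * ‖g τ‖ₑ ∂ν ≠ ⊤ := by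
  refine ne_top_of_le_ne_top hg.2.ne (lintegral_mono_ae ?_)
  filter_upwards [hK] with τ h
  rw [h]
  split_ifs <;> simp

/-- Fubini reduces the composition to `setLIntegral_fracKernel_mul`. The inner measure is arbitrary
so that a Dirac mass at `a` can be used, for which the inner integral is a multiple of `(t -
a)^(γ-1)`. -/
theorem setIntegral_fracKernel_comp_left {β γ : ℝ} (hβ : 0 < β) (hγ : 0 < γ) (hβγ : β + γ = 1)
    {ν : Measure ℝ} [SFinite ν] (hν : ∀ᵐ τ ∂ν, a ≤ τ) {g : ℝ → 𝕜} (hg : Integrable g ν) {x : ℝ}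
    (hx : x ≤ b) :
    ∫ t in Ioo a b, fracKernel β (x, t) • ∫ τ, fracKernel γ (t, τ) • g τ ∂ν =
      ∫ τ, (if τ < x then (1 : ℝ) else 0) • g τ ∂ν := by
  have hW : Measurable fun p : ℝ × ℝ =>
      ENNReal.ofReal (fracKernel β (x, p.1) * fracKernel γ p) :=
    (((measurable_fracKernel β).comp (by fun_prop : Measurable fun p : ℝ × ℝ => (x, p.1))).mul
      (measurable_fracKernel γ)).ennreal_ofReal
  have hK : ∀ᵐ τ ∂ν, ∫⁻ t in Ioo a b,
      ENNReal.ofReal (fracKernel β (x, t) * fracKernel γ (t, τ)) = if τ < x then 1 else 0 := by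
    filter_upwards [hν] with τ hτ using setLIntegral_fracKernel_mul hβ hγ hβγ hx hτ
  have h := (integral_kernel_smul (μ := volume.restrict (Ioo a b)) hW hg.1
    (lintegral_ite_mul_enorm_ne_top hg _ hK)).2.2.2
  have e0 : ∀ t τ, (ENNReal.ofReal (fracKernel β (x, t) * fracKernel γ (t, τ))).toReal • g τ =
      fracKernel β (x, t) • fracKernel γ (t, τ) • g τ := by
    intro t τ
    rw [ENNReal.toReal_ofReal (mul_nonneg (fracKernel_nonneg hβ _) (fracKernel_nonneg hγ _)),
      mul_smul]
  simp only [e0, integral_smul] at h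
  rw [h]
  refine integral_congr_ae ?_
  filter_upwards [hK] with τ hτ
  rw [hτ]
  split_ifs <;> simp

theorem setIntegral_fracKernel_comp_right {β γ : ℝ} (hβ : 0 < β) (hγ : 0 < γ) (hβγ : β + γ = 1)
    {ν : Measure ℝ} [SFinite ν] (hν : ∀ᵐ τ ∂ν, τ ≤ b) {g : ℝ → 𝕜} (hg : Integrable g ν) {x : ℝ}
    (hx : a ≤ x) :
    ∫ t in Ioo a b, fracKernel β (t, x) • ∫ τ, fracKernel γ (τ, t) • g τ ∂ν =
      ∫ τ, (if x < τ then (1 : ℝ) else 0) • g τ ∂ν := by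
  have hW : Measurable fun p : ℝ × ℝ =>
      ENNReal.ofReal (fracKernel γ (p.2, p.1) * fracKernel β (p.1, x)) :=
    (((measurable_fracKernel γ).comp (by fun_prop : Measurable fun p : ℝ × ℝ => (p.2, p.1))).mul
      ((measurable_fracKernel β).comp (by fun_prop : Measurable fun p : ℝ × ℝ =>
        (p.1, x)))).ennreal_ofReal
  have hK : ∀ᵐ τ ∂ν, ∫⁻ t in Ioo a b,
      ENNReal.ofReal (fracKernel γ (τ, t) * fracKernel β (t, x)) = if x < τ then 1 else 0 := by
    filter_upwards [hν] with τ hτ using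
      setLIntegral_fracKernel_mul hγ hβ (by rw [add_comm]; exact hβγ) hτ hx
  have h := (integral_kernel_smul (μ := volume.restrict (Ioo a b)) hW hg.1
    (lintegral_ite_mul_enorm_ne_top hg _ hK)).2.2.2
  have e0 : ∀ t τ, (ENNReal.ofReal (fracKernel γ (τ, t) * fracKernel β (t, x))).toReal • g τ =
      fracKernel β (t, x) • fracKernel γ (τ, t) • g τ := by
    intro t τ
    rw [ENNReal.toReal_ofReal (mul_nonneg (fracKernel_nonneg hγ _) (fracKernel_nonneg hβ _)),
      mul_comm, mul_smul]
  simp only [e0, integral_smul] at h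
  rw [h]
  refine integral_congr_ae ?_
  filter_upwards [hK] with τ hτ
  rw [hτ]
  split_ifs <;> simp

theorem ae_mem_Ioo : ∀ᵐ τ ∂(volume.restrict (Ioo a b)), τ ∈ Ioo a b :=
  ae_restrict_mem measurableSet_Ioo

variable {α : ℝ}

/-- `I_{a+}^{1-α} I_{a+}^α = I_{a+}^1`, for measures carried by `[a, ∞)`. -/
theorem leftFracInt_one_sub_kernel (hα : 0 < α) (hα1 : α ≤ 1) {ν : Measure ℝ} [SFinite ν]
    (hν : ∀ᵐ τ ∂ν, a ≤ τ) {g : ℝ → 𝕜} (hg : Integrable g ν) {x : ℝ} (hx : x ∈ Icc a b) :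
    leftFracInt (1 - α) a (fun t => ∫ τ, fracKernel α (t, τ) • g τ ∂ν) x =
      ∫ τ, (if τ < x then (1 : ℝ) else 0) • g τ ∂ν := by
  -- At `α = 1` the outer integral is the identity by convention and the inner kernel is already the
  -- Heaviside kernel; the composition formula covers only positive orders.
  rcases hα1.eq_or_lt with rfl | h1
  · simp [leftFracInt, fracKernel_one]
  · rw [leftFracInt_eq_setIntegral (by linarith) hx]
    exact setIntegral_fracKernel_comp_left (by linarith) hα (by ring) hν hg hx.2

/-- `I_{a+}^α I_{a+}^{1-α} = I_{a+}^1`. -/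
theorem kernel_leftFracInt_one_sub (hα : 0 < α) (hα1 : α ≤ 1) {g : ℝ → 𝕜}
    (hg : IntegrableOn g (Ioo a b)) {x : ℝ} (hx : x ∈ Icc a b) :
    ∫ t in Ioo a b, fracKernel α (x, t) • leftFracInt (1 - α) a g t = ∫ t in a..x, g t := by
  rw [← setIntegral_Ioo_ite_lt hx]
  rcases hα1.eq_or_lt with rfl | h1
  · simp [leftFracInt, fracKernel_one]
  · rw [← setIntegral_fracKernel_comp_left hα (by linarith : 0 < 1 - α) (by ring)
      (ae_mem_Ioo.mono fun τ hτ => hτ.1.le) hg hx.2]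
    refine setIntegral_congr_fun measurableSet_Ioo fun t ht => ?_
    rw [leftFracInt_eq_setIntegral (by linarith) (Ioo_subset_Icc_self ht)]

/-- `I_{b-}^α I_{b-}^{1-α} = I_{b-}^1`. -/
theorem kernel_rightFracInt_one_sub (hα : 0 < α) (hα1 : α ≤ 1) {g : ℝ → 𝕜}
    (hg : IntegrableOn g (Ioo a b)) {x : ℝ} (hx : x ∈ Icc a b) :
    ∫ t in Ioo a b, fracKernel α (t, x) • rightFracInt (1 - α) b g t = ∫ t in x..b, g t := by
  rw [← setIntegral_Ioo_ite_gt hx]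
  rcases hα1.eq_or_lt with rfl | h1
  · simp [rightFracInt, fracKernel_one]
  · rw [← setIntegral_fracKernel_comp_right hα (by linarith : 0 < 1 - α) (by ring)
      (ae_mem_Ioo.mono fun τ hτ => hτ.2.le) hg hx.1]
    refine setIntegral_congr_fun measurableSet_Ioo fun t ht => ?_
    rw [rightFracInt_eq_setIntegral (by linarith) (Ioo_subset_Icc_self ht)]

/-- `I_{b-}^{1-α} I_{b-}^α = I_{b-}^1`. -/
theorem rightFracInt_one_sub_kernel (hα : 0 < α) (hα1 : α ≤ 1) {g : ℝ → 𝕜}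
    (hg : IntegrableOn g (Ioo a b)) {x : ℝ} (hx : x ∈ Icc a b) :
    rightFracInt (1 - α) b (fun t => ∫ τ in Ioo a b, fracKernel α (τ, t) • g τ) x =
      ∫ t in x..b, g t := by
  rw [← setIntegral_Ioo_ite_gt hx]
  rcases hα1.eq_or_lt with rfl | h1
  · simp [rightFracInt, fracKernel_one]
  · rw [rightFracInt_eq_setIntegral (by linarith) hx]
    exact setIntegral_fracKernel_comp_right (by linarith) hα (by ring)
      (ae_mem_Ioo.mono fun τ hτ => hτ.2.le) hg hx.1

theorem hasACDeriv_integral {g : ℝ → 𝕜} (hg : IntegrableOn g (Ioo a b)) (c : 𝕜) :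
    HasACDeriv a b (fun x => c + ∫ t in a..x, g t) g :=
  ⟨hg, fun x _ => by simp⟩

theorem hasACDeriv_neg_integral_right (hab : a < b) {g : ℝ → 𝕜} (hg : IntegrableOn g (Ioo a b)) :
    HasACDeriv a b (fun x => -∫ t in x..b, g t) g := by
  have hi : IntervalIntegrable g volume a b :=
    (intervalIntegrable_iff_integrableOn_Ioo_of_le hab.le).2 hg
  refine ⟨hg, fun x hx => ?_⟩
  have h1 : IntervalIntegrable g volume a x :=
    hi.mono_set (by rw [uIcc_of_le hab.le, uIcc_of_le hx.1]; exact Icc_subset_Icc_right hx.2)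
  have h2 : IntervalIntegrable g volume x b :=
    hi.mono_set (by rw [uIcc_of_le hab.le, uIcc_of_le hx.2]; exact Icc_subset_Icc_left hx.1)
  simp only
  rw [← intervalIntegral.integral_add_adjacent_intervals h1 h2]
  ring

/-- Uniqueness for Abel's equation: applying `I_{a+}^α` shows that the primitive of `g` vanishes. -/
theorem ae_eq_zero_of_leftFracInt (hab : a < b) (hα : 0 < α) (hα1 : α ≤ 1) {g : ℝ → 𝕜}
    (hg : IntegrableOn g (Ioo a b))
    (h : leftFracInt (1 - α) a g =ᵐ[volume.restrict (Ioo a b)] 0) :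
    g =ᵐ[volume.restrict (Ioo a b)] 0 := by
  refine (hasACDeriv_integral hg 0).ae_eq_zero hab ?_
  filter_upwards [ae_mem_Ioo] with x hx
  rw [zero_add, ← kernel_leftFracInt_one_sub hα hα1 hg (Ioo_subset_Icc_self hx), Pi.zero_apply]
  refine integral_eq_zero_of_ae ?_
  filter_upwards [h] with t ht
  rw [ht]; simp

/-- The mirror image, with the orders exchanged: applying `I_{b-}^{1-α}` to `I_{b-}^α g = 0`
annihilates the primitive of `g`. -/
theorem ae_eq_zero_of_rightKernel (hab : a < b) (hα : 0 < α) (hα1 : α ≤ 1) {g : ℝ → 𝕜}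
    (hg : IntegrableOn g (Ioo a b))
    (h : ∀ᵐ x ∂volume.restrict (Ioo a b), ∫ t in Ioo a b, fracKernel α (t, x) • g t = 0) :
    g =ᵐ[volume.restrict (Ioo a b)] 0 := by
  refine (hasACDeriv_neg_integral_right hab hg).ae_eq_zero hab ?_
  filter_upwards [ae_mem_Ioo, rightFracInt_ae_eq_zero (β := 1 - α) h] with x hx h2
  rw [← rightFracInt_one_sub_kernel hα hα1 hg (Ioo_subset_Icc_self hx), h2]
  simp

theorem integrableOn_rightFracInt (hab : a < b) {β : ℝ} (hβ : 0 ≤ β) {g : ℝ → 𝕜}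
    (hg : IntegrableOn g (Ioo a b)) : IntegrableOn (rightFracInt β b g) (Ioo a b) := by
  rcases hβ.eq_or_lt with rfl | h
  · have : rightFracInt 0 b g = g := by funext x; simp [rightFracInt]
    rwa [this]
  · have := (rightFracInt_aux hab h hg).2.smul (Real.Gamma β)⁻¹
    have h1 : rightFracInt β b g =
        (Real.Gamma β)⁻¹ • fun x => ∫ t in x..b, ((t - x) ^ (β - 1)) • g t := by
      funext x; simp [rightFracInt, h.ne']
    rw [h1]
    exact this

end FractionalIntegrals

/-! ### Square integrability of the fractional kernel -/

section KernelL2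

variable {a b α : ℝ}

/-- Up to normalisation the left side is the diagonal value of the iterated kernel. The case `τ =
a`, included here, puts `(t - a)^(α-1)` in `L²`. -/
theorem lintegral_enorm_fracKernel_sq (hα : 1 / 2 < α) {τ : ℝ} (hτ : τ ∈ Ico a b) :
    ∫⁻ t in Ioo a b, ‖fracKernel α (t, τ)‖ₑ ^ 2 ≤ ENNReal.ofReal ((Real.Gamma α)⁻¹ ^ 2) *
      ENNReal.ofReal ((b - a) ^ (2 * α - 1) / (2 * α - 1)) := by
  have h1 : ∀ t, ‖fracKernel α (t, τ)‖ₑ ^ 2 =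
      ENNReal.ofReal (fracKernel α (t, τ) * fracKernel α (t, τ)) := by
    intro t
    have := fracKernel_nonneg (by linarith : 0 < α) (t, τ)
    rw [Real.enorm_of_nonneg this, ← ENNReal.ofReal_pow this, sq]
  simp only [h1]
  rw [lintegral_fracKernel_mul hτ.1, iterKernel_self hα hτ.2]
  gcongr
  · linarith
  · linarith [hτ.2]
  · linarith
  · exact hτ.1

theorem memLp_fracKernel_slice (hα : 1 / 2 < α) {τ : ℝ} (hτ : τ ∈ Ico a b) :
    MemLp (fun t => fracKernel α (t, τ)) 2 (volume.restrict (Ioo a b)) := by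
  have hm : Measurable fun t => fracKernel α (t, τ) :=
    (measurable_fracKernel α).comp measurable_prodMk_right
  rw [memLp_two_iff_lintegral_lt_top hm.aestronglyMeasurable]
  exact (lintegral_enorm_fracKernel_sq hα hτ).trans_lt
    (ENNReal.mul_lt_top ENNReal.ofReal_lt_top ENNReal.ofReal_lt_top)

theorem memLp_fracKernel (hα : 1 / 2 < α) : MemLp (fracKernel α) 2
    ((volume.restrict (Ioo a b)).prod (volume.restrict (Ioo a b))) := by
  have hm := measurable_fracKernel α
  rw [memLp_two_iff_lintegral_lt_top hm.aestronglyMeasurable,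
    lintegral_prod_symm _ (hm.enorm.pow_const 2).aemeasurable]
  have h1 : ∀ᵐ τ ∂volume.restrict (Ioo a b), ∫⁻ t in Ioo a b, ‖fracKernel α (t, τ)‖ₑ ^ 2 ≤
      ENNReal.ofReal ((Real.Gamma α)⁻¹ ^ 2) *
        ENNReal.ofReal ((b - a) ^ (2 * α - 1) / (2 * α - 1)) := by
    filter_upwards [ae_mem_Ioo] with τ hτ using
      lintegral_enorm_fracKernel_sq hα ⟨hτ.1.le, hτ.2⟩
  refine (lintegral_mono_ae h1).trans_lt ?_
  rw [lintegral_const]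
  exact ENNReal.mul_lt_top (ENNReal.mul_lt_top ENNReal.ofReal_lt_top ENNReal.ofReal_lt_top)
    (measure_lt_top _ _)

end KernelL2

end

section

/-! ### The inverse of the one-dimensional operator -/

section CompressedSquare

variable {𝕜 : Type*} [RCLike 𝕜] {H : Type*} [NormedAddCommGroup H] [InnerProductSpace 𝕜 H]

/-- The operator `J* (1 - P_k) J`, where `P_k` is the orthogonal projection onto the line spanned
by `k`. -/
def compressedSquare (J J' : H →L[𝕜] H) (k : H) : H →L[𝕜] H :=
  J' ∘L (Submodule.span 𝕜 {k})ᗮ.starProjection ∘L J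

variable {J J' : H →L[𝕜] H} (k : H)

theorem compressedSquare_apply (f : H) :
    compressedSquare J J' k f = J' ((Submodule.span 𝕜 {k})ᗮ.starProjection (J f)) := rfl

theorem inner_compressedSquare (hJ : ∀ f g, inner 𝕜 (J f) g = inner 𝕜 f (J' g)) (f g : H) :
    inner 𝕜 (compressedSquare J J' k f) g =
      inner 𝕜 ((Submodule.span 𝕜 {k})ᗮ.starProjection (J f)) (J g) := by
  rw [compressedSquare_apply, ← inner_conj_symm, ← hJ, inner_conj_symm]

theorem compressedSquare_isSymmetric (hJ : ∀ f g, inner 𝕜 (J f) g = inner 𝕜 f (J' g)) :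
    (compressedSquare J J' k : H →ₗ[𝕜] H).IsSymmetric := by
  intro f g
  simp only [ContinuousLinearMap.coe_coe]
  rw [inner_compressedSquare k hJ, Submodule.inner_starProjection_left_eq_right, hJ,
    compressedSquare_apply]

theorem compressedSquare_nonneg (hJ : ∀ f g, inner 𝕜 (J f) g = inner 𝕜 f (J' g)) (f : H) :
    0 ≤ RCLike.re (inner 𝕜 (compressedSquare J J' k f) f) := by
  rw [inner_compressedSquare k hJ]
  exact Submodule.re_inner_starProjection_nonneg _ _

theorem starProjection_span_singleton_orthogonal (h : H) :
    ∃ c : 𝕜, (Submodule.span 𝕜 {k})ᗮ.starProjection h = h - c • k := by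
  obtain ⟨c, hc⟩ := Submodule.mem_span_singleton.1
    (Submodule.starProjection_apply_mem (Submodule.span 𝕜 {k}) h)
  exact ⟨c, by rw [Submodule.starProjection_orthogonal_val, hc]⟩

theorem inner_starProjection_span_singleton_orthogonal (h : H) :
    inner 𝕜 k ((Submodule.span 𝕜 {k})ᗮ.starProjection h) = 0 :=
  Submodule.mem_orthogonal_singleton_iff_inner_right.1
    (Submodule.starProjection_apply_mem (Submodule.span 𝕜 {k})ᗮ h)

/-- The quadratic form at `f` is the squared norm of the projection of `J f`, so it vanishes only if
`J f` lies on the line of `k`. -/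
theorem exists_smul_of_compressedSquare_eq_zero
    (hJ : ∀ f g, inner 𝕜 (J f) g = inner 𝕜 f (J' g)) {f : H}
    (hf : compressedSquare J J' k f = 0) : ∃ c : 𝕜, J f = c • k := by
  have h1 := inner_compressedSquare k hJ f f
  rw [hf, inner_zero_left] at h1
  have h2 := Submodule.re_inner_starProjection_eq_normSq (K := (Submodule.span 𝕜 {k})ᗮ) (J f)
  rw [← h1, map_zero] at h2
  obtain ⟨c, hc⟩ := starProjection_span_singleton_orthogonal (𝕜 := 𝕜) k (J f)
  refine ⟨c, sub_eq_zero.1 ?_⟩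
  rw [← hc, Submodule.starProjection_apply]
  have h3 := pow_eq_zero_iff (two_ne_zero) |>.1 h2.symm
  simpa using h3

/-- The two properties that determine the projected vector: it is orthogonal to `k` and differs from
`h` by a multiple of `k`. -/
theorem starProjection_eq_of_inner_eq_zero {g h : H} (c : 𝕜) (hg : inner 𝕜 k g = 0)
    (hgh : g = h + c • k) : (Submodule.span 𝕜 {k})ᗮ.starProjection h = g := by
  have h1 : (Submodule.span 𝕜 {k})ᗮ.starProjection g = g :=
    Submodule.starProjection_eq_self_iff.2
      (Submodule.mem_orthogonal_singleton_iff_inner_right.2 hg)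
  have h2 : (Submodule.span 𝕜 {k})ᗮ.starProjection k = 0 := by
    rw [Submodule.starProjection_orthogonal_val, sub_eq_zero, eq_comm,
      Submodule.starProjection_eq_self_iff]
    exact Submodule.mem_span_singleton_self k
  rw [← h1, hgh, map_add, map_smul, h2, smul_zero, add_zero]

end CompressedSquare

/-! ### The Dirichlet problem on the interval as inversion of `J* (1 - P_k) J` -/

section OneDimensional

variable {𝕜 : Type*} [RCLike 𝕜] {a b α : ℝ}

theorem ae_integrableOn_fracKernel_smul (hab : a < b) (hα : 0 < α) {g : ℝ → 𝕜}
    (hg : IntegrableOn g (Ioo a b)) :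
    ∀ᵐ x ∂volume.restrict (Ioo a b),
      IntegrableOn (fun t => fracKernel α (t, x) • g t) (Ioo a b) := by
  filter_upwards [(rightFracInt_aux hab hα hg).1, ae_mem_Ioo] with x h hx
  rw [intervalIntegrable_iff_integrableOn_Ioo_of_le hx.2.le,
    ← integrable_indicator_iff measurableSet_Ioo] at h
  refine ((h.smul (Real.Gamma α)⁻¹).integrableOn (s := Ioo a b)).congr_fun_ae ?_
  filter_upwards [ae_mem_Ioo] with t ht
  by_cases htx : x < t
  · rw [Pi.smul_apply, indicator_of_mem (s := Ioo x b) ⟨htx, ht.2⟩, fracKernel_of_lt htx, smul_smul]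
  · rw [Pi.smul_apply, indicator_of_notMem (fun h => htx h.1), fracKernel_of_le (not_lt.1 htx),
      smul_zero, zero_smul]

/-- The general solution of `D_{a+}^α g = f` is `J f + c k`. Integrating back with `I_{b-}^α` builds
in the condition at `b`, and the value at `a` is `⟨k, g⟩`, so the remaining boundary condition is an
orthogonality that selects `c`. -/
theorem isDirichletFracODE_iff (hab : a < b) (hα : 1 / 2 < α) (hα1 : α ≤ 1) :
    ∃ K : Lp 𝕜 2 (volume.restrict (Ioo a b)) →L[𝕜] Lp 𝕜 2 (volume.restrict (Ioo a b)),
      IsCompactOperator K ∧ (K : _ →ₗ[𝕜] Lp 𝕜 2 (volume.restrict (Ioo a b))).IsSymmetric ∧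
      (∀ f, K f = 0 → f = 0) ∧ (∀ f, 0 ≤ RCLike.re (inner 𝕜 (K f) f)) ∧
      ∀ (u f : ℝ → 𝕜) (hu : MemLp u 2 (volume.restrict (Ioo a b)))
        (hf : MemLp f 2 (volume.restrict (Ioo a b))),
        IsDirichletFracODE α a b u f ↔ hu.toLp u = K (hf.toLp f) := by
  have hα0 : 0 < α := by linarith
  set μ : Measure ℝ := volume.restrict (Ioo a b) with hμ
  have hk : MemLp (fracKernel α) 2 (μ.prod μ) := memLp_fracKernel hα
  have hk₀ : MemLp (fun t => (fracKernel α (t, a) : 𝕜)) 2 μ :=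
    (memLp_fracKernel_slice hα ⟨le_rfl, hab⟩).ofReal
  let J : Lp 𝕜 2 μ →L[𝕜] Lp 𝕜 2 μ := kernelOp 𝕜 hk
  let J' : Lp 𝕜 2 μ →L[𝕜] Lp 𝕜 2 μ := kernelOp 𝕜 (MemLp.swap_prod hk)
  let k : Lp 𝕜 2 μ := hk₀.toLp _
  have hJ : ∀ f g, inner 𝕜 (J f) g = inner 𝕜 f (J' g) := inner_kernelOp hk
  have hLpInt : ∀ f : Lp 𝕜 2 μ, IntegrableOn f (Ioo a b) := fun f =>
    (Lp.memLp f).integrable (by norm_num)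
  have hac : ∀ᵐ τ ∂(Measure.dirac a : Measure ℝ), τ ∈ Ico a b := by
    exact (ae_dirac_iff measurableSet_Ico).2 ⟨le_rfl, hab⟩
  have hIoo : ∀ᵐ τ ∂μ, τ ∈ Ioo a b := ae_mem_Ioo
  have hdir : ∀ (c : 𝕜), Integrable (fun _ : ℝ => c) (Measure.dirac a : Measure ℝ) :=
    fun c => integrable_const c
  -- the left fractional integral of `J f + c k`
  have hleft : ∀ (f : Lp 𝕜 2 μ) (c : 𝕜), leftFracInt (1 - α) a (J f + c • k : Lp 𝕜 2 μ) =ᵐ[μ]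
      fun x => c + ∫ t in a..x, f t := by
    intro f c
    have e1 : (J f + c • k : Lp 𝕜 2 μ) =ᵐ[μ] (fun t => ∫ τ, fracKernel α (t, τ) • f τ ∂μ) +
        fun t => ∫ τ, fracKernel α (t, τ) • c ∂(Measure.dirac a) := by
      filter_upwards [Lp.coeFn_add (J f) (c • k), Lp.coeFn_smul c k, hk₀.coeFn_toLp,
        kernelOp_coeFn hk f] with t h1 h2 h3 h4
      rw [h1, Pi.add_apply, h2, Pi.smul_apply, h3, h4, Pi.add_apply, integral_dirac]
      rw [smul_eq_mul, RCLike.real_smul_eq_coe_mul, mul_comm]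
    have i1 : IntegrableOn (fun t => ∫ τ, fracKernel α (t, τ) • f τ ∂μ) (Ioo a b) :=
      (hLpInt (J f)).congr (kernelOp_coeFn hk f)
    have i2 : IntegrableOn (fun t => ∫ τ, fracKernel α (t, τ) • c ∂(Measure.dirac a))
        (Ioo a b) := by
      simp only [integral_dirac]
      exact ((memLp_fracKernel_slice hα ⟨le_rfl, hab⟩).integrable (by norm_num)).smul_const c
    have e2 := leftFracInt_add hab (sub_nonneg.2 hα1) i1 i2
    have e3 : leftFracInt (1 - α) a (J f + c • k : Lp 𝕜 2 μ) =ᵐ[μ] leftFracInt (1 - α) a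
        ((fun t => ∫ τ, fracKernel α (t, τ) • f τ ∂μ) +
          fun t => ∫ τ, fracKernel α (t, τ) • c ∂(Measure.dirac a)) := by
      -- Invariance of the fractional integral under changes on null sets follows from additivity
      -- and its vanishing on null functions.
      have h0 : ((J f + c • k : Lp 𝕜 2 μ) : ℝ → 𝕜) + (-1 : 𝕜) •
          ((fun t => ∫ τ, fracKernel α (t, τ) • f τ ∂μ) +
          fun t => ∫ τ, fracKernel α (t, τ) • c ∂(Measure.dirac a)) =ᵐ[μ] 0 := by
        filter_upwards [e1] with t ht
        rw [Pi.add_apply, Pi.smul_apply, ht, smul_eq_mul, neg_one_mul, add_neg_cancel]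
        rfl
      have h1 := leftFracInt_ae_eq_zero (β := 1 - α) h0
      have h2 := leftFracInt_add hab (sub_nonneg.2 hα1) (hLpInt (J f + c • k))
        ((i1.add i2).smul (-1 : 𝕜))
      rw [leftFracInt_smul] at h2
      filter_upwards [h1, h2] with t h1 h2
      rw [h1] at h2
      simp only [Pi.add_apply, Pi.smul_apply, Pi.zero_apply, smul_eq_mul, neg_mul, one_mul] at h2
      linear_combination -h2
    filter_upwards [e2, e3, hIoo] with x h2 h3 hx
    have hx' := Ioo_subset_Icc_self hx
    rw [h3, h2, Pi.add_apply, leftFracInt_one_sub_kernel hα0 hα1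
      (hIoo.mono fun τ hτ => hτ.1.le) (hLpInt f) hx', leftFracInt_one_sub_kernel hα0 hα1
      (hac.mono fun τ hτ => hτ.1) (hdir c) hx', integral_dirac, setIntegral_Ioo_ite_lt hx',
      if_pos hx.1, one_smul, add_comm]
  -- pairing with `k` is evaluation at `a` of the right fractional integral
  have hinner : ∀ g : Lp 𝕜 2 μ, inner 𝕜 k g = ∫ t, fracKernel α (t, a) • g t ∂μ := by
    intro g
    rw [L2.inner_def]
    refine integral_congr_ae ?_
    filter_upwards [hk₀.coeFn_toLp] with t ht
    rw [ht, RCLike.inner_apply, RCLike.conj_ofReal, RCLike.real_smul_eq_coe_mul, mul_comm]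
  have hJ' : ∀ g : Lp 𝕜 2 μ, J' g =ᵐ[μ] fun x => ∫ t, fracKernel α (t, x) • g t ∂μ :=
    fun g => kernelOp_coeFn (MemLp.swap_prod hk) g
  refine ⟨compressedSquare J J' k, ?_, compressedSquare_isSymmetric k hJ, ?_,
    compressedSquare_nonneg k hJ, ?_⟩
  · exact (isCompactOperator_kernelOp hk).clm_comp
      (J' ∘L (Submodule.span 𝕜 {k})ᗮ.starProjection)
  · intro f hf
    -- If `J f = c k`, applying `I_{a+}^{1-α}` shows that the primitive of `f` is constant, whence
    -- `f = 0`.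
    obtain ⟨c, hc⟩ := exists_smul_of_compressedSquare_eq_zero k hJ hf
    have h1 : J f + (-c) • k = 0 := by rw [hc]; simp
    have h2 := hleft f (-c)
    rw [h1] at h2
    have h3 : (fun x => -c + ∫ t in a..x, f t) =ᵐ[μ] 0 :=
      h2.symm.trans (leftFracInt_ae_eq_zero (Lp.coeFn_zero 𝕜 2 μ))
    exact (Lp.eq_zero_iff_ae_eq_zero).2
      ((hasACDeriv_integral (hLpInt f) (-c)).ae_eq_zero hab h3)
  · intro u f hu hf
    set F : Lp 𝕜 2 μ := hf.toLp f with hF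
    have hfF : F =ᵐ[μ] f := hf.coeFn_toLp
    constructor
    · rintro ⟨U, g, hUu, hUa, hUb, ⟨v, hv, hgv⟩, hg, w, hw, hgw⟩
      obtain ⟨-, hw2⟩ := hw.congr hfF.symm
      -- `g = J f + w(a) k`
      have e1 : g =ᵐ[μ] (J F + w a • k : Lp 𝕜 2 μ) := by
        have i2 := (hLpInt (J F + w a • k)).smul (-1 : 𝕜)
        have h0 := ae_eq_zero_of_leftFracInt hab hα0 hα1 (hg.add i2) (by
          have h2 := leftFracInt_add hab (sub_nonneg.2 hα1) hg i2
          rw [leftFracInt_smul] at h2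
          filter_upwards [h2, hleft F (w a), hgw, hIoo] with t h2 h3 h4 ht
          rw [h2, Pi.add_apply, Pi.smul_apply, h3, h4, hw2 t (Ioo_subset_Icc_self ht)]
          simp)
        filter_upwards [h0] with t ht
        simp only [Pi.add_apply, Pi.smul_apply, Pi.zero_apply, smul_eq_mul, neg_mul,
          one_mul] at ht
        linear_combination ht
      set G : Lp 𝕜 2 μ := J F + w a • k with hG
      -- `I_{b-}^α` applied to `-I_{b-}^{1-α} U'` is `U(x) - U(b)`. The identity holds at every `x`,
      -- in particular at `a`, where it becomes `⟨k, G⟩ = U(a)`.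
      have hGv : ∀ x ∈ Icc a b, ∫ t, fracKernel α (t, x) • G t ∂μ = U x := by
        intro x hx
        have h1 : ∫ t, fracKernel α (t, x) • G t ∂μ =
            ∫ t in Ioo a b, -(fracKernel α (t, x) • rightFracInt (1 - α) b v t) := by
          refine integral_congr_ae ?_
          filter_upwards [e1, hgv] with t h1 h2
          rw [← h1, h2, smul_neg]
        have h2 : ∫ t in x..b, v t = -U x := by
          have hi : IntervalIntegrable v volume a b :=
            (intervalIntegrable_iff_integrableOn_Ioo_of_le hab.le).2 hv.1
          have h1 : IntervalIntegrable v volume a x :=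
            hi.mono_set (by
              rw [uIcc_of_le hab.le, uIcc_of_le hx.1]; exact Icc_subset_Icc_right hx.2)
          have h2 : IntervalIntegrable v volume x b :=
            hi.mono_set (by
              rw [uIcc_of_le hab.le, uIcc_of_le hx.2]; exact Icc_subset_Icc_left hx.1)
          have h3 := hv.2 b ⟨hab.le, le_rfl⟩
          rw [← intervalIntegral.integral_add_adjacent_intervals h1 h2, ← add_assoc,
            ← hv.2 x hx, hUb] at h3
          linear_combination -h3
        rw [h1, integral_neg, kernel_rightFracInt_one_sub hα0 hα1 hv.1 hx, h2, neg_neg]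
      have hkG : inner 𝕜 k G = 0 := by rw [hinner, hGv a ⟨le_rfl, hab.le⟩, hUa]
      rw [compressedSquare_apply, starProjection_eq_of_inner_eq_zero k (w a) hkG hG]
      refine Lp.ext ?_
      filter_upwards [hu.coeFn_toLp, hUu, hJ' G, hIoo] with x h1 h2 h3 hx
      rw [h1, h2, h3, hGv x (Ioo_subset_Icc_self hx)]
    · intro huK
      set G := (Submodule.span 𝕜 {k})ᗮ.starProjection (J F) with hG
      obtain ⟨c, hc⟩ := starProjection_span_singleton_orthogonal (𝕜 := 𝕜) k (J F)
      have hkG : inner 𝕜 k G = 0 := inner_starProjection_span_singleton_orthogonal k (J F)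
      have hGc : G = J F + (-c) • k := by rw [hG, hc]; simp [sub_eq_add_neg]
      -- Absolute continuity of `I_{b-}^α (J F)`, from Lebesgue measure, and of `I_{b-}^α` of the
      -- multiple of `k`, from the Dirac mass at `a`.
      obtain ⟨v₁, hv₁, e₁⟩ := exists_primitive_fracInt_fracInt hα hα1
        (hIoo.mono fun τ hτ => ⟨hτ.1.le, hτ.2⟩ : ∀ᵐ τ ∂μ, τ ∈ Ico a b) (hLpInt F)
      obtain ⟨v₂, hv₂, e₂⟩ := exists_primitive_fracInt_fracInt hα hα1 hac (hdir (-c))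
      have hGae : G =ᵐ[μ] fun t => (∫ τ, fracKernel α (t, τ) • F τ ∂μ) +
          ∫ τ, fracKernel α (t, τ) • (-c) ∂(Measure.dirac a) := by
        rw [hGc]
        filter_upwards [Lp.coeFn_add (J F) ((-c) • k), Lp.coeFn_smul (-c) k, hk₀.coeFn_toLp,
          kernelOp_coeFn hk F] with t h1 h2 h3 h4
        rw [h1, Pi.add_apply, h2, Pi.smul_apply, h3, h4, integral_dirac, smul_eq_mul,
          RCLike.real_smul_eq_coe_mul, mul_comm (-c)]
      have hv : IntegrableOn (v₁ + v₂) (Ioo a b) := hv₁.add hv₂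
      have hU : ∀ x ∈ Ico a b, ∫ t, fracKernel α (t, x) • G t ∂μ =
          -∫ ξ in x..b, (v₁ + v₂) ξ := by
        intro x hx
        have hkx : MemLp (fun t => fracKernel α (t, x)) 2 μ := memLp_fracKernel_slice hα hx
        have m1 : MemLp (fun t => ∫ τ, fracKernel α (t, τ) • F τ ∂μ) 2 μ :=
          (memLp_kernel_integral hk (Lp.memLp F)).1
        have m2 : MemLp (fun t => ∫ τ, fracKernel α (t, τ) • (-c) ∂(Measure.dirac a)) 2 μ := by
          have := hk₀.mul_const (-c)
          refine this.ae_eq (Eventually.of_forall fun t => ?_)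
          simp only [integral_dirac, RCLike.real_smul_eq_coe_mul]
        have h1 : ∫ t, fracKernel α (t, x) • G t ∂μ =
            ∫ t, (fracKernel α (t, x) • (∫ τ, fracKernel α (t, τ) • F τ ∂μ) +
              fracKernel α (t, x) • ∫ τ, fracKernel α (t, τ) • (-c) ∂(Measure.dirac a)) ∂μ := by
          refine integral_congr_ae ?_
          filter_upwards [hGae] with t ht
          rw [ht, smul_add]
        have hi : ∀ v : ℝ → 𝕜, IntegrableOn v (Ioo a b) → IntervalIntegrable v volume x b := by
          intro v hv
          rw [intervalIntegrable_iff_integrableOn_Ioo_of_le hx.2.le]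
          exact hv.mono_set (Ioo_subset_Ioo_left hx.1)
        have j1 : Integrable (fun t => fracKernel α (t, x) •
            ∫ τ, fracKernel α (t, τ) • F τ ∂μ) μ := memLp_one_iff_integrable.1 (m1.smul hkx)
        have j2 : Integrable (fun t => fracKernel α (t, x) •
            ∫ τ, fracKernel α (t, τ) • (-c) ∂(Measure.dirac a)) μ :=
          memLp_one_iff_integrable.1 (m2.smul hkx)
        rw [h1, integral_add j1 j2, e₁ x hx, e₂ x hx]
        simp only [Pi.add_apply]
        rw [intervalIntegral.integral_add (hi _ hv₁) (hi _ hv₂)]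
        ring
      -- Both sides have the same image under `I_{b-}^α`, which is injective; so `G` is indeed the
      -- Caputo derivative of the constructed function.
      have hGr : G =ᵐ[μ] fun x => -rightFracInt (1 - α) b (v₁ + v₂) x := by
        have i2 := integrableOn_rightFracInt hab (sub_nonneg.2 hα1) hv
        have h0 := ae_eq_zero_of_rightKernel hab hα0 hα1 ((hLpInt G).add i2) (by
          filter_upwards [hIoo, ae_integrableOn_fracKernel_smul hab hα0 i2] with x hx hix
          have h1 := kernel_rightFracInt_one_sub hα0 hα1 hv (Ioo_subset_Icc_self hx)
          have h2 := hU x ⟨hx.1.le, hx.2⟩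
          have hix' : Integrable (fun t => fracKernel α (t, x) • G t) μ :=
            memLp_one_iff_integrable.1
              ((Lp.memLp G).smul (memLp_fracKernel_slice hα ⟨hx.1.le, hx.2⟩))
          simp only [Pi.add_apply, smul_add]
          rw [integral_add hix' hix, h1, h2, neg_add_cancel])
        filter_upwards [h0] with t ht
        simp only [Pi.add_apply, Pi.zero_apply] at ht
        linear_combination ht
      refine ⟨fun x => -∫ t in x..b, (v₁ + v₂) t, G, ?_, ?_, by simp,
        ⟨v₁ + v₂, hasACDeriv_neg_integral_right hab hv, hGr⟩, hLpInt G,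
        fun x => -c + ∫ t in a..x, F t, (hasACDeriv_integral (hLpInt F) (-c)).congr hfF, ?_⟩
      · have h1 := hu.coeFn_toLp
        rw [huK, compressedSquare_apply] at h1
        filter_upwards [h1, hJ' G, hIoo] with x h1 h2 hx
        rw [← h1, h2, hU x ⟨hx.1.le, hx.2⟩]
      · show -∫ t in a..b, (v₁ + v₂) t = 0
        rw [← hU a ⟨le_rfl, hab⟩, ← hinner, hkG]
      · rw [hGc]
        exact hleft F (-c)

end OneDimensional

end

section

/-! ### Diagonalization of relations given by a compact resolvent -/

/-- A relation on square integrable functions that is described by a compact positive injective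
operator is diagonal in a Hilbert basis, with eigenvalues tending to infinity. -/
theorem exists_hilbertBasis_diagonal.{u} {𝕜 : Type u} [RCLike 𝕜] {X : Type*} [MeasurableSpace X]
    {μ : Measure X} {S : Lp 𝕜 2 μ →L[𝕜] Lp 𝕜 2 μ} (hS : IsCompactOperator S)
    (hsymm : (S : Lp 𝕜 2 μ →ₗ[𝕜] Lp 𝕜 2 μ).IsSymmetric) (hinj : ∀ f, S f = 0 → f = 0)
    (hpos : ∀ f, 0 ≤ RCLike.re (inner 𝕜 (S f) f)) {t : ℝ} (hle : ∀ f, t * ‖S f‖ ≤ ‖f‖)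
    {R : (X → 𝕜) → (X → 𝕜) → Prop}
    (hR : ∀ (u f : X → 𝕜) (hu : MemLp u 2 μ) (hf : MemLp f 2 μ),
      R u f ↔ hu.toLp u = S (hf.toLp f + (t : 𝕜) • hu.toLp u)) :
    ∃ (ι : Type u) (e : HilbertBasis ι 𝕜 (Lp 𝕜 2 μ)) (c : ι → ℝ), (∀ i, 0 ≤ c i) ∧
      (∀ i, -t < c i) ∧ (∀ M : ℝ, {i | c i ≤ M}.Finite) ∧
      ∀ u v, MemLp u 2 μ → MemLp v 2 μ → (R u v ↔ ∀ i, ∫ x, inner 𝕜 (e i x) (v x) ∂μ =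
        (c i : 𝕜) * ∫ x, inner 𝕜 (e i x) (u x) ∂μ) := by
  obtain ⟨ι, e, κ, hκ, he, hfin⟩ := exists_hilbertBasis_eigenvectors hS hsymm hinj hpos
  -- In the eigenbasis, `u = S (f + t u)` reads `f_i = (1/κ_i - t) u_i`. The bound `t κ_i ≤ 1` gives
  -- nonnegativity, and positivity of `κ_i` gives the strict bound `-t < c i`.
  refine ⟨ι, e, fun i => (κ i)⁻¹ - t, fun i => ?_, fun i => ?_, fun M => ?_, ?_⟩
  · have h1 := hle (e i)
    rw [he, norm_smul, RCLike.norm_ofReal, abs_of_pos (hκ i), e.orthonormal.1 i, mul_one] at h1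
    rw [sub_nonneg, ← one_div, le_div_iff₀ (hκ i)]
    exact h1
  · have := inv_pos.2 (hκ i)
    linarith
  · rcases le_or_gt (M + t) 0 with h | h
    · convert Set.finite_empty (α := ι)
      rw [eq_empty_iff_forall_notMem]
      intro i hi
      have := inv_pos.2 (hκ i)
      have hi' : (κ i)⁻¹ - t ≤ M := hi
      linarith
    · refine (hfin (M + t)⁻¹ (inv_pos.2 h)).subset fun i hi => ?_
      have hi' : (κ i)⁻¹ - t ≤ M := hi
      exact (inv_le_comm₀ (hκ i) h).1 (by linarith)
  · intro u f hu hf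
    have hSi : ∀ i (g : Lp 𝕜 2 μ), inner 𝕜 (e i) (S g) = (κ i : 𝕜) * inner 𝕜 (e i) g := by
      intro i g
      have h1 := hsymm (e i) g
      simp only [ContinuousLinearMap.coe_coe] at h1
      rw [← h1, he, inner_smul_left, RCLike.conj_ofReal]
    have h2 : hu.toLp u = S (hf.toLp f + (t : 𝕜) • hu.toLp u) ↔
        ∀ i, inner 𝕜 (e i) (hu.toLp u) =
          inner 𝕜 (e i) (S (hf.toLp f + (t : 𝕜) • hu.toLp u)) :=
      ⟨fun h i => by rw [← h], fun h => HilbertBasis.ext_inner e h⟩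
    rw [hR u f hu hf, h2]
    refine forall_congr' fun i => ?_
    rw [← inner_Lp_toLp (e i) hf, ← inner_Lp_toLp (e i) hu, hSi, inner_add_right, inner_smul_right]
    have hκ' : (κ i : 𝕜) ≠ 0 := RCLike.ofReal_ne_zero.2 (hκ i).ne'
    push_cast
    constructor <;> intro h
    · field_simp
      linear_combination -h
    · rw [h]
      field_simp
      ring

/-! ### Cardinality of the eigenbases -/

theorem countable_of_finite_sublevels {ι : Type*} {c : ι → ℝ} (h : ∀ M : ℝ, {i | c i ≤ M}.Finite) :
    Countable ι := by
  rw [← countable_univ_iff]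
  refine (countable_iUnion fun n : ℕ => (h n).countable).mono fun i _ => ?_
  exact mem_iUnion.2 (exists_nat_ge (c i))

theorem infinite_of_hilbertBasis_Lp_Ioo {𝕜 : Type*} [RCLike 𝕜] {a b : ℝ} (hab : a < b) {ι : Type*}
    (e : HilbertBasis ι 𝕜 (Lp 𝕜 2 (volume.restrict (Ioo a b)))) : Infinite ι := by
  by_contra hinf
  rw [not_infinite_iff_finite] at hinf
  have := Fintype.ofFinite ι
  have hfd : FiniteDimensional 𝕜 (Lp 𝕜 2 (volume.restrict (Ioo a b))) :=
    Module.Finite.of_basis (e.toOrthonormalBasis).toBasis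
  -- The points decrease from `b` towards `a`. The indicators of the disjoint intervals `(p (n + 1),
  -- p n)` form an infinite orthogonal family of nonzero vectors.
  let p : ℕ → ℝ := fun n => a + (b - a) / (n + 1)
  have hp : Antitone p := fun m n h => by
    have : (m : ℝ) ≤ n := Nat.cast_le.2 h
    have := sub_pos.2 hab
    simp only [p]
    gcongr
  have hp' : ∀ n, p (n + 1) < p n := fun n => by
    have := sub_pos.2 hab
    simp only [p]
    gcongr
    linarith
  let v : ℕ → Lp 𝕜 2 (volume.restrict (Ioo a b)) := fun n =>
    indicatorConstLp 2 (measurableSet_Ioo (a := p (n + 1)) (b := p n)) (measure_ne_top _ _) 1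
  have hv : LinearIndependent 𝕜 v := by
    refine linearIndependent_of_ne_zero_of_inner_eq_zero (fun n hn => ?_) ?_
    · have h1 := congrArg norm hn
      simp only [v] at h1
      rw [norm_indicatorConstLp (by norm_num) (by norm_num), norm_zero, norm_one, one_mul,
        Real.rpow_eq_zero measureReal_nonneg (by norm_num), measureReal_restrict_apply
        measurableSet_Ioo, inter_eq_self_of_subset_left, Real.volume_real_Ioo_of_le (hp' n).le]
        at h1
      · linarith [hp' n]
      · refine Ioo_subset_Ioo ?_ ?_
        · have := sub_pos.2 hab
          simp only [p]
          have : 0 ≤ (b - a) / (((n + 1 : ℕ) : ℝ) + 1) := by positivity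
          linarith
        · have := hp (Nat.zero_le n)
          simpa [p] using this
    · have key : ∀ m n, m < n → inner 𝕜 (v m) (v n) = 0 := by
        intro m n hmn
        simp only [v]
        rw [L2.inner_indicatorConstLp_one]
        refine integral_eq_zero_of_ae ?_
        have h1 := (indicatorConstLp_coeFn (p := 2) (μ := volume.restrict (Ioo a b)) (c := (1 : 𝕜))
          (hs := measurableSet_Ioo (a := p (n + 1)) (b := p n)) (hμs := measure_ne_top _ _))
        filter_upwards [ae_restrict_of_ae h1, ae_restrict_mem measurableSet_Ioo] with x h2 h3
        rw [h2, indicator_of_notMem]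
        · rfl
        · intro h4
          have := hp (Nat.succ_le_of_lt hmn)
          exact absurd (h4.2.trans_le this) h3.1.not_gt
      intro m n hmn
      rcases lt_or_gt_of_ne hmn with h | h
      · exact key m n h
      · rw [← inner_conj_symm, key n m h, map_zero]
  exact not_finite_iff_infinite.2 inferInstance hv.finite

/-- The constant function one is a nonzero vector, so the basis cannot be empty. -/
theorem nonempty_of_hilbertBasis_Lp {𝕜 : Type*} [RCLike 𝕜] {X : Type*} [MeasurableSpace X]
    {μ : Measure X} [IsFiniteMeasure μ] [NeZero μ] {ι : Type*}
    (e : HilbertBasis ι 𝕜 (Lp 𝕜 2 μ)) : Nonempty ι := by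
  by_contra hι
  rw [not_nonempty_iff] at hι
  let w : Lp 𝕜 2 μ := indicatorConstLp 2 MeasurableSet.univ (measure_ne_top μ _) 1
  have h0 : w = 0 := HilbertBasis.ext_inner e fun i => hι.elim i
  have h1 := congrArg norm h0
  simp only [w] at h1
  rw [norm_indicatorConstLp (by norm_num) (by norm_num), norm_zero, norm_one, one_mul,
    Real.rpow_eq_zero measureReal_nonneg (by norm_num)] at h1
  exact NeZero.ne μ (Measure.measure_univ_eq_zero.1 ((measureReal_eq_zero_iff).1 h1))

end

section

/-! ### The resolvent of a closed form -/

section FormResolvent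

variable {𝕜 : Type*} [RCLike 𝕜] {H G : Type*} [NormedAddCommGroup H] [InnerProductSpace 𝕜 H]
  [CompleteSpace H] [NormedAddCommGroup G] [InnerProductSpace 𝕜 G] [CompleteSpace G]

/-- The embedding of the form domain into the underlying space, the form domain being given as the
closure of a subspace of graph vectors. -/
def formEmbedding (W : Submodule 𝕜 (WithLp 2 (H × G))) : W.topologicalClosure →L[𝕜] H :=
  WithLp.fstL 2 𝕜 H G ∘L W.topologicalClosure.subtypeL

theorem formEmbedding_apply (W : Submodule 𝕜 (WithLp 2 (H × G))) (w : W.topologicalClosure) :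
    formEmbedding W w = (w : WithLp 2 (H × G)).fst := rfl

instance completeSpace_formDomain (W : Submodule 𝕜 (WithLp 2 (H × G))) :
    CompleteSpace W.topologicalClosure :=
  W.isClosed_topologicalClosure.completeSpace_coe

/-- The operator `(1 + A)⁻¹`, where `A` is the operator of the form `‖w.snd‖²`. -/
def formResolvent (W : Submodule 𝕜 (WithLp 2 (H × G))) : H →L[𝕜] H :=
  formEmbedding W ∘L ContinuousLinearMap.adjoint (formEmbedding W)

variable (W : Submodule 𝕜 (WithLp 2 (H × G)))

theorem norm_formEmbedding_le (w : W.topologicalClosure) : ‖formEmbedding W w‖ ≤ ‖w‖ := by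
  rw [formEmbedding_apply, ← abs_norm, ← abs_norm w]
  refine sq_le_sq.1 ?_
  rw [Submodule.coe_norm, WithLp.prod_norm_sq_eq_of_L2]
  exact le_add_of_nonneg_right (sq_nonneg _)

/-- The factorisation `ι ι*` in terms of the embedding `ι`; symmetry, positivity and the description
of the kernel all follow from it. -/
theorem inner_formResolvent (f g : H) :
    inner 𝕜 (formResolvent W f) g = inner 𝕜 (ContinuousLinearMap.adjoint (formEmbedding W) f)
      (ContinuousLinearMap.adjoint (formEmbedding W) g) := by
  rw [ContinuousLinearMap.adjoint_inner_right]; rfl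

theorem formResolvent_isSymmetric : (formResolvent W : H →ₗ[𝕜] H).IsSymmetric := by
  intro f g
  simp only [ContinuousLinearMap.coe_coe]
  rw [inner_formResolvent, ← inner_conj_symm, ← inner_formResolvent, inner_conj_symm]

theorem formResolvent_nonneg (f : H) : 0 ≤ RCLike.re (inner 𝕜 (formResolvent W f) f) := by
  rw [inner_formResolvent]
  exact inner_self_nonneg

theorem norm_formResolvent_le (f : H) : ‖formResolvent W f‖ ≤ ‖f‖ := by
  have h1 : ‖formEmbedding W‖ ≤ 1 :=
    ContinuousLinearMap.opNorm_le_bound _ zero_le_one fun w => by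
      rw [one_mul]; exact norm_formEmbedding_le W w
  have h2 : ‖ContinuousLinearMap.adjoint (formEmbedding W) f‖ ≤ 1 * ‖f‖ := by
    refine (ContinuousLinearMap.le_opNorm _ f).trans ?_
    rw [LinearIsometryEquiv.norm_map]
    gcongr
  rw [one_mul] at h2
  exact (norm_formEmbedding_le W _).trans h2

theorem formResolvent_eq_zero {f : H} (hf : formResolvent W f = 0) :
    ∀ w ∈ W, inner 𝕜 w.fst f = 0 := by
  intro w hw
  have h1 := inner_formResolvent W f f
  rw [hf, inner_zero_left, eq_comm, inner_self_eq_zero] at h1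
  have h2 := ContinuousLinearMap.adjoint_inner_right (formEmbedding W)
    ⟨w, W.le_topologicalClosure hw⟩ f
  rw [h1, inner_zero_right] at h2
  exact h2.symm

/-- `ι* g` is the Riesz representative of `w ↦ ⟨w.fst, g⟩` on the form domain, and by continuity it
suffices to test on the dense subspace `W`. The second component is left existential, so closability
of the form is not needed here. -/
theorem eq_formResolvent_iff {u g : H} : u = formResolvent W g ↔
    ∃ v : G, WithLp.toLp 2 (u, v) ∈ W.topologicalClosure ∧
      ∀ w ∈ W, inner 𝕜 w (WithLp.toLp 2 (u, v)) = inner 𝕜 w.fst g := by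
  constructor
  · intro h
    set w := ContinuousLinearMap.adjoint (formEmbedding W) g with hw
    have h0 : WithLp.toLp 2 (u, (w : WithLp 2 (H × G)).snd) = w := by
      rw [h]; rfl
    refine ⟨(w : WithLp 2 (H × G)).snd, by rw [h0]; exact w.2, fun w' hw' => ?_⟩
    rw [h0]
    exact ContinuousLinearMap.adjoint_inner_right (formEmbedding W)
      ⟨w', W.le_topologicalClosure hw'⟩ g
  · rintro ⟨v, hv, h⟩
    have h1 : ∀ w ∈ W.topologicalClosure,
        inner 𝕜 w (WithLp.toLp 2 (u, v)) = inner 𝕜 w.fst g := by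
      intro w hw
      have hc : IsClosed {w : WithLp 2 (H × G) |
          inner 𝕜 w (WithLp.toLp 2 (u, v)) = inner 𝕜 w.fst g} :=
        isClosed_eq (continuous_id.inner continuous_const)
          ((WithLp.fstL 2 𝕜 H G).continuous.inner continuous_const)
      have hw' : w ∈ closure (W : Set (WithLp 2 (H × G))) := by
        rwa [← Submodule.topologicalClosure_coe]
      exact closure_minimal h hc hw'
    have h2 : ContinuousLinearMap.adjoint (formEmbedding W) g = ⟨WithLp.toLp 2 (u, v), hv⟩ := by
      refine ext_inner_left 𝕜 fun w => ?_
      rw [ContinuousLinearMap.adjoint_inner_right]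
      exact (h1 w w.2).symm
    rw [formResolvent, ContinuousLinearMap.comp_apply, h2]
    rfl

/-- The estimate extends from `W` to its closure, so the compact operators `A n ∘ ι` converge in
norm to the embedding `ι`. This replaces a Rellich theorem. -/
theorem isCompactOperator_formResolvent {A : ℕ → H →L[𝕜] H} (hA : ∀ n, IsCompactOperator (A n))
    {c : ℕ → ℝ} (hc : Tendsto c atTop (𝓝 0)) (hc0 : ∀ n, 0 ≤ c n)
    (h : ∀ n, ∀ w ∈ W, ‖w.fst - A n w.fst‖ ≤ c n * ‖w‖) :
    IsCompactOperator (formResolvent W) := by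
  have h1 : ∀ n, ∀ w ∈ W.topologicalClosure, ‖w.fst - A n w.fst‖ ≤ c n * ‖w‖ := by
    intro n w hw
    have hcl : IsClosed {w : WithLp 2 (H × G) | ‖w.fst - A n w.fst‖ ≤ c n * ‖w‖} :=
      isClosed_le (((WithLp.fstL 2 𝕜 H G).continuous.sub
        ((A n).continuous.comp (WithLp.fstL 2 𝕜 H G).continuous)).norm)
        (continuous_const.mul continuous_norm)
    have hw' : w ∈ closure (W : Set (WithLp 2 (H × G))) := by
      rwa [← Submodule.topologicalClosure_coe]
    exact closure_minimal (h n) hcl hw'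
  have h2 : Tendsto (fun n => A n ∘L formEmbedding W) atTop (𝓝 (formEmbedding W)) := by
    refine (tendsto_iff_norm_sub_tendsto_zero (E := W.topologicalClosure →L[𝕜] H)).2 ?_
    refine squeeze_zero (fun n => norm_nonneg (A n ∘L formEmbedding W - formEmbedding W)) (fun n => ?_) hc
    refine ContinuousLinearMap.opNorm_le_bound _ (hc0 n) fun w => ?_
    rw [← norm_neg, sub_apply, neg_sub]
    exact h1 n w w.2
  have h3 : IsCompactOperator (formEmbedding W) :=
    isCompactOperator_of_tendsto h2 (Eventually.of_forall fun n => (hA n).comp_clm _)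
  exact h3.comp_clm _

end FormResolvent

end

section

/-! ### The singular kernel -/

/-- The Euclidean space of dimension `N`. -/
abbrev Euc (N : ℕ) : Type := EuclideanSpace ℝ (Fin N)

variable {N : ℕ} {s : ℝ}

/-- The kernel `|h|^{-(N+2s)}` of the fractional Laplacian. -/
def singKernel (s : ℝ) (h : Euc N) : ℝ := (‖h‖ ^ ((N : ℝ) + 2 * s))⁻¹

theorem singKernel_nonneg (s : ℝ) (h : Euc N) : 0 ≤ singKernel s h :=
  inv_nonneg.2 (Real.rpow_nonneg (norm_nonneg h) _)

theorem singKernel_neg (s : ℝ) (h : Euc N) : singKernel s (-h) = singKernel s h := by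
  simp only [singKernel, norm_neg]

theorem measurable_singKernel (s : ℝ) : Measurable (singKernel s : Euc N → ℝ) := by
  unfold singKernel
  fun_prop

/-- In polar coordinates the integrand is `r^(1-2s)` near zero, integrable because `s < 1`, and
`r^(-1-2s)` at infinity, integrable because `s > 0`. -/
theorem integrable_min_mul_singKernel (hN : 1 ≤ N) (hs : 0 < s) (hs1 : s < 1) :
    Integrable fun h : Euc N => min 1 (‖h‖ ^ 2) * singKernel s h := by
  have : Nontrivial (Euc N) := by
    have : Nonempty (Fin N) := ⟨⟨0, hN⟩⟩
    infer_instance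
  have h1 := integrable_fun_norm_addHaar (volume : Measure (Euc N))
    (f := fun r : ℝ => min 1 (r ^ 2) * (r ^ ((N : ℝ) + 2 * s))⁻¹)
  refine h1.2 ?_
  rw [finrank_euclideanSpace_fin, ← Ioc_union_Ioi_eq_Ioi zero_le_one, integrableOn_union]
  have hpow : ∀ r : ℝ, 0 < r → r ^ (N - 1) = r ^ ((N : ℝ) - 1) := by
    intro r hr
    rw [← Real.rpow_natCast, Nat.cast_sub hN, Nat.cast_one]
  constructor
  · have h2 : IntegrableOn (fun r : ℝ => r ^ (1 - 2 * s)) (Ioc 0 1) :=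
      (intervalIntegrable_iff_integrableOn_Ioc_of_le zero_le_one).1
        (intervalIntegral.intervalIntegrable_rpow' (by linarith))
    refine h2.congr_fun (fun r hr => ?_) measurableSet_Ioc
    have hr0 : 0 < r := hr.1
    have h3 : r ^ 2 ≤ 1 := pow_le_one₀ hr0.le hr.2
    simp only [smul_eq_mul]
    rw [min_eq_right h3, hpow r hr0, ← Real.rpow_neg hr0.le, ← Real.rpow_natCast r 2,
      ← Real.rpow_add hr0, ← Real.rpow_add hr0]
    congr 1
    push_cast
    ring
  · have h2 : IntegrableOn (fun r : ℝ => r ^ (-1 - 2 * s)) (Ioi 1) :=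
      integrableOn_Ioi_rpow_of_lt (by linarith) zero_lt_one
    refine h2.congr_fun (fun r hr => ?_) measurableSet_Ioi
    have hr1 : 1 < r := hr
    have hr0 : 0 < r := zero_lt_one.trans hr1
    simp only [smul_eq_mul]
    rw [min_eq_left (one_le_pow₀ hr1.le), hpow r hr0, ← Real.rpow_neg hr0.le, one_mul,
      ← Real.rpow_add hr0]
    congr 1
    ring

theorem singKernel_le_of_le {ε : ℝ} (hε : 0 < ε) {h : Euc N} (hh : ε ≤ ‖h‖) :
    singKernel s h ≤ (min 1 (ε ^ 2))⁻¹ * (min 1 (‖h‖ ^ 2) * singKernel s h) := by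
  have h0 : 0 < min 1 (ε ^ 2) := lt_min one_pos (pow_pos hε 2)
  rw [← mul_assoc]
  refine le_mul_of_one_le_left (singKernel_nonneg s h) ?_
  rw [← div_eq_inv_mul, one_le_div h0]
  gcongr

theorem integrable_indicator_singKernel (hN : 1 ≤ N) (hs : 0 < s) (hs1 : s < 1) {ε : ℝ}
    (hε : 0 < ε) :
    Integrable ((Metric.ball (0 : Euc N) ε)ᶜ.indicator (singKernel s)) := by
  refine ((integrable_min_mul_singKernel hN hs hs1).const_mul (min 1 (ε ^ 2))⁻¹).mono'
    ((measurable_singKernel s).indicator Metric.isOpen_ball.measurableSet.compl).aestronglyMeasurable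
    (Eventually.of_forall fun h => ?_)
  by_cases hh : h ∈ (Metric.ball (0 : Euc N) ε)ᶜ
  · rw [indicator_of_mem hh, Real.norm_of_nonneg (singKernel_nonneg s h)]
    exact singKernel_le_of_le hε (by simpa using hh)
  · rw [indicator_of_notMem hh, norm_zero]
    have := singKernel_nonneg s h
    positivity

/-! ### Differences of test functions -/

variable {𝕜 : Type*} [RCLike 𝕜]

/-- The symmetric second difference, with a minus sign. -/
def secondDiff (φ : Euc N → 𝕜) (y h : Euc N) : 𝕜 := (φ y - φ (y - h)) + (φ y - φ (y + h))

/-- For large increments boundedness suffices. For small ones, first differences use the Lipschitz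
constant of `φ`, and second differences that of its derivative. The factor `min 1 |h|²` is what
makes the singular kernel integrable. -/
theorem exists_bound_differences {φ : Euc N → 𝕜} (hφ : ContDiff ℝ ∞ φ)
    (hc : HasCompactSupport φ) : ∃ M : ℝ, 0 ≤ M ∧ (∀ y, ‖φ y‖ ≤ M) ∧
      (∀ y ξ, ‖φ y - φ ξ‖ ^ 2 ≤ M * min 1 (‖y - ξ‖ ^ 2)) ∧
      ∀ y h, ‖secondDiff φ y h‖ ≤ M * min 1 (‖h‖ ^ 2) := by
  obtain ⟨B, hB⟩ := hc.exists_bound_of_continuous hφ.continuous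
  obtain ⟨L₁, hL₁⟩ := ContDiff.lipschitzWith_of_hasCompactSupport hc hφ (by simp)
  have hφ' : ContDiff ℝ 1 (fderiv ℝ φ) := hφ.fderiv_right (m := 1) (by norm_cast)
  obtain ⟨L₂, hL₂⟩ := ContDiff.lipschitzWith_of_hasCompactSupport (hc.fderiv ℝ) hφ' (by simp)
  have hB0 : 0 ≤ B := (norm_nonneg _).trans (hB 0)
  have hmin : ∀ {x A A' t : ℝ}, x ≤ A → x ≤ A' * t → 0 ≤ A → 0 ≤ A' → 0 ≤ t →
      x ≤ (A + A') * min 1 t := by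
    intro x A A' t h1 h2 h3 h4 h5
    rcases le_total 1 t with h | h
    · rw [min_eq_left h]; linarith
    · rw [min_eq_right h]; nlinarith
  have hd : ∀ y h : Euc N, ‖φ (y + h) - φ y - fderiv ℝ φ y h‖ ≤ L₂ * ‖h‖ ^ 2 := by
    intro y h
    have h1 := (convex_closedBall y ‖h‖).norm_image_sub_le_of_norm_fderiv_le' (𝕜 := ℝ) (f := φ)
      (φ := fderiv ℝ φ y) (C := L₂ * ‖h‖) (x := y) (y := y + h)
      (fun x _ => (hφ.differentiable (by simp)).differentiableAt)
      (fun x hx => (hL₂.norm_sub_le x y).trans (by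
        gcongr
        rwa [← dist_eq_norm, ← Metric.mem_closedBall]))
      (Metric.mem_closedBall_self (norm_nonneg h)) (by simp)
    rw [add_sub_cancel_left] at h1
    refine h1.trans_eq ?_
    ring
  have n1 : (0 : ℝ) ≤ L₁ := L₁.2
  have n2 : (0 : ℝ) ≤ L₂ := L₂.2
  have e1 : ∀ y ξ, ‖φ y - φ ξ‖ ^ 2 ≤ ((2 * B) ^ 2 + L₁ ^ 2) * min 1 (‖y - ξ‖ ^ 2) := by
    intro y ξ
    refine hmin ?_ ?_ (by positivity) (by positivity) (by positivity)
    · gcongr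
      exact (norm_sub_le _ _).trans (by linarith [hB y, hB ξ])
    · rw [← mul_pow]
      gcongr
      exact hL₁.norm_sub_le y ξ
  have e2 : ∀ y h, ‖secondDiff φ y h‖ ≤ (4 * B + 2 * L₂) * min 1 (‖h‖ ^ 2) := by
    intro y h
    refine hmin ?_ ?_ (by positivity) (by positivity) (by positivity)
    · refine (norm_add_le _ _).trans ?_
      have h1 := (norm_sub_le (φ y) (φ (y - h))).trans (add_le_add (hB y) (hB (y - h)))
      have h2 := (norm_sub_le (φ y) (φ (y + h))).trans (add_le_add (hB y) (hB (y + h)))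
      linarith
    · have h1 := hd y h
      have h2 := hd y (-h)
      rw [norm_neg, map_neg, ← sub_eq_add_neg] at h2
      -- The first-order terms at `h` and `-h` cancel, leaving two quadratic Taylor remainders.
      have h3 : secondDiff φ y h = -((φ (y + h) - φ y - fderiv ℝ φ y h) +
          (φ (y - h) - φ y - -(fderiv ℝ φ y h))) := by
        simp only [secondDiff]; ring
      rw [h3, norm_neg]
      refine (norm_add_le _ _).trans ?_
      linarith
  have hm : ∀ t : ℝ, 0 ≤ min 1 (t ^ 2) := fun t => le_min zero_le_one (sq_nonneg t)
  refine ⟨B + ((2 * B) ^ 2 + L₁ ^ 2) + (4 * B + 2 * L₂), by positivity, fun y => ?_, fun y ξ => ?_,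
    fun y h => ?_⟩
  · refine (hB y).trans ?_
    rw [add_assoc]
    exact le_add_of_nonneg_right (by positivity)
  · refine (e1 y ξ).trans (mul_le_mul_of_nonneg_right ?_ (hm _))
    rw [add_assoc, add_left_comm]
    exact le_add_of_nonneg_right (by positivity)
  · refine (e2 y h).trans (mul_le_mul_of_nonneg_right ?_ (hm _))
    exact le_add_of_nonneg_left (by positivity)

/-! ### The fractional Laplacian of a test function -/

/-- The singular integral truncated at distance `ε`. -/
def truncFracLap (s ε : ℝ) (φ : Euc N → 𝕜) (y : Euc N) : 𝕜 :=
  ∫ ξ in (Metric.ball y ε)ᶜ, singKernel s (y - ξ) • (φ y - φ ξ)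

theorem truncFracLap_eq_integral (ε : ℝ) (φ : Euc N → 𝕜) (y : Euc N) : truncFracLap s ε φ y =
    ∫ ξ, (Metric.ball (0 : Euc N) ε)ᶜ.indicator (singKernel s) (y - ξ) • (φ y - φ ξ) := by
  rw [truncFracLap, ← integral_indicator Metric.isOpen_ball.measurableSet.compl]
  congr 1
  funext ξ
  have hiff : ξ ∈ (Metric.ball y ε)ᶜ ↔ y - ξ ∈ (Metric.ball (0 : Euc N) ε)ᶜ := by
    simp only [mem_compl_iff, Metric.mem_ball, dist_eq_norm, sub_zero,
      norm_sub_rev ξ y]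
  by_cases h : ξ ∈ (Metric.ball y ε)ᶜ
  · rw [indicator_of_mem h, indicator_of_mem (hiff.1 h)]
  · rw [indicator_of_notMem h, indicator_of_notMem (fun h' => h (hiff.2 h')), zero_smul]

/-- The kernel is even, so the substitutions `ξ = y - h` and `ξ = y + h` give the same truncated
integral. Their average contains the second difference, whose quadratic decay permits `ε → 0`. -/
theorem truncFracLap_eq_secondDiff (hN : 1 ≤ N) (hs : 0 < s) (hs1 : s < 1) {ε : ℝ} (hε : 0 < ε)
    {φ : Euc N → 𝕜} (hφ : Continuous φ) {M : ℝ} (hM : ∀ y, ‖φ y‖ ≤ M) (y : Euc N) :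
    truncFracLap s ε φ y = (1 / 2 : ℝ) •
      ∫ h, (Metric.ball (0 : Euc N) ε)ᶜ.indicator (singKernel s) h • secondDiff φ y h := by
  set κ : Euc N → ℝ := (Metric.ball (0 : Euc N) ε)ᶜ.indicator (singKernel s) with hκ
  have hκi : Integrable κ := integrable_indicator_singKernel hN hs hs1 hε
  have hκn : ∀ h, κ (-h) = κ h := by
    intro h
    simp only [hκ, indicator, mem_compl_iff, Metric.mem_ball, dist_zero_right, norm_neg,
      singKernel_neg]
  have hi : ∀ (g : Euc N → Euc N), Continuous g →
      Integrable fun h => κ h • (φ y - φ (g h)) := by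
    intro g hg
    refine hκi.smul_bdd (C := M + M) (by fun_prop) (Eventually.of_forall fun h => ?_)
    exact (norm_sub_le _ _).trans (add_le_add (hM _) (hM _))
  have h1 : truncFracLap s ε φ y = ∫ h, κ h • (φ y - φ (y - h)) := by
    rw [truncFracLap_eq_integral, ← integral_sub_left_eq_self
      (fun ξ => κ (y - ξ) • (φ y - φ ξ)) volume y]
    simp only [sub_sub_cancel]
  have h2 : truncFracLap s ε φ y = ∫ h, κ h • (φ y - φ (y + h)) := by
    rw [h1, ← integral_neg_eq_self]
    simp only [hκn, sub_neg_eq_add]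
  simp only [secondDiff, smul_add]
  rw [integral_add (hi _ (by fun_prop)) (hi _ (by fun_prop)), ← h1, ← h2, ← two_smul ℝ, smul_smul]
  norm_num

theorem stronglyMeasurable_integral_secondDiff {κ : Euc N → ℝ} (hκ : Measurable κ)
    {φ : Euc N → 𝕜} (hφ : Continuous φ) :
    StronglyMeasurable fun y => ∫ h, κ h • secondDiff φ y h := by
  have h1 : StronglyMeasurable fun p : Euc N × Euc N => κ p.2 • secondDiff φ p.1 p.2 := by
    refine StronglyMeasurable.smul (hκ.comp measurable_snd).stronglyMeasurable ?_
    refine Continuous.stronglyMeasurable ?_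
    unfold secondDiff
    fun_prop
  exact h1.integral_prod_right

/-- Dominated convergence on second differences: the `limUnder` in the definition of `fracLap` is a
true limit, and the truncations are bounded uniformly in `ε` and `y`, as needed for passing to the
limit under the integral. -/
theorem fracLap_spec (hN : 1 ≤ N) (hs : 0 < s) (hs1 : s < 1) (C : ℝ) {φ : Euc N → 𝕜}
    (hφ : ContDiff ℝ ∞ φ) (hc : HasCompactSupport φ) :
    (∀ y, Tendsto (fun ε => C • truncFracLap s ε φ y) (𝓝[>] 0) (𝓝 (fracLap C s φ y))) ∧
      StronglyMeasurable (fracLap C s φ) ∧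
      (∀ ε, 0 < ε → StronglyMeasurable (truncFracLap s ε φ)) ∧
      ∃ B, ∀ ε, 0 < ε → ∀ y, ‖truncFracLap s ε φ y‖ ≤ B := by
  obtain ⟨M, hM0, hM, -, hM2⟩ := exists_bound_differences hφ hc
  have hi := integrable_min_mul_singKernel hN hs hs1
  have hT : ∀ ε, 0 < ε → ∀ y, truncFracLap s ε φ y = (1 / 2 : ℝ) •
      ∫ h, (Metric.ball (0 : Euc N) ε)ᶜ.indicator (singKernel s) h • secondDiff φ y h :=
    fun ε hε y => truncFracLap_eq_secondDiff hN hs hs1 hε hφ.continuous hM y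
  have hmeas : ∀ ε, Measurable ((Metric.ball (0 : Euc N) ε)ᶜ.indicator (singKernel s)) := fun ε =>
    (measurable_singKernel s).indicator Metric.isOpen_ball.measurableSet.compl
  have hbd : ∀ ε y h, ‖(Metric.ball (0 : Euc N) ε)ᶜ.indicator (singKernel s) h •
      secondDiff φ y h‖ ≤ M * (min 1 (‖h‖ ^ 2) * singKernel s h) := by
    intro ε y h
    have h0 := singKernel_nonneg s h
    rw [norm_smul]
    by_cases hh : h ∈ (Metric.ball (0 : Euc N) ε)ᶜ
    · rw [indicator_of_mem hh, Real.norm_of_nonneg h0]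
      calc singKernel s h * ‖secondDiff φ y h‖ ≤ singKernel s h * (M * min 1 (‖h‖ ^ 2)) := by
            gcongr; exact hM2 y h
        _ = _ := by ring
    · rw [indicator_of_notMem hh, norm_zero, zero_mul]
      positivity
  have hsd : ∀ y, Continuous (secondDiff φ y) := by
    intro y
    have := hφ.continuous
    unfold secondDiff
    fun_prop
  have hlim : ∀ y, Tendsto (fun ε => C • truncFracLap s ε φ y) (𝓝[>] 0)
      (𝓝 (C • (1 / 2 : ℝ) • ∫ h, singKernel s h • secondDiff φ y h)) := by
    intro y
    refine Tendsto.const_smul ?_ C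
    have h1 : Tendsto (fun ε => (1 / 2 : ℝ) •
        ∫ h, (Metric.ball (0 : Euc N) ε)ᶜ.indicator (singKernel s) h • secondDiff φ y h) (𝓝[>] 0)
        (𝓝 ((1 / 2 : ℝ) • ∫ h, singKernel s h • secondDiff φ y h)) := by
      refine Tendsto.const_smul ?_ _
      refine tendsto_integral_filter_of_dominated_convergence _ (Eventually.of_forall fun ε =>
        (hmeas ε).aestronglyMeasurable.smul (hsd y).aestronglyMeasurable)
        (Eventually.of_forall fun ε => Eventually.of_forall (hbd ε y)) (hi.const_mul M)
        (Eventually.of_forall fun h => ?_)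
      -- At `h = 0` the second difference vanishes; elsewhere the truncation is inactive once `ε <
      -- |h|`.
      by_cases hh : h = 0
      · subst hh
        simp [secondDiff]
      · refine tendsto_const_nhds.congr' ?_
        filter_upwards [Ioo_mem_nhdsGT (norm_pos_iff.2 hh)] with ε hε
        rw [indicator_of_mem]
        simpa using hε.2.le
    refine h1.congr' ?_
    filter_upwards [self_mem_nhdsWithin] with ε hε using (hT ε hε y).symm
  have hval : ∀ y, fracLap C s φ y = C • (1 / 2 : ℝ) • ∫ h, singKernel s h • secondDiff φ y h :=
    fun y => (hlim y).limUnder_eq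
  refine ⟨fun y => by rw [hval]; exact hlim y, ?_, fun ε hε => ?_,
    (1 / 2 : ℝ) * ∫ h : Euc N, M * (min 1 (‖h‖ ^ 2) * singKernel s h), fun ε hε y => ?_⟩
  · rw [funext hval]
    exact ((stronglyMeasurable_integral_secondDiff (measurable_singKernel s)
      hφ.continuous).const_smul (1 / 2 : ℝ)).const_smul C
  · rw [funext (hT ε hε)]
    exact (stronglyMeasurable_integral_secondDiff (hmeas ε) hφ.continuous).const_smul (1 / 2 : ℝ)
  · rw [hT ε hε, norm_smul, Real.norm_of_nonneg (by norm_num)]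
    gcongr
    exact norm_integral_le_of_norm_le (hi.const_mul M) (Eventually.of_forall (hbd ε y))

end

section

/-! ### Difference quotients and the fractional Laplacian -/

variable {N : ℕ} {s : ℝ} {𝕜 : Type*} [RCLike 𝕜]

theorem inv_rpow_mul_inv_rpow (hs : 0 < s) (h : Euc N) :
    (‖h‖ ^ ((N : ℝ) / 2 + s))⁻¹ * (‖h‖ ^ ((N : ℝ) / 2 + s))⁻¹ = singKernel s h := by
  have h0 : (0 : ℝ) ≤ (N : ℝ) / 2 + s := by positivity
  rw [singKernel, ← mul_inv, ← Real.rpow_add_of_nonneg (norm_nonneg h) h0 h0]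
  congr 2
  ring

theorem diffQuot_mul (hs : 0 < s) (w φ : Euc N → 𝕜) (p : Euc N × Euc N) :
    diffQuot s w p * diffQuot s φ p =
      singKernel s (p.1 - p.2) • ((w p.1 - w p.2) * (φ p.1 - φ p.2)) := by
  rw [diffQuot, diffQuot, smul_mul_smul_comm, inv_rpow_mul_inv_rpow hs]

theorem norm_diffQuot_sq (hs : 0 < s) (w : Euc N → 𝕜) (p : Euc N × Euc N) :
    ‖diffQuot s w p‖ ^ 2 = singKernel s (p.1 - p.2) * ‖w p.1 - w p.2‖ ^ 2 := by
  rw [sq, ← norm_mul, diffQuot_mul hs, norm_smul, norm_mul, Real.norm_of_nonneg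
    (singKernel_nonneg s _), sq]

theorem integrable_mul_sub {f κ : Euc N → ℝ} (hf : Integrable f) (hκ : Integrable κ) :
    Integrable (fun p : Euc N × Euc N => f p.2 * κ (p.1 - p.2)) (volume.prod volume) :=
  hf.convolution_integrand (ContinuousLinearMap.mul ℝ ℝ) hκ

theorem integrable_mul_sub_fst {f κ : Euc N → ℝ} (hf : Integrable f) (hκ : Integrable κ)
    (hn : ∀ h, κ (-h) = κ h) :
    Integrable (fun p : Euc N × Euc N => f p.1 * κ (p.1 - p.2)) (volume.prod volume) := by
  refine (integrable_mul_sub hf hκ).swap.congr (Eventually.of_forall fun p => ?_)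
  simp only [Function.comp_apply, Prod.fst_swap, Prod.snd_swap]
  rw [← hn, neg_sub]

/-- The quotient vanishes unless one of the two points lies in the support of `φ`. Its square is
thus dominated by the indicator of that compact set, in either variable, times an integrable
function of the difference. -/
theorem memLp_diffQuot (hN : 1 ≤ N) (hs : 0 < s) (hs1 : s < 1) {φ : Euc N → 𝕜}
    (hφ : ContDiff ℝ ∞ φ) (hc : HasCompactSupport φ) :
    MemLp (diffQuot s φ) 2 (volume.prod volume) := by
  obtain ⟨M, hM0, -, hM, -⟩ := exists_bound_differences hφ hc
  have hm := aestronglyMeasurable_diffQuot s (hφ.continuous.aestronglyMeasurable (μ := volume))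
  rw [memLp_two_iff_integrable_sq_norm hm]
  have hK : Integrable ((tsupport φ).indicator fun _ => M) :=
    (integrable_indicator_iff (isClosed_tsupport φ).measurableSet).2
      (integrableOn_const hc.isCompact.measure_lt_top.ne)
  have hi := integrable_min_mul_singKernel hN hs hs1
  have hn : ∀ h : Euc N, min 1 (‖-h‖ ^ 2) * singKernel s (-h) =
      min 1 (‖h‖ ^ 2) * singKernel s h := fun h => by rw [norm_neg, singKernel_neg]
  refine ((integrable_mul_sub hK hi).add (integrable_mul_sub_fst hK hi hn)).mono'
    (hm.norm.pow 2) (Eventually.of_forall fun p => ?_)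
  rw [Real.norm_of_nonneg (sq_nonneg _), norm_diffQuot_sq hs, Pi.add_apply]
  have h0 := singKernel_nonneg s (p.1 - p.2)
  have h1 : 0 ≤ min 1 (‖p.1 - p.2‖ ^ 2) * singKernel s (p.1 - p.2) := by positivity
  have hind : ∀ y, 0 ≤ (tsupport φ).indicator (fun _ => M) y := fun y =>
    indicator_nonneg (fun _ _ => hM0) y
  by_cases hp : p.1 ∉ tsupport φ ∧ p.2 ∉ tsupport φ
  · rw [image_eq_zero_of_notMem_tsupport hp.1, image_eq_zero_of_notMem_tsupport hp.2, sub_zero,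
      norm_zero]
    have := hind p.1
    have := hind p.2
    nlinarith
  · have h2 : M ≤ (tsupport φ).indicator (fun _ => M) p.2 +
        (tsupport φ).indicator (fun _ => M) p.1 := by
      by_cases h3 : p.1 ∈ tsupport φ
      · rw [indicator_of_mem h3]
        exact le_add_of_nonneg_left (hind _)
      · have h4 : p.2 ∈ tsupport φ := by
          by_contra h4
          exact hp ⟨h3, h4⟩
        rw [indicator_of_mem h4]
        exact le_add_of_nonneg_right (hind _)
    rw [← add_mul]
    calc singKernel s (p.1 - p.2) * ‖φ p.1 - φ p.2‖ ^ 2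
        ≤ singKernel s (p.1 - p.2) * (M * min 1 (‖p.1 - p.2‖ ^ 2)) := by
          gcongr; exact hM _ _
      _ = M * (min 1 (‖p.1 - p.2‖ ^ 2) * singKernel s (p.1 - p.2)) := by ring
      _ ≤ _ := mul_le_mul_of_nonneg_right h2 h1

/-- Away from the diagonal everything is absolutely integrable. Exchanging the two variables and
averaging replaces `w(y) (φ(y) - φ(ξ))` by half the product of the two differences. -/
theorem integral_mul_truncFracLap (hN : 1 ≤ N) (hs : 0 < s) (hs1 : s < 1) {ε : ℝ} (hε : 0 < ε)
    {w φ : Euc N → 𝕜} (hw : Integrable w) (hφ : ContDiff ℝ ∞ φ) (hc : HasCompactSupport φ) :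
    ∫ y, w y * truncFracLap s ε φ y = (1 / 2 : ℝ) • ∫ p,
      {p : Euc N × Euc N | ε ≤ ‖p.1 - p.2‖}.indicator
        (fun p => diffQuot s w p * diffQuot s φ p) p ∂(volume.prod volume) := by
  obtain ⟨M, hM0, hM, -, -⟩ := exists_bound_differences hφ hc
  set κ : Euc N → ℝ := (Metric.ball (0 : Euc N) ε)ᶜ.indicator (singKernel s) with hκ
  have hκi : Integrable κ := integrable_indicator_singKernel hN hs hs1 hε
  have hκm : Measurable κ :=
    (measurable_singKernel s).indicator Metric.isOpen_ball.measurableSet.compl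
  have hκn : ∀ h, κ (-h) = κ h := by
    intro h
    simp only [hκ, indicator, mem_compl_iff, Metric.mem_ball, dist_zero_right, norm_neg,
      singKernel_neg]
  have hκ0 : ∀ h, 0 ≤ κ h := fun h => indicator_nonneg (fun _ _ => singKernel_nonneg s _) h
  let F : Euc N × Euc N → 𝕜 := fun p => κ (p.1 - p.2) • (w p.1 * (φ p.1 - φ p.2))
  have hFi : Integrable F (volume.prod volume) := by
    refine ((integrable_mul_sub_fst hw.norm hκi hκn).const_mul (M + M)).mono' ?_
      (Eventually.of_forall fun p => ?_)
    · refine (hκm.comp (measurable_fst.sub measurable_snd)).aestronglyMeasurable.smul ?_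
      have := hφ.continuous
      exact hw.1.comp_fst.mul (by fun_prop)
    · simp only [F]
      rw [norm_smul, norm_mul, Real.norm_of_nonneg (hκ0 _)]
      have h1 : ‖φ p.1 - φ p.2‖ ≤ M + M := (norm_sub_le _ _).trans (add_le_add (hM _) (hM _))
      have h2 := hκ0 (p.1 - p.2)
      calc κ (p.1 - p.2) * (‖w p.1‖ * ‖φ p.1 - φ p.2‖) ≤ κ (p.1 - p.2) * (‖w p.1‖ * (M + M)) := by
            gcongr
        _ = _ := by ring
  have h1 : ∫ y, w y * truncFracLap s ε φ y = ∫ p, F p ∂(volume.prod volume) := by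
    rw [integral_prod F hFi]
    refine integral_congr_ae (Eventually.of_forall fun y => ?_)
    simp only [F]
    rw [truncFracLap_eq_integral, ← integral_const_mul]
    refine integral_congr_ae (Eventually.of_forall fun ξ => ?_)
    simp only [mul_smul_comm, hκ]
  have h2 : ∫ p, F p ∂(volume.prod volume) = ∫ p, F p.swap ∂(volume.prod volume) :=
    (integral_prod_swap F).symm
  have h3 : ∀ p, {p : Euc N × Euc N | ε ≤ ‖p.1 - p.2‖}.indicator
      (fun p => diffQuot s w p * diffQuot s φ p) p = F p + F p.swap := by
    intro p
    simp only [F, Prod.fst_swap, Prod.snd_swap]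
    rw [← hκn (p.2 - p.1), neg_sub, ← smul_add]
    have hiff : p.1 - p.2 ∈ (Metric.ball (0 : Euc N) ε)ᶜ ↔ ε ≤ ‖p.1 - p.2‖ := by
      simp
    by_cases h : ε ≤ ‖p.1 - p.2‖
    · rw [hκ, indicator_of_mem (hiff.2 h), indicator_of_mem (by exact h), diffQuot_mul hs]
      congr 1
      ring
    · rw [hκ, indicator_of_notMem (fun h' => h (hiff.1 h')), indicator_of_notMem (by exact h),
        zero_smul]
  have hFs : Integrable (fun p => F p.swap) (volume.prod volume) := hFi.swap
  rw [integral_congr_ae (Eventually.of_forall h3), integral_add hFi hFs, ← h2, ← h1,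
    ← two_smul ℝ, smul_smul]
  norm_num

/-- The fractional Laplacian of a test function is represented by the Gagliardo form. -/
theorem integral_mul_fracLap (hN : 1 ≤ N) (hs : 0 < s) (hs1 : s < 1) (C : ℝ) {w φ : Euc N → 𝕜}
    (hw : Integrable w) (hw2 : MemLp (diffQuot s w) 2 (volume.prod volume))
    (hφ : ContDiff ℝ ∞ φ) (hc : HasCompactSupport φ) :
    Integrable (fun y => w y * fracLap C s φ y) ∧ ∫ y, w y * fracLap C s φ y =
      (C / 2) • ∫ p, diffQuot s w p * diffQuot s φ p ∂(volume.prod volume) := by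
  obtain ⟨hlim, hm, hmT, B, hB⟩ := fracLap_spec hN hs hs1 C hφ hc
  have hpos : ∀ n : ℕ, (0 : ℝ) < 1 / ((n : ℝ) + 1) := fun n => by positivity
  have hε : Tendsto (fun n : ℕ => 1 / ((n : ℝ) + 1)) atTop (𝓝[>] 0) :=
    tendsto_nhdsWithin_iff.2 ⟨tendsto_one_div_add_atTop_nhds_zero_nat,
      Eventually.of_forall fun n => hpos n⟩
  have hB0 : ∀ y, ‖fracLap C s φ y‖ ≤ ‖C‖ * B := by
    intro y
    refine le_of_tendsto ((hlim y).comp hε).norm (Eventually.of_forall fun n => ?_)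
    simp only [Function.comp_apply]
    rw [norm_smul]
    gcongr
    exact hB _ (hpos n) y
  have hint : Integrable fun y => w y * fracLap C s φ y :=
    hw.mul_bdd (c := ‖C‖ * B) hm.aestronglyMeasurable (Eventually.of_forall hB0)
  refine ⟨hint, ?_⟩
  have l1 : Tendsto (fun n : ℕ => ∫ y, w y * (C • truncFracLap s (1 / ((n : ℝ) + 1)) φ y)) atTop
      (𝓝 (∫ y, w y * fracLap C s φ y)) := by
    refine tendsto_integral_of_dominated_convergence (fun y => ‖w y‖ * (‖C‖ * B))
      (fun n => hw.1.mul ((hmT _ (hpos n)).const_smul C).aestronglyMeasurable)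
      (hw.norm.mul_const _) (fun n => Eventually.of_forall fun y => ?_)
      (Eventually.of_forall fun y => ((hlim y).comp hε).const_mul (w y))
    rw [norm_mul, norm_smul]
    gcongr
    exact hB _ (hpos n) y
  have hφ2 := memLp_diffQuot hN hs hs1 hφ hc
  have hprod : Integrable (fun p => diffQuot s w p * diffQuot s φ p)
      (volume.prod volume : Measure (Euc N × Euc N)) := hw2.integrable_mul hφ2
  have hset : ∀ ε : ℝ, MeasurableSet {p : Euc N × Euc N | ε ≤ ‖p.1 - p.2‖} := fun ε =>
    measurableSet_le measurable_const (by fun_prop)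
  have l2 : Tendsto (fun n : ℕ => ∫ p, {p : Euc N × Euc N | 1 / ((n : ℝ) + 1) ≤
      ‖p.1 - p.2‖}.indicator (fun p => diffQuot s w p * diffQuot s φ p) p
        ∂(volume.prod volume)) atTop
      (𝓝 (∫ p, diffQuot s w p * diffQuot s φ p ∂(volume.prod volume))) := by
    refine tendsto_integral_of_dominated_convergence
      (fun p => ‖diffQuot s w p * diffQuot s φ p‖)
      (fun n => hprod.1.indicator (hset _)) hprod.norm
      (fun n => Eventually.of_forall fun p => norm_indicator_le_norm_self _ p)
      (Eventually.of_forall fun p => ?_)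
    -- On the diagonal, which every truncation removes, the product of difference quotients is zero.
    by_cases hp : p.1 - p.2 = 0
    · have h0 : diffQuot s w p * diffQuot s φ p = 0 := by
        rw [diffQuot_mul hs, sub_eq_zero.1 hp]
        simp
      rw [h0]
      refine tendsto_const_nhds.congr fun n => ?_
      rw [indicator_apply, h0, ite_self]
    · refine tendsto_const_nhds.congr' ?_
      filter_upwards [hε.eventually (Ioo_mem_nhdsGT (norm_pos_iff.2 hp))] with n hn
      rw [indicator_of_mem]
      exact hn.2.le
  have l3 := (l2.const_smul (1 / 2 : ℝ)).const_smul C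
  rw [smul_smul, mul_one_div] at l3
  refine tendsto_nhds_unique l1 (l3.congr fun n => ?_)
  simp only [mul_smul_comm]
  rw [integral_smul, integral_mul_truncFracLap hN hs hs1 (hpos n) hw hφ hc]

end

section

/-! ### Approximation by averages -/

variable {N : ℕ} {s : ℝ} {𝕜 : Type*} [RCLike 𝕜]

/-- The kernel of the average over balls of radius `ε`. -/
def ballKernel (N : ℕ) (ε : ℝ) : Euc N → ℝ :=
  (Metric.ball (0 : Euc N) ε).indicator fun _ => (volume.real (Metric.ball (0 : Euc N) ε))⁻¹

theorem measurable_ballKernel (N : ℕ) (ε : ℝ) : Measurable (ballKernel N ε) :=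
  measurable_const.indicator Metric.isOpen_ball.measurableSet

theorem norm_ballKernel_le (N : ℕ) (ε : ℝ) (h : Euc N) :
    ‖ballKernel N ε h‖ ≤ (volume.real (Metric.ball (0 : Euc N) ε))⁻¹ :=
  (norm_indicator_le_norm_self _ _).trans
    (Real.norm_of_nonneg (inv_nonneg.2 measureReal_nonneg)).le

theorem integrable_ballKernel (N : ℕ) (ε : ℝ) : Integrable (ballKernel N ε) :=
  (integrable_indicator_iff Metric.isOpen_ball.measurableSet).2
    (integrableOn_const measure_ball_lt_top.ne)

theorem measureReal_ball_pos {ε : ℝ} (hε : 0 < ε) :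
    0 < volume.real (Metric.ball (0 : Euc N) ε) :=
  ENNReal.toReal_pos (Metric.measure_ball_pos volume _ hε).ne' measure_ball_lt_top.ne

theorem integral_ballKernel {ε : ℝ} (hε : 0 < ε) : ∫ h, ballKernel N ε h = 1 := by
  rw [ballKernel, integral_indicator Metric.isOpen_ball.measurableSet, setIntegral_const,
    smul_eq_mul, mul_inv_cancel₀ (measureReal_ball_pos hε).ne']

theorem sub_eq_rpow_smul_diffQuot (w : Euc N → 𝕜) (y ξ : Euc N) :
    w y - w ξ = (‖y - ξ‖ ^ ((N : ℝ) / 2 + s)) • diffQuot s w (y, ξ) := by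
  rw [diffQuot, smul_smul]
  rcases eq_or_ne y ξ with rfl | h
  · simp
  · rw [mul_inv_cancel₀, one_smul]
    exact (Real.rpow_pos_of_pos (norm_pos_iff.2 (sub_ne_zero.2 h)) _).ne'

/-- On the ball the integrand is at most `|B_ε|⁻² ε^(N+2s)`; multiplying by `|B_ε| = ε^N |B_1|`
leaves `ε^(2s) / |B_1|`. -/
theorem lintegral_enorm_ballKernel_mul_sq_le (hN : 1 ≤ N) (hs : 0 < s) {ε : ℝ} (hε : 0 < ε)
    (y : Euc N) : ∫⁻ ξ, ‖ballKernel N ε (y - ξ) * ‖y - ξ‖ ^ ((N : ℝ) / 2 + s)‖ₑ ^ 2 ≤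
      ENNReal.ofReal (ε ^ (2 * s) / volume.real (Metric.ball (0 : Euc N) 1)) := by
  have : Nontrivial (Euc N) := by
    have : Nonempty (Fin N) := ⟨⟨0, hN⟩⟩
    infer_instance
  set V := volume.real (Metric.ball (0 : Euc N) ε) with hV
  have hV0 : 0 < V := measureReal_ball_pos hε
  have hVe : V = ε ^ (N : ℝ) * volume.real (Metric.ball (0 : Euc N) 1) := by
    rw [hV, measureReal_def, Measure.addHaar_ball _ _ hε.le, ENNReal.toReal_mul,
      ENNReal.toReal_ofReal (by positivity), finrank_euclideanSpace_fin, measureReal_def,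
      Real.rpow_natCast]
  have h1 : ∀ ξ, ‖ballKernel N ε (y - ξ) * ‖y - ξ‖ ^ ((N : ℝ) / 2 + s)‖ₑ ^ 2 ≤
      (Metric.ball y ε).indicator
        (fun _ => ENNReal.ofReal ((V⁻¹ * ε ^ ((N : ℝ) / 2 + s)) ^ 2)) ξ := by
    intro ξ
    by_cases h : ξ ∈ Metric.ball y ε
    · have h' : ‖y - ξ‖ < ε := by rwa [← dist_eq_norm, dist_comm]
      rw [indicator_of_mem h, ballKernel, indicator_of_mem (by simpa using h'), ← hV,
        Real.enorm_of_nonneg (by positivity), ← ENNReal.ofReal_pow (by positivity)]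
      gcongr
    · have h' : y - ξ ∉ Metric.ball (0 : Euc N) ε := by
        rwa [mem_ball_zero_iff, ← dist_eq_norm, dist_comm]
      rw [ballKernel, indicator_of_notMem h', zero_mul]
      simp
  refine (lintegral_mono h1).trans ?_
  rw [lintegral_indicator Metric.isOpen_ball.measurableSet, setLIntegral_const,
    Measure.addHaar_ball_center, ← ENNReal.ofReal_toReal (measure_ball_lt_top
      (μ := volume) (x := (0 : Euc N)) (r := ε)).ne, ← measureReal_def, ← hV,
    ← ENNReal.ofReal_mul (by positivity)]
  refine ENNReal.ofReal_le_ofReal (le_of_eq ?_)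
  have h2 : (ε ^ ((N : ℝ) / 2 + s)) ^ 2 = ε ^ (N : ℝ) * ε ^ (2 * s) := by
    rw [← Real.rpow_natCast, ← Real.rpow_mul hε.le, ← Real.rpow_add hε]
    congr 1
    push_cast
    ring
  have h3 : (0 : ℝ) < volume.real (Metric.ball (0 : Euc N) 1) := measureReal_ball_pos one_pos
  have h4 : (0 : ℝ) < ε ^ (N : ℝ) := Real.rpow_pos_of_pos hε _
  rw [mul_pow, h2, hVe]
  field_simp

/-- A function of finite Gagliardo seminorm is close to its averages over small balls. -/
theorem lintegral_sub_average_sq_le (hN : 1 ≤ N) (hs : 0 < s) {ε : ℝ} (hε : 0 < ε)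
    {w : Euc N → 𝕜} (hw : Integrable w) :
    ∫⁻ y, ‖w y - ∫ ξ, ballKernel N ε (y - ξ) • w ξ‖ₑ ^ 2 ≤
      ENNReal.ofReal (ε ^ (2 * s) / volume.real (Metric.ball (0 : Euc N) 1)) *
        ∫⁻ p, ‖diffQuot s w p‖ₑ ^ 2 ∂(volume.prod volume) := by
  have hm := aestronglyMeasurable_diffQuot s hw.1
  rw [lintegral_prod _ (hm.enorm.pow_const 2), ← lintegral_const_mul'' _
    (hm.enorm.pow_const 2).lintegral_prod_right']
  refine lintegral_mono_ae ?_
  filter_upwards [hm.prodMk_left] with y hy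
  have hκ : Integrable fun ξ => ballKernel N ε (y - ξ) :=
    (integrable_ballKernel N ε).comp_sub_left y
  have hκm : Measurable fun ξ => ballKernel N ε (y - ξ) :=
    (measurable_ballKernel N ε).comp (measurable_const.sub measurable_id)
  have hκw : Integrable fun ξ => ballKernel N ε (y - ξ) • w ξ :=
    hw.bdd_smul _ hκm.aestronglyMeasurable (Eventually.of_forall fun ξ => norm_ballKernel_le N ε _)
  -- The averaging kernel has integral one, so the error is the average of `w y - w ξ`, which
  -- Cauchy-Schwarz bounds by the `L²` norm of the difference quotient in `ξ`.
  have h1 : w y - ∫ ξ, ballKernel N ε (y - ξ) • w ξ =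
      ∫ ξ, (ballKernel N ε (y - ξ) * ‖y - ξ‖ ^ ((N : ℝ) / 2 + s)) • diffQuot s w (y, ξ) := by
    have h2 : w y = ∫ ξ, ballKernel N ε (y - ξ) • w y := by
      rw [integral_smul_const, integral_sub_left_eq_self (ballKernel N ε) volume y,
        integral_ballKernel hε, one_smul]
    conv_lhs => rw [h2]
    rw [← integral_sub (hκ.smul_const _) hκw]
    refine integral_congr_ae (Eventually.of_forall fun ξ => ?_)
    simp only
    rw [← smul_sub, mul_smul, ← sub_eq_rpow_smul_diffQuot]
  rw [h1]
  have h3 := enorm_integral_smul_le (μ := volume)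
    (k := fun ξ => ballKernel N ε (y - ξ) * ‖y - ξ‖ ^ ((N : ℝ) / 2 + s))
    (hκm.mul (by fun_prop)).aestronglyMeasurable hy
  refine (pow_le_pow_left' h3 2).trans ?_
  rw [mul_pow, eLpNorm_two_sq, eLpNorm_two_sq]
  gcongr
  exact lintegral_enorm_ballKernel_mul_sq_le hN hs hε y

end

section

/-! ### The form of the fractional Dirichlet Laplacian -/

variable {N : ℕ} {s C : ℝ} {𝕜 : Type*} [RCLike 𝕜] {Ω : Set (Euc N)}

theorem diffQuot_add (s : ℝ) (w₁ w₂ : Euc N → 𝕜) :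
    diffQuot s (w₁ + w₂) = diffQuot s w₁ + diffQuot s w₂ := by
  funext p
  simp only [diffQuot, Pi.add_apply, ← smul_add]
  congr 1; ring

theorem diffQuot_sub (s : ℝ) (w₁ w₂ : Euc N → 𝕜) :
    diffQuot s (w₁ - w₂) = diffQuot s w₁ - diffQuot s w₂ := by
  funext p
  simp only [diffQuot, Pi.sub_apply, ← smul_sub]
  congr 1; ring

theorem diffQuot_const_smul (s : ℝ) (c : 𝕜) (w : Euc N → 𝕜) :
    diffQuot s (c • w) = c • diffQuot s w := by
  funext p
  simp only [diffQuot, Pi.smul_apply, ← smul_sub]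
  rw [smul_comm]

/-- The test functions on `Ω` together with their normalized difference quotients. -/
def formSpace (𝕜 : Type*) [RCLike 𝕜] (C s : ℝ) (Ω : Set (Euc N)) :
    Submodule 𝕜 (WithLp 2 (Lp 𝕜 2 (volume.restrict Ω) ×
      Lp 𝕜 2 ((volume : Measure (Euc N)).prod (volume : Measure (Euc N))))) where
  carrier := {w | ∃ φ : Euc N → 𝕜, IsTestFunction Ω φ ∧ w.fst =ᵐ[volume.restrict Ω] φ ∧
    w.snd =ᵐ[(volume : Measure (Euc N)).prod (volume : Measure (Euc N))]
      Real.sqrt (C / 2) • diffQuot s φ}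
  zero_mem' := by
    refine ⟨0, IsTestFunction.zero Ω, Lp.coeFn_zero 𝕜 2 _, ?_⟩
    refine (Lp.coeFn_zero 𝕜 2 _).trans (Eventually.of_forall fun p => ?_)
    simp [diffQuot]
  add_mem' := by
    rintro w w' ⟨φ, hφ, h1, h2⟩ ⟨φ', hφ', h1', h2'⟩
    refine ⟨φ + φ', hφ.add hφ', (Lp.coeFn_add _ _).trans (h1.add h1'),
      (Lp.coeFn_add _ _).trans ((h2.add h2').trans ?_)⟩
    rw [diffQuot_add, smul_add]
  smul_mem' := by
    rintro c w ⟨φ, hφ, h1, h2⟩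
    refine ⟨c • φ, hφ.smul c, (Lp.coeFn_smul c _).trans (h1.const_smul c),
      (Lp.coeFn_smul c _).trans ((h2.const_smul c).trans ?_)⟩
    rw [diffQuot_const_smul, smul_comm]

theorem mem_formSpace {w : WithLp 2 (Lp 𝕜 2 (volume.restrict Ω) ×
      Lp 𝕜 2 ((volume : Measure (Euc N)).prod (volume : Measure (Euc N))))} :
    w ∈ formSpace 𝕜 C s Ω ↔ ∃ φ : Euc N → 𝕜, IsTestFunction Ω φ ∧
      w.fst =ᵐ[volume.restrict Ω] φ ∧
      w.snd =ᵐ[(volume : Measure (Euc N)).prod (volume : Measure (Euc N))]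
        Real.sqrt (C / 2) • diffQuot s φ := Iff.rfl

theorem IsTestFunction.memLp_diffQuot (hN : 1 ≤ N) (hs : 0 < s) (hs1 : s < 1) {φ : Euc N → 𝕜}
    (hφ : IsTestFunction Ω φ) : MemLp (diffQuot s φ) 2 (volume.prod volume) :=
  FracCyl.memLp_diffQuot hN hs hs1 hφ.1 hφ.2.1

theorem IsTestFunction.toLp_mem_formSpace (C : ℝ) (hN : 1 ≤ N) (hs : 0 < s) (hs1 : s < 1)
    {φ : Euc N → 𝕜} (hφ : IsTestFunction Ω φ) :
    WithLp.toLp 2 (hφ.memLp.toLp φ,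
      ((IsTestFunction.memLp_diffQuot hN hs hs1 hφ).const_smul (Real.sqrt (C / 2))).toLp
        (Real.sqrt (C / 2) • diffQuot s φ)) ∈ formSpace 𝕜 C s Ω :=
  ⟨φ, hφ, hφ.memLp.coeFn_toLp, MemLp.coeFn_toLp
    ((IsTestFunction.memLp_diffQuot hN hs hs1 hφ).const_smul (Real.sqrt (C / 2)))⟩

theorem IsTestFunction.indicator_eq {φ : Euc N → 𝕜} (hφ : IsTestFunction Ω φ) :
    Ω.indicator φ = φ :=
  indicator_eq_self.2 ((subset_tsupport φ).trans hφ.2.2)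

theorem IsTestFunction.eLpNorm_indicator_sub (hΩ : IsOpen Ω) {φ u : Euc N → 𝕜}
    (hφ : IsTestFunction Ω φ) :
    eLpNorm (Ω.indicator u - φ) 2 volume = eLpNorm (u - φ) 2 (volume.restrict Ω) := by
  have h1 : Ω.indicator u - φ = Ω.indicator (u - φ) := by
    rw [indicator_sub', IsTestFunction.indicator_eq hφ]
  rw [h1, eLpNorm_indicator_eq_eLpNorm_restrict hΩ.measurableSet]

theorem eLpNorm_real_smul {X : Type*} [MeasurableSpace X] {μ : Measure X} (c : ℝ) (f : X → 𝕜) :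
    eLpNorm (c • f) 2 μ = ‖c‖ₑ * eLpNorm f 2 μ :=
  eLpNorm_const_smul c f 2 μ

theorem MemHs0.memLp_diffQuot (hN : 1 ≤ N) (hs : 0 < s) (hs1 : s < 1) {w : Euc N → 𝕜}
    (h : MemHs0 s Ω w) : MemLp (diffQuot s w) 2 (volume.prod volume) := by
  obtain ⟨hm, φ, hφ, -, h2⟩ := h
  obtain ⟨n, hn⟩ := (h2.eventually (gt_mem_nhds ENNReal.zero_lt_top)).exists
  have h3 : MemLp (diffQuot s (w - φ n)) 2 (volume.prod volume) :=
    ⟨aestronglyMeasurable_diffQuot s (hm.sub (hφ n).1.continuous.aestronglyMeasurable), hn⟩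
  have h4 := h3.add (IsTestFunction.memLp_diffQuot hN hs hs1 (hφ n))
  rwa [← diffQuot_add, sub_add_cancel] at h4

theorem MemHs0.toLp_mem_closure (C : ℝ) (hN : 1 ≤ N) (hs : 0 < s) (hs1 : s < 1) (hΩ : IsOpen Ω)
    {u : Euc N → 𝕜} (hu : MemLp u 2 (volume.restrict Ω)) (h : MemHs0 s Ω (Ω.indicator u)) :
    ∃ v, WithLp.toLp 2 (hu.toLp u, v) ∈ (formSpace 𝕜 C s Ω).topologicalClosure := by
  have hD := MemHs0.memLp_diffQuot hN hs hs1 h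
  obtain ⟨-, φ, hφ, h1, h2⟩ := h
  refine ⟨(hD.const_smul (Real.sqrt (C / 2))).toLp _, ?_⟩
  have l1 : Tendsto (fun n => (hφ n).memLp.toLp (φ n)) atTop (𝓝 (hu.toLp u)) := by
    rw [Lp.tendsto_Lp_iff_tendsto_eLpNorm'' _ (fun n => (hφ n).memLp)]
    refine h1.congr fun n => ?_
    rw [IsTestFunction.eLpNorm_indicator_sub hΩ (hφ n), eLpNorm_sub_comm]
  have l2 : Tendsto (fun n => ((IsTestFunction.memLp_diffQuot hN hs hs1 (hφ n)).const_smul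
      (Real.sqrt (C / 2))).toLp (Real.sqrt (C / 2) • diffQuot s (φ n))) atTop
      (𝓝 ((hD.const_smul (Real.sqrt (C / 2))).toLp _)) := by
    rw [Lp.tendsto_Lp_iff_tendsto_eLpNorm'' _
      (fun n => (IsTestFunction.memLp_diffQuot hN hs hs1 (hφ n)).const_smul (Real.sqrt (C / 2)))]
    have h3 := ENNReal.Tendsto.const_mul h2 (a := ‖Real.sqrt (C / 2)‖ₑ) (Or.inr enorm_ne_top)
    rw [mul_zero] at h3
    refine h3.congr fun n => ?_
    rw [← eLpNorm_real_smul, diffQuot_sub, smul_sub, eLpNorm_sub_comm]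
  have l3 := ((WithLp.prod_continuous_toLp 2 _ _).tendsto _).comp (l1.prodMk_nhds l2)
  exact mem_closure_of_tendsto l3 (Eventually.of_forall fun n =>
    IsTestFunction.toLp_mem_formSpace C hN hs hs1 (hφ n))

/-- Closability of the Gagliardo form: if test functions converge in `L²` and their quotients
converge to `v`, almost everywhere convergence along a subsequence identifies `v` with the quotient
of the limit. -/
theorem memHs0_of_toLp_mem_closure (hC : 0 < C)
    (hΩ : IsOpen Ω) {u : Euc N → 𝕜} (hu : MemLp u 2 (volume.restrict Ω))
    {v : Lp 𝕜 2 ((volume : Measure (Euc N)).prod (volume : Measure (Euc N)))}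
    (h : WithLp.toLp 2 (hu.toLp u, v) ∈ (formSpace 𝕜 C s Ω).topologicalClosure) :
    MemHs0 s Ω (Ω.indicator u) ∧ v =ᵐ[(volume : Measure (Euc N)).prod (volume : Measure (Euc N))]
      Real.sqrt (C / 2) • diffQuot s (Ω.indicator u) := by
  have hc : 0 < Real.sqrt (C / 2) := Real.sqrt_pos.2 (by positivity)
  have h' : WithLp.toLp 2 (hu.toLp u, v) ∈ closure (formSpace 𝕜 C s Ω : Set _) := by
    rwa [← Submodule.topologicalClosure_coe]
  obtain ⟨w, hw, hlim⟩ := mem_closure_iff_seq_limit.1 h'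
  choose φ hφ h1 h2 using fun n => mem_formSpace.1 (hw n)
  have hum : AEStronglyMeasurable (Ω.indicator u) volume :=
    (aestronglyMeasurable_indicator_iff hΩ.measurableSet).2 hu.1
  have l1 : Tendsto (fun n => eLpNorm (Ω.indicator u - φ n) 2 volume) atTop (𝓝 0) := by
    have h3 := ((WithLp.fstL 2 𝕜 _ _).continuous.tendsto _).comp hlim
    have h4 := (Lp.tendsto_Lp_iff_tendsto_eLpNorm _ u hu).1 h3
    refine h4.congr fun n => ?_
    rw [IsTestFunction.eLpNorm_indicator_sub hΩ (hφ n), eLpNorm_sub_comm]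
    exact eLpNorm_congr_ae (ae_eq_rfl.sub (h1 n))
  have l2 : Tendsto (fun n => eLpNorm (Real.sqrt (C / 2) • diffQuot s (φ n) - (v : _ → 𝕜)) 2
      (volume.prod volume)) atTop (𝓝 0) := by
    have h3 := ((WithLp.sndL 2 𝕜 _ _).continuous.tendsto _).comp hlim
    have h4 := (Lp.tendsto_Lp_iff_tendsto_eLpNorm' _ _).1 h3
    refine h4.congr fun n => eLpNorm_congr_ae ((h2 n).sub ae_eq_rfl)
  have hφm : ∀ n, AEStronglyMeasurable (φ n) (volume : Measure (Euc N)) := fun n =>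
    (hφ n).1.continuous.aestronglyMeasurable
  have hv : v =ᵐ[(volume : Measure (Euc N)).prod (volume : Measure (Euc N))]
      Real.sqrt (C / 2) • diffQuot s (Ω.indicator u) := by
    obtain ⟨n₁, hn₁, a₁⟩ := (tendstoInMeasure_of_tendsto_eLpNorm two_ne_zero hφm hum
      (l1.congr fun n => eLpNorm_sub_comm _ _ _ _)).exists_seq_tendsto_ae
    obtain ⟨n₂, hn₂, a₂⟩ := (tendstoInMeasure_of_tendsto_eLpNorm two_ne_zero
      (fun n => (aestronglyMeasurable_diffQuot s (hφm (n₁ n))).const_smul (Real.sqrt (C / 2)))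
      (Lp.aestronglyMeasurable v) (l2.comp hn₁.tendsto_atTop)).exists_seq_tendsto_ae
    -- Convergence at almost every point is pulled back along both projections, since the quotient
    -- at `p` involves both coordinates.
    filter_upwards [a₂, Measure.quasiMeasurePreserving_fst.ae a₁,
      Measure.quasiMeasurePreserving_snd.ae a₁] with p hp hp1 hp2
    refine tendsto_nhds_unique hp ?_
    have h5 := (hp1.sub hp2).comp hn₂.tendsto_atTop
    exact (h5.const_smul (‖p.1 - p.2‖ ^ ((N : ℝ) / 2 + s))⁻¹).const_smul (Real.sqrt (C / 2))
  refine ⟨⟨hum, φ, hφ, l1, ?_⟩, hv⟩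
  have h3 := ENNReal.Tendsto.const_mul l2 (a := ‖(Real.sqrt (C / 2))⁻¹‖ₑ) (Or.inr enorm_ne_top)
  rw [mul_zero] at h3
  refine h3.congr fun n => ?_
  rw [eLpNorm_sub_comm, ← eLpNorm_real_smul]
  refine eLpNorm_congr_ae ?_
  filter_upwards [hv] with p hp
  rw [Pi.smul_apply, Pi.sub_apply, hp, diffQuot_sub, Pi.smul_apply, Pi.smul_apply, Pi.sub_apply,
    ← smul_sub, inv_smul_smul₀ hc.ne']

theorem IsTestFunction.conj {φ : Euc N → 𝕜} (hφ : IsTestFunction Ω φ) :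
    IsTestFunction Ω fun y => starRingEnd 𝕜 (φ y) := by
  refine ⟨(RCLike.conjCLE (K := 𝕜)).contDiff.comp hφ.1,
    hφ.2.1.comp_left (g := starRingEnd 𝕜) (map_zero _), ?_⟩
  exact (closure_mono (Function.support_comp_subset (g := starRingEnd 𝕜) (map_zero _) φ)).trans
    hφ.2.2

theorem diffQuot_conj (s : ℝ) (φ : Euc N → 𝕜) (p : Euc N × Euc N) :
    diffQuot s (fun y => starRingEnd 𝕜 (φ y)) p = starRingEnd 𝕜 (diffQuot s φ p) := by
  simp only [diffQuot, RCLike.real_smul_eq_coe_mul, map_mul, map_sub, RCLike.conj_ofReal]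

/-- The fractional Dirichlet Laplacian is given by its form. -/
theorem isFracDirichletLap_iff (hC : 0 < C) (hN : 1 ≤ N) (hs : 0 < s) (hs1 : s < 1)
    (hΩ : IsOpen Ω) (hΩb : Bornology.IsBounded Ω) {u f : Euc N → 𝕜}
    (hu : MemLp u 2 (volume.restrict Ω)) (hf : MemLp f 2 (volume.restrict Ω)) :
    IsFracDirichletLap C s Ω u f ↔ hu.toLp u =
      formResolvent (formSpace 𝕜 C s Ω) (hf.toLp f + ((1 : ℝ) : 𝕜) • hu.toLp u) := by
  rw [RCLike.ofReal_one, one_smul, eq_formResolvent_iff]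
  have : IsFiniteMeasure (volume.restrict Ω) :=
    ⟨by rw [Measure.restrict_apply_univ]; exact hΩb.measure_lt_top⟩
  have hui : Integrable (Ω.indicator u) :=
    (integrable_indicator_iff hΩ.measurableSet).2 (hu.integrable (by norm_num))
  -- The weight `√(C / 2)` on each quotient in `formSpace` yields the factor `C / 2` of
  -- `integral_mul_fracLap`.
  have hsq : ((C / 2 : ℝ) : 𝕜) = (Real.sqrt (C / 2) : 𝕜) * (Real.sqrt (C / 2) : 𝕜) := by
    rw [← RCLike.ofReal_mul, Real.mul_self_sqrt (by positivity)]
  -- For one test function, the variational identity and the weak equation coincide. The weak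
  -- equation is bilinear and the inner product conjugates its first argument, so `φ` is paired with
  -- the form vector of its conjugate.
  have key : ∀ v : Lp 𝕜 2 ((volume : Measure (Euc N)).prod (volume : Measure (Euc N))),
      WithLp.toLp 2 (hu.toLp u, v) ∈ (formSpace 𝕜 C s Ω).topologicalClosure →
      ∀ φ : Euc N → 𝕜, IsTestFunction Ω φ → ∀ w ∈ formSpace 𝕜 C s Ω,
      w.fst =ᵐ[volume.restrict Ω] (fun y => starRingEnd 𝕜 (φ y)) →
      w.snd =ᵐ[(volume : Measure (Euc N)).prod (volume : Measure (Euc N))]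
        Real.sqrt (C / 2) • diffQuot s (fun y => starRingEnd 𝕜 (φ y)) →
      Integrable (fun y => Ω.indicator u y * fracLap C s φ y) ∧
      (inner 𝕜 w (WithLp.toLp 2 (hu.toLp u, v)) = inner 𝕜 w.fst (hf.toLp f + hu.toLp u) ↔
        ∫ y, Ω.indicator u y * fracLap C s φ y = ∫ y in Ω, f y * φ y) := by
    intro v hv φ hφ w hw h1 h2
    obtain ⟨hu0, hvu⟩ := memHs0_of_toLp_mem_closure hC hΩ hu hv
    obtain ⟨hi, he⟩ := integral_mul_fracLap hN hs hs1 C hui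
      (MemHs0.memLp_diffQuot hN hs hs1 hu0) hφ.1 hφ.2.1
    refine ⟨hi, ?_⟩
    have e1 : inner 𝕜 w.fst (hf.toLp f) = ∫ y in Ω, f y * φ y := by
      rw [inner_Lp_toLp _ hf]
      refine integral_congr_ae ?_
      filter_upwards [h1] with y hy
      rw [hy, RCLike.inner_apply, RCLike.conj_conj]
    have e2 : inner 𝕜 w.snd v = ∫ y, Ω.indicator u y * fracLap C s φ y := by
      rw [he, L2.inner_def, ← integral_smul]
      refine integral_congr_ae ?_
      filter_upwards [h2, hvu] with p hp hp'
      rw [hp, hp', Pi.smul_apply, Pi.smul_apply, RCLike.inner_apply, diffQuot_conj,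
        RCLike.real_smul_eq_coe_mul, RCLike.real_smul_eq_coe_mul, RCLike.real_smul_eq_coe_mul,
        map_mul, RCLike.conj_conj, RCLike.conj_ofReal, hsq]
      ring
    -- The term `⟨w.fst, u⟩`, due to the shift by one, occurs on both sides and cancels.
    rw [WithLp.prod_inner_apply, inner_add_right, ← e1, ← e2, add_comm]
    exact add_left_inj _
  constructor
  · rintro ⟨hu0, -, h⟩
    obtain ⟨v, hv⟩ := MemHs0.toLp_mem_closure C hN hs hs1 hΩ hu hu0
    refine ⟨v, hv, fun w hw => ?_⟩
    obtain ⟨φ, hφ, h1, h2⟩ := mem_formSpace.1 hw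
    have h3 : (fun y => starRingEnd 𝕜 (starRingEnd 𝕜 (φ y))) = φ := by
      funext y; exact RCLike.conj_conj _
    refine (key v hv _ (IsTestFunction.conj hφ) w hw ?_ ?_).2.2 (h _ (IsTestFunction.conj hφ)).2
    · rw [h3]; exact h1
    · rw [h3]; exact h2
  · rintro ⟨v, hv, h⟩
    refine ⟨(memHs0_of_toLp_mem_closure hC hΩ hu hv).1, hf, fun φ hφ => ?_⟩
    have hw := IsTestFunction.toLp_mem_formSpace C hN hs hs1 (IsTestFunction.conj hφ)
    have h3 := key v hv φ hφ _ hw (IsTestFunction.conj hφ).memLp.coeFn_toLp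
      (MemLp.coeFn_toLp ((IsTestFunction.memLp_diffQuot hN hs hs1 (IsTestFunction.conj hφ)).const_smul _))
    exact ⟨h3.1, h3.2.1 (h _ hw)⟩

end

section

variable {N : ℕ} {s C : ℝ} {𝕜 : Type*} [RCLike 𝕜] {Ω : Set (Euc N)}

/-! ### Compactness and injectivity of the resolvent -/

theorem memLp_ballKernel (N : ℕ) (ε : ℝ) (μ : Measure (Euc N)) [IsFiniteMeasure μ] :
    MemLp (fun p : Euc N × Euc N => ballKernel N ε (p.1 - p.2)) 2 (μ.prod μ) :=
  MemLp.of_bound ((measurable_ballKernel N ε).comp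
    (measurable_fst.sub measurable_snd)).aestronglyMeasurable _
    (Eventually.of_forall fun _ => norm_ballKernel_le N ε _)

/-- Averages over balls are Hilbert-Schmidt on `L²(Ω)` because `Ω` has finite measure and the
averaging kernel is bounded, and they approximate the embedding at rate `ε^s`. -/
theorem isCompactOperator_formResolvent_formSpace (hC : 0 < C) (hN : 1 ≤ N) (hs : 0 < s)
    (hΩb : Bornology.IsBounded Ω) :
    IsCompactOperator (formResolvent (formSpace 𝕜 C s Ω)) := by
  have : IsFiniteMeasure (volume.restrict Ω) :=
    ⟨by rw [Measure.restrict_apply_univ]; exact hΩb.measure_lt_top⟩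
  let ε : ℕ → ℝ := fun n => 1 / ((n : ℝ) + 1)
  have hε : ∀ n, 0 < ε n := fun n => by simp only [ε]; positivity
  let V : ℝ := volume.real (Metric.ball (0 : Euc N) 1)
  have hV : 0 < V := measureReal_ball_pos one_pos
  have hc0 : 0 < C / 2 := by positivity
  refine isCompactOperator_formResolvent (formSpace 𝕜 C s Ω)
    (A := fun n => kernelOp 𝕜 (memLp_ballKernel N (ε n) (volume.restrict Ω)))
    (fun n => isCompactOperator_kernelOp _)
    (c := fun n => Real.sqrt (ε n ^ (2 * s) / V / (C / 2))) ?_ (fun n => Real.sqrt_nonneg _) ?_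
  · have h1 : Tendsto (fun n => ε n ^ (2 * s)) atTop (𝓝 0) := by
      have h2 : Tendsto ε atTop (𝓝 0) := tendsto_one_div_add_atTop_nhds_zero_nat
      have h3 := h2.rpow_const (p := 2 * s) (Or.inr (by positivity))
      rwa [Real.zero_rpow (by positivity)] at h3
    have h4 := (((h1.div_const V).div_const (C / 2))).sqrt
    simpa using h4
  · intro n w hw
    obtain ⟨φ, hφ, h1, h2⟩ := mem_formSpace.1 hw
    have hφi : Integrable φ := hφ.1.continuous.integrable_of_hasCompactSupport hφ.2.1
    have e1 : ‖w.fst - kernelOp 𝕜 (memLp_ballKernel N (ε n) (volume.restrict Ω)) w.fst‖ₑ ^ 2 ≤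
        ∫⁻ y, ‖φ y - ∫ ξ, ballKernel N (ε n) (y - ξ) • φ ξ‖ₑ ^ 2 := by
      rw [enorm_Lp_sq]
      refine le_trans (le_of_eq (lintegral_congr_ae ?_)) (setLIntegral_le_lintegral Ω _)
      filter_upwards [Lp.coeFn_sub w.fst (kernelOp 𝕜 (memLp_ballKernel N (ε n)
        (volume.restrict Ω)) w.fst), h1, kernelOp_coeFn (𝕜 := 𝕜) (memLp_ballKernel N (ε n)
        (volume.restrict Ω)) w.fst] with y a1 a2 a3
      -- Test functions vanish outside `Ω`, so averaging inside `Ω` agrees with averaging in the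
      -- whole space; no extension operator is involved.
      have a4 : ∫ ξ in Ω, ballKernel N (ε n) (y - ξ) • w.fst ξ =
          ∫ ξ, ballKernel N (ε n) (y - ξ) • φ ξ := by
        rw [← setIntegral_eq_integral_of_forall_compl_eq_zero (s := Ω)
          (f := fun ξ => ballKernel N (ε n) (y - ξ) • φ ξ) (fun ξ hξ => by
          rw [image_eq_zero_of_notMem_tsupport (fun h => hξ (hφ.2.2 h)), smul_zero])]
        refine integral_congr_ae ?_
        filter_upwards [h1] with ξ hξ
        rw [hξ]
      rw [a1, Pi.sub_apply, a3, a2, a4]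
    have e2 : ‖w.snd‖ₑ ^ 2 =
        ENNReal.ofReal (C / 2) * ∫⁻ p, ‖diffQuot s φ p‖ₑ ^ 2 ∂(volume.prod volume) := by
      rw [enorm_Lp_sq, ← lintegral_const_mul'' _ ((aestronglyMeasurable_diffQuot s
        hφi.1).enorm.pow_const 2)]
      refine lintegral_congr_ae ?_
      filter_upwards [h2] with p hp
      rw [hp, Pi.smul_apply, enorm_smul, mul_pow, Real.enorm_of_nonneg (Real.sqrt_nonneg _),
        ← ENNReal.ofReal_pow (Real.sqrt_nonneg _), Real.sq_sqrt hc0.le]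
    have e3 : ‖w.fst - kernelOp 𝕜 (memLp_ballKernel N (ε n) (volume.restrict Ω)) w.fst‖ₑ ^ 2 ≤
        ENNReal.ofReal (ε n ^ (2 * s) / V / (C / 2)) * ‖w.snd‖ₑ ^ 2 := by
      refine (e1.trans (lintegral_sub_average_sq_le hN hs (hε n) hφi)).trans (le_of_eq ?_)
      have hp : 0 ≤ ε n ^ (2 * s) / V / (C / 2) := by
        have := (hε n).le
        positivity
      rw [e2, ← mul_assoc, ← ENNReal.ofReal_mul hp, div_mul_cancel₀ _ hc0.ne']
    have e4 : ‖w.fst - kernelOp 𝕜 (memLp_ballKernel N (ε n) (volume.restrict Ω)) w.fst‖ ^ 2 ≤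
        (ε n ^ (2 * s) / V / (C / 2)) * ‖w.snd‖ ^ 2 := by
      have hp : 0 ≤ ε n ^ (2 * s) / V / (C / 2) := by
        have := (hε n).le
        positivity
      rw [← ofReal_norm, ← ofReal_norm, ← ENNReal.ofReal_pow (norm_nonneg _),
        ← ENNReal.ofReal_pow (norm_nonneg _), ← ENNReal.ofReal_mul hp,
        ENNReal.ofReal_le_ofReal_iff (by positivity)] at e3
      exact e3
    have e5 : ‖w.snd‖ ^ 2 ≤ ‖w‖ ^ 2 := by
      rw [WithLp.prod_norm_sq_eq_of_L2]
      exact le_add_of_nonneg_left (sq_nonneg _)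
    refine le_of_sq_le_sq ?_ (by positivity)
    rw [mul_pow, Real.sq_sqrt (by have := (hε n).le; positivity)]
    refine e4.trans (mul_le_mul_of_nonneg_left e5 ?_)
    have := (hε n).le
    positivity

/-- An element of the kernel is orthogonal to all test functions, hence zero by the fundamental
lemma of the calculus of variations. -/
theorem formResolvent_formSpace_eq_zero (C : ℝ) (hN : 1 ≤ N) (hs : 0 < s) (hs1 : s < 1)
    (hΩ : IsOpen Ω) {f : Lp 𝕜 2 (volume.restrict Ω)}
    (hf : formResolvent (formSpace 𝕜 C s Ω) f = 0) : f = 0 := by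
  rw [Lp.eq_zero_iff_ae_eq_zero, EventuallyEq, ae_restrict_iff' hΩ.measurableSet]
  have hloc : LocallyIntegrableOn f Ω volume :=
    locallyIntegrableOn_of_locallyIntegrable_restrict ((Lp.memLp f).locallyIntegrable (by norm_num))
  refine hΩ.ae_eq_zero_of_integral_contDiff_smul_eq_zero hloc fun φ h1 h2 h3 => ?_
  have hφ : IsTestFunction Ω fun y => (φ y : 𝕜) := by
    refine ⟨(RCLike.ofRealCLM (K := 𝕜)).contDiff.comp h1,
      h2.comp_left (g := RCLike.ofReal) (by simp), ?_⟩
    exact (closure_mono (Function.support_comp_subset (g := (RCLike.ofReal : ℝ → 𝕜))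
      (by simp) φ)).trans h3
  have h4 := formResolvent_eq_zero _ hf _ (IsTestFunction.toLp_mem_formSpace C hN hs hs1 hφ)
  rw [L2.inner_def] at h4
  rw [← setIntegral_eq_integral_of_forall_compl_eq_zero (s := Ω)
    (fun y hy => by rw [image_eq_zero_of_notMem_tsupport (fun hm => hy (h3 hm)), zero_smul]), ← h4]
  refine integral_congr_ae ?_
  filter_upwards [hφ.memLp.coeFn_toLp] with y hy
  have h5 : inner 𝕜 (hφ.memLp.toLp _ y) (f y) = φ y • f y := by
    rw [hy, RCLike.inner_apply, RCLike.conj_ofReal, RCLike.real_smul_eq_coe_mul, mul_comm]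
  exact h5.symm

end

end FracCyl

end

/-! ### The theorem on the cylinder -/

theorem theorem3p2 {𝕜 : Type*} [RCLike 𝕜] {N : ℕ} (hN : 1 ≤ N) {a b : ℝ} (hab : a < b)
    {Ω : Set (EuclideanSpace ℝ (Fin N))} (hΩ : IsOpen Ω) (hΩc : IsConnected Ω)
    (hΩb : Bornology.IsBounded Ω) {α s C : ℝ} (hα : 1 / 2 < α) (hα1 : α ≤ 1)
    (hs : 0 < s) (hs1 : s < 1) (hC : 0 < C) :
    IsSelfAdjoint (FracCyl.dirichletOp (𝕜 := 𝕜) C s hα1 hab hΩ) ∧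
    (∀ u : (FracCyl.dirichletOp (𝕜 := 𝕜) C s hα1 hab hΩ).domain,
      (u : FracCyl.L2Cyl 𝕜 a b Ω) ≠ 0 →
        0 < RCLike.re (inner 𝕜 (FracCyl.dirichletOp C s hα1 hab hΩ u)
          (u : FracCyl.L2Cyl 𝕜 a b Ω))) ∧
    ∃ ν : ℕ → ℝ, Monotone ν ∧ (∀ n, 0 < ν n) ∧ Tendsto ν atTop atTop ∧
      (∀ μ : 𝕜, FracCyl.IsEigenvalue (FracCyl.dirichletOp C s hα1 hab hΩ) μ ↔
        ∃ n, μ = (ν n : 𝕜)) ∧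
      ∃ e : HilbertBasis ℕ 𝕜 (FracCyl.L2Cyl 𝕜 a b Ω), ∀ n,
        ∃ u : (FracCyl.dirichletOp (𝕜 := 𝕜) C s hα1 hab hΩ).domain,
          (u : FracCyl.L2Cyl 𝕜 a b Ω) = e n ∧
            FracCyl.dirichletOp C s hα1 hab hΩ u = (ν n : 𝕜) • e n := by
  have hfin : IsFiniteMeasure (volume.restrict Ω) :=
    ⟨by rw [Measure.restrict_apply_univ]; exact hΩb.measure_lt_top⟩
  have hne : NeZero (volume.restrict Ω) :=
    ⟨by
      rw [Ne, Measure.restrict_eq_zero]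
      exact (hΩ.measure_pos volume hΩc.nonempty).ne'⟩
  obtain ⟨K, hK, hKs, hKi, hKp, hKR⟩ := FracCyl.isDirichletFracODE_iff (𝕜 := 𝕜) hab hα hα1
  -- Here `K` inverts the operator itself, so the shift is zero and `-t < c i` gives strict
  -- positivity.
  obtain ⟨ι, e, c, -, hc, hcf, hR⟩ := FracCyl.exists_hilbertBasis_diagonal hK hKs hKi hKp (t := 0)
    (fun f => by rw [zero_mul]; exact norm_nonneg f) (R := FracCyl.IsDirichletFracODE α a b)
    (fun u f hu hf => by rw [hKR u f hu hf, RCLike.ofReal_zero, zero_smul, add_zero])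
  -- In `y` the compact operator is `(1 + A)⁻¹`, so the shift is one, and contractivity gives `d j ≥
  -- 0`.
  obtain ⟨κ, f, d, hd, -, hdf, hS⟩ := FracCyl.exists_hilbertBasis_diagonal
    (FracCyl.isCompactOperator_formResolvent_formSpace (𝕜 := 𝕜) hC hN hs hΩb)
    (FracCyl.formResolvent_isSymmetric _)
    (fun f hf => FracCyl.formResolvent_formSpace_eq_zero C hN hs hs1 hΩ hf) (FracCyl.formResolvent_nonneg _)
    (t := 1) (fun f => by rw [one_mul]; exact FracCyl.norm_formResolvent_le _ f)
    (R := FracCyl.IsFracDirichletLap C s Ω)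
    (fun u f hu hf => FracCyl.isFracDirichletLap_iff hC hN hs hs1 hΩ hΩb hu hf)
  simp only [neg_zero] at hc
  have := FracCyl.countable_of_finite_sublevels hcf
  have := FracCyl.countable_of_finite_sublevels hdf
  -- Infinitely many indices in `x` and at least one in `y` make the product index set infinite, as
  -- required for an enumeration by `ℕ`.
  have := FracCyl.infinite_of_hilbertBasis_Lp_Ioo hab e
  have := FracCyl.nonempty_of_hilbertBasis_Lp f
  obtain ⟨E, hE⟩ := FracCyl.exists_hilbertBasis_slicewise_sum
    (ρ := (volume : Measure (ℝ × EuclideanSpace ℝ (Fin N))).restrict (Ioo a b ×ˢ Ω))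
    (by rw [Measure.volume_eq_prod, Measure.prod_restrict]) e f hc hd hR hS
  refine FracCyl.diagonal_operator_spectral E (fun p => c p.1 + d p.2)
    (fun p => add_pos_of_pos_of_nonneg (hc _) (hd _)) (fun M => ?_) _ fun u v => ?_
  · refine ((hcf M).prod (hdf M)).subset fun p hp => ?_
    have hp' : c p.1 + d p.2 ≤ M := hp
    have h1 := hd p.2
    have h2 := hc p.1
    exact ⟨show c p.1 ≤ M by linarith, show d p.2 ≤ M by linarith⟩
  · rw [FracCyl.dirichletOp_graph, ← hE]
    rfl
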